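/- Let $F$ be a finite set of associative-commutative (AC) binary symbols, $C$ a set of constants, and $S$ a finite set of equations between ground terms over $F\cup C$. $ACCC(S)$ denotes the smallest congruence on ground terms that contains $S$ and all ground instances of associativity and commutativity of the symbols in $F$. *Extended signature.* Let $K\supseteq C$ be a finite set of constants with a total ordering $\gg_C$. $S$ is flattened and purified with constants of $K\setminus C$: each distinct (modulo AC) nonconstant subterm of $S$ that is an argument of a different symbol, or a side of an equation whose two sides have different outermost symbols, is named by its own constant $u\in K\setminus C$. In place of $S$ one gets a finite set $S_C$ of equations between constants and, for each $f\in F$, a finite set $S_f$ of equations $f(A)=f(B)$ between $f$-monomials, where $A,B$ are nonempty finite multisets over $K$ and $f(\{c\})$ stands for $c$ (the defining equations $f(A)=u$ of the new constants included). *Orderings.* For each $f\in F$ let $\gg_f$ be a well-founded total ordering on $f$-monomials over $K$ that extends $\gg_C$, is admissible ($f(A)\gg_f f(B)$ if $B\subsetneq A$; and $f(A_1)\gg_f f(A_2)$ implies $f(A_1\cup B)\gg_f f(A_2\cup B)$, unions being multiset sums), and makes every nonconstant $f$-monomial bigger than every constant. *Subprocedures.* For a set $E$ of constant equations, $\mathrm{canon}(E)$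 is the set of rules $c\to\hat c$ with $\hat c\neq c$ the $\gg_C$-least constant equal to $c$ modulo $E$. A rule $f(A)\to f(B)$ rewrites $f(M)$ with $A\subseteq M$ to $f((M-A)\cup B)$. The critical pair of $f(A_1)\to f(A_2)$ and $f(B_1)\to f(B_2)$ is $(f((AB-A_1)\cup A_2),\,f((AB-B_1)\cup B_2))$ with $AB=(A_1\cup B_1)-(A_1\cap B_1)$. To *process* an equation with the current rules $R$: compute normal forms of its sides with $R$; if they are equal, discard it; otherwise orient them by $\gg_f$ into a rule $\rho$, form the critical pairs of $\rho$ with all rules of $R$, and add $\rho$ to $R$ with interreduction (a rule whose left side is reduced by $\rho$ is removed from $R$ and becomes a pending equation again; a right side reduced by $\rho$ is replaced by a normal form). - **SingleACCompletion**$(E,\gg_f)$: start with $R=\emptyset$ and pending equations $E$; process pending equations, adding the critical pairs to the pending ones, until none is pending. - **update$_{AC}$**$(R_f,R_C,\gg_f)$: let $Q$ be the rules of $R_f$ whose left side is reducible by $R_C$; start with $R=R_C\cup(R_f\setminus Q)$ and process the equations in $Q$ in passes, the pending equations of the next pass being those from interreduction and the normal forms with $R$ (before the new rule is added) of those critical pairs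 for which they differ; stop when none is pending. Return $R$ and the set of constant rules $\rho$ that were added. *Algorithm CombinationMultAC.* Put $R_C=\mathrm{canon}(S_C)$. For each $f$, normalize $S_f$ by $R_C$ and let $R_f$ be the result of SingleACCompletion. Let $N$ be the set of all constant rules in the $R_f$. If $\mathrm{canon}(R_C\cup N)=R_C$, return; otherwise replace $R_C$ by $\mathrm{canon}(R_C\cup N)$ and repeat: apply update$_{AC}$ with $R_C$ to every $R_f$ that has a rule with left side reducible by $R_C$, and let $N$ be the set of new constant rules so obtained; if $N=\emptyset$, return, otherwise replace $R_C$ by $\mathrm{canon}(R_C\cup N)$. The result is $R_S=R_C\cup\bigcup_{f\in F}R_f$. **Theorem 7.1.** Every run of this algorithm, whatever selections, visiting orders and normal forms it uses, terminates and returns a finite system $R_S$ such that 1. every rule of $R_C$ is oriented by $\gg_C$ and every rule of $R_f$ by $\gg_f$; 2. $R_S$ is canonical: its rewrite relation, on all ground terms over $F\cup K$ modulo AC, is terminating and locally confluent; 3. in the extended signature, $ACCC(R_S)=ACCC(S_C\cup\bigcup_f S_f)$, the rules of $R_S$ being read as equations; 4. for ground terms $u,v$ over the original signature $F\cup C$: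 $u=v\in ACCC(R_S)$ if and only if $u=v\in ACCC(S)$. -/

import Mathlib

namespace ACClosure

/-! ### Ground terms and AC congruence closure -/

/-- Ground terms over constants `C` and binary function symbols `F` (all of them AC symbols). -/
inductive GTerm (F C : Type*) where
  | const (c : C) : GTerm F C
  | app (f : F) (s t : GTerm F C) : GTerm F C

/-- Renaming of constants (used for the inclusion of a signature in an extended one). -/
def GTerm.map {F C K : Type*} (i : C → K) : GTerm F C → GTerm F K
  | .const c => .const (i c)
  | .app f s t => .app f (s.map i) (t.map i)

/-- The outermost function symbol of a term, `none` for a constant. -/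
def GTerm.head {F C : Type*} : GTerm F C → Option F
  | .const _ => none
  | .app f _ _ => some f

/-- The AC congruence closure of a set `E` of ground equations: the smallest congruence that
contains `E` and all ground instances of associativity and commutativity of every symbol. -/
inductive ACCC {F C : Type*} (E : Set (GTerm F C × GTerm F C)) : GTerm F C → GTerm F C → Prop
  | ax (s t : GTerm F C) : (s, t) ∈ E → ACCC E s t
  | refl (s : GTerm F C) : ACCC E s s
  | symm (s t : GTerm F C) : ACCC E s t → ACCC E t s
  | trans (s t u : GTerm F C) : ACCC E s t → ACCC E t u → ACCC E s u
  | congr (f : F) (s s' t t' : GTerm F C) :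
      ACCC E s s' → ACCC E t t' → ACCC E (.app f s t) (.app f s' t')
  | comm (f : F) (s t : GTerm F C) : ACCC E (.app f s t) (.app f t s)
  | assoc (f : F) (s t u : GTerm F C) :
      ACCC E (.app f s (.app f t u)) (.app f (.app f s t) u)

/-- Equality of ground terms modulo AC. -/
instance acSetoid (F C : Type*) : Setoid (GTerm F C) where
  r := ACCC ∅
  iseqv := ⟨ACCC.refl, fun {s t} h => ACCC.symm s t h, fun {s t u} h h' => ACCC.trans s t u h h'⟩

/-- Flattened ground terms: arguments of an AC symbol form a multiset, that is, ground terms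
are taken modulo AC. -/
abbrev ACTerm (F C : Type*) : Type _ := Quotient (acSetoid F C)

/-! ### Rewriting of ground terms modulo AC -/

/-- One application of a ground rule of `R` to a subterm. -/
inductive TermStep {F C : Type*} (R : Set (GTerm F C × GTerm F C)) :
    GTerm F C → GTerm F C → Prop
  | rule (s t : GTerm F C) : (s, t) ∈ R → TermStep R s t
  | left (f : F) (s s' t : GTerm F C) : TermStep R s s' → TermStep R (.app f s t) (.app f s' t)
  | right (f : F) (s t t' : GTerm F C) : TermStep R t t' → TermStep R (.app f s t) (.app f s t')

/-- The rewrite relation on flattened terms. On an `f`-monomial, a rule `f(A) → f(B)` rewrites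
`f(M)` with `A ⊆ M` to `f((M - A) + B)`. -/
def ACStep {F C : Type*} (R : Set (GTerm F C × GTerm F C)) (x y : ACTerm F C) : Prop :=
  ∃ s t : GTerm F C, Quotient.mk _ s = x ∧ Quotient.mk _ t = y ∧ TermStep R s t

/-- There are no infinite chains `t 0 → t 1 → t 2 → ⋯`. -/
def Terminating {α : Type*} (r : α → α → Prop) : Prop :=
  ¬ ∃ t : ℕ → α, ∀ n, r (t n) (t (n + 1))

def LocallyConfluent {α : Type*} (r : α → α → Prop) : Prop :=
  ∀ t u₁ u₂, r t u₁ → r t u₂ →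
    ∃ v, Relation.ReflTransGen r u₁ v ∧ Relation.ReflTransGen r u₂ v

def Canonical {α : Type*} (r : α → α → Prop) : Prop :=
  Terminating r ∧ LocallyConfluent r

/-! ### Monomials, admissible orderings, rewriting of monomials -/

/-- A set of pairs of `f`-monomials (for a fixed `f`), read as equations or as rewrite rules.
The `f`-monomial `f(M)` is represented by the nonempty multiset `M`; the singleton `{c}` is the
constant `c`. -/
abbrev Rules (K : Type*) : Type _ := Set (Multiset K × Multiset K)

/-- `IsMono f M t`: the term `t` is one of the ways to write the `f`-monomial `f(M)`. -/
inductive IsMono {F K : Type*} (f : F) : Multiset K → GTerm F K → Prop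
  | const (c : K) : IsMono f {c} (.const c)
  | app (A B : Multiset K) (s t : GTerm F K) :
      IsMono f A s → IsMono f B t → IsMono f (A + B) (.app f s t)

/-- `gt A B` stands for `f(A) ≫ f(B)`: a well-founded total admissible ordering on (nonempty)
monomials that extends the ordering of the constants, with nonconstant monomials bigger than
constants. -/
structure IsAdmissible {K : Type*} [LinearOrder K] (gt : Multiset K → Multiset K → Prop) :
    Prop where
  irrefl : ∀ A, A ≠ 0 → ¬ gt A A
  trans : ∀ A B D, A ≠ 0 → B ≠ 0 → D ≠ 0 → gt A B → gt B D → gt A D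
  total : ∀ A B, A ≠ 0 → B ≠ 0 → A ≠ B → gt A B ∨ gt B A
  wf : ¬ ∃ A : ℕ → Multiset K, (∀ n, A n ≠ 0) ∧ ∀ n, gt (A n) (A (n + 1))
  subterm : ∀ A B, B ≠ 0 → B < A → gt A B
  compat : ∀ A₁ A₂ B, A₁ ≠ 0 → A₂ ≠ 0 → gt A₁ A₂ → gt (A₁ + B) (A₂ + B)
  extendsConst : ∀ a b : K, b < a → gt {a} {b}
  constSmall : ∀ (A : Multiset K) (c : K), 2 ≤ Multiset.card A → gt A {c}

section Monomials

variable {K : Type*} [LinearOrder K]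

/-- One-step rewriting of monomials. -/
def RStep (R : Rules K) (M M' : Multiset K) : Prop :=
  ∃ p ∈ R, p.1 ≤ M ∧ M' = (M - p.1) + p.2

def Normal (R : Rules K) (M : Multiset K) : Prop := ∀ M', ¬ RStep R M M'

/-- `N` is a normal form of `M`. -/
def IsNF (R : Rules K) (M N : Multiset K) : Prop :=
  Relation.ReflTransGen (RStep R) M N ∧ Normal R N

/-- `nf` computes a normal form of every monomial (normal forms need not be unique). -/
def ComputesNF (R : Rules K) (nf : Multiset K → Multiset K) : Prop := ∀ M, IsNF R M (nf M)

/-- The critical pair of two rules, obtained from the superposition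
`(A₁ + B₁) - (A₁ ∩ B₁)` of their left sides `A₁`, `B₁`. -/
def critPair (p q : Multiset K × Multiset K) : Multiset K × Multiset K :=
  let AB := (p.1 + q.1) - (p.1 ∩ q.1)
  ((AB - p.1) + p.2, (AB - q.1) + q.2)

/-- `p` is the rule obtained by orienting the equation `s = t`. -/
def Orients (gt : Multiset K → Multiset K → Prop) (s t : Multiset K)
    (p : Multiset K × Multiset K) : Prop :=
  gt p.1 p.2 ∧ (p = (s, t) ∨ p = (t, s))

/-- The rules of `R` whose left side is reduced by the rule `p`. -/
def removedBy (R : Rules K) (p : Multiset K × Multiset K) : Rules K := {q ∈ R | p.1 ≤ q.1}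

/-- The rules of `R` whose left side is not reduced by the rule `p`. -/
def keptBy (R : Rules K) (p : Multiset K × Multiset K) : Rules K := {q ∈ R | ¬ p.1 ≤ q.1}

/-- Adding the rule `p` to `R` and interreducing: rules with a left side reduced by `p` are dropped,
and a right side that `p` reduces is reduced by `p` and then normalized with `nf`. -/
def interreduce (R : Rules K) (p : Multiset K × Multiset K) (nf : Multiset K → Multiset K) :
    Rules K :=
  insert p {q' | ∃ q ∈ keptBy R p,
    q' = if p.1 ≤ q.2 then (q.1, nf ((q.2 - p.1) + p.2)) else q}

/-! ### Constant rules -/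

/-- The reduced canonical system of a set of constant equations:
all rules `c → d`, where `d ≠ c` is the least element of the congruence class of `c`.
Updating a constant system `RC` with new constant rules `N` gives `constSystem (RC ∪ N)`. -/
def constSystem (E : Set (K × K)) : Set (K × K) :=
  {p | p.1 ≠ p.2 ∧ Relation.EqvGen (fun a b => (a, b) ∈ E) p.1 p.2 ∧
    ∀ e, Relation.EqvGen (fun a b => (a, b) ∈ E) p.1 e → p.2 ≤ e}

/-- Constant rules as rules on monomials. -/
def constRules (RC : Set (K × K)) : Rules K := {p | ∃ c d, (c, d) ∈ RC ∧ p = ({c}, {d})}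

/-- The constant rules in a set of rules on monomials. -/
def constPart (R : Rules K) : Set (K × K) := {p | (({p.1} : Multiset K), ({p.2} : Multiset K)) ∈ R}

/-- Replacing constants in a set of equations by their canonical forms. -/
def normalizeBy (RC : Set (K × K)) (E : Rules K) : Rules K :=
  {e' | ∃ e ∈ E, IsNF (constRules RC) e.1 e'.1 ∧ IsNF (constRules RC) e.2 e'.2}

/-- The rules of `R` whose left side is not in canonical form with respect to `RC`. -/
def affected (RC : Set (K × K)) (R : Rules K) : Rules K :=
  {q ∈ R | ¬ Normal (constRules RC) q.1}

/-! ### Completion for a single AC symbol -/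

/-- One round of completion. The state is `(R, T)`: current rules, and equations still to be
processed. -/
inductive CompletionStep (gt : Multiset K → Multiset K → Prop) :
    Rules K × Rules K → Rules K × Rules K → Prop
  | discard (R T : Rules K) (e : Multiset K × Multiset K) (nf : Multiset K → Multiset K) :
      e ∈ T → ComputesNF R nf → nf e.1 = nf e.2 →
      CompletionStep gt (R, T) (R, T \ {e})
  | add (R T : Rules K) (e p : Multiset K × Multiset K) (nf nf' : Multiset K → Multiset K) :
      e ∈ T → ComputesNF R nf → nf e.1 ≠ nf e.2 → Orients gt (nf e.1) (nf e.2) p →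
      ComputesNF (insert p (keptBy R p)) nf' →
      CompletionStep gt (R, T)
        (interreduce R p nf', (T \ {e}) ∪ {c | ∃ q ∈ R, c = critPair p q} ∪ removedBy R p)

/-! ### Updating the canonical system of an AC symbol with constant rules -/

/-- State of the update procedure: current rules, new constant rules found so far, equations of the
current pass, equations for the next pass. -/
structure UpdState (K : Type*) where
  R : Rules K
  NRC : Set (K × K)
  S : Rules K
  T : Rules K

/-- Start of the update of `R` with the constant system `RC`. -/
def updStart (R : Rules K) (RC : Set (K × K)) : UpdState K :=
  ⟨constRules RC ∪ (R \ affected RC R), ∅, affected RC R, ∅⟩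

inductive UpdateStep (gt : Multiset K → Multiset K → Prop) : UpdState K → UpdState K → Prop
  | discard (R : Rules K) (NRC : Set (K × K)) (S T : Rules K) (e : Multiset K × Multiset K)
      (nf : Multiset K → Multiset K) :
      e ∈ S → ComputesNF R nf → nf e.1 = nf e.2 →
      UpdateStep gt ⟨R, NRC, S, T⟩ ⟨R, NRC, S \ {e}, T⟩
  | add (R : Rules K) (NRC : Set (K × K)) (S T : Rules K) (e p : Multiset K × Multiset K)
      (nf nf' : Multiset K → Multiset K) :
      e ∈ S → ComputesNF R nf → nf e.1 ≠ nf e.2 → Orients gt (nf e.1) (nf e.2) p →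
      ComputesNF (insert p (keptBy R p)) nf' →
      UpdateStep gt ⟨R, NRC, S, T⟩
        ⟨interreduce R p nf', NRC ∪ constPart {p}, S \ {e},
          T ∪ {c | ∃ q ∈ R, nf (critPair p q).1 ≠ nf (critPair p q).2 ∧
              c = (nf (critPair p q).1, nf (critPair p q).2)} ∪ removedBy R p⟩
  | nextPass (R : Rules K) (NRC : Set (K × K)) (T : Rules K) :
      T ≠ ∅ → UpdateStep gt ⟨R, NRC, ∅, T⟩ ⟨R, NRC, T, ∅⟩

end Monomials

/-! ### The combination algorithm for several AC symbols -/

/-- Configurations of the combination algorithm. `RC` is the current constant system, `R f` the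
current system of the symbol `f`, `N` the new constant rules collected in the current loop, `todo`
the symbols that the current loop still has to visit. -/
inductive Config (F K : Type*) where
  /-- the loop that completes the equations of each symbol separately -/
  | firstLoop (RC N : Set (K × K)) (todo : Set F) (R : F → Rules K)
  /-- inside the first loop, completion for the symbol `f` -/
  | completing (RC N : Set (K × K)) (todo : Set F) (R : F → Rules K) (f : F)
      (st : Rules K × Rules K)
  /-- the loop that propagates `RC` to the systems of the symbols -/
  | propagating (RC N : Set (K × K)) (todo : Set F) (R : F → Rules K)
  /-- inside the propagation loop, update of the system of the symbol `f` -/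
  | updating (RC N : Set (K × K)) (todo : Set F) (R : F → Rules K) (f : F) (st : UpdState K)
  /-- the algorithm has returned `RC ∪ ⋃ f, R f` -/
  | done (RC : Set (K × K)) (R : F → Rules K)

/-- The (nondeterministic) steps of the combination algorithm on the equations `Sf f` between
`f`-monomials, with the orderings `gt f`. -/
inductive CombStep {F K : Type*} [DecidableEq F] [LinearOrder K]
    (gt : F → Multiset K → Multiset K → Prop) (Sf : F → Rules K) :
    Config F K → Config F K → Prop
  | beginCompletion (RC N : Set (K × K)) (todo : Set F) (R : F → Rules K) (f : F) :
      f ∈ todo →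
      CombStep gt Sf (.firstLoop RC N todo R)
        (.completing RC N (todo \ {f}) R f (∅, normalizeBy RC (Sf f)))
  | completion (RC N : Set (K × K)) (todo : Set F) (R : F → Rules K) (f : F)
      (st st' : Rules K × Rules K) :
      CompletionStep (gt f) st st' →
      CombStep gt Sf (.completing RC N todo R f st) (.completing RC N todo R f st')
  | endCompletion (RC N : Set (K × K)) (todo : Set F) (R : F → Rules K) (f : F) (Rf : Rules K) :
      CombStep gt Sf (.completing RC N todo R f (Rf, ∅))
        (.firstLoop RC (N ∪ constPart Rf) todo (Function.update R f Rf))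
  | noNewConst (RC N : Set (K × K)) (R : F → Rules K) :
      constSystem (RC ∪ N) = RC →
      CombStep gt Sf (.firstLoop RC N ∅ R) (.done RC R)
  | newConst (RC N : Set (K × K)) (R : F → Rules K) :
      constSystem (RC ∪ N) ≠ RC →
      CombStep gt Sf (.firstLoop RC N ∅ R) (.propagating (constSystem (RC ∪ N)) ∅ Set.univ R)
  | skipUpdate (RC N : Set (K × K)) (todo : Set F) (R : F → Rules K) (f : F) :
      f ∈ todo → affected RC (R f) = ∅ →
      CombStep gt Sf (.propagating RC N todo R) (.propagating RC N (todo \ {f}) R)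
  | beginUpdate (RC N : Set (K × K)) (todo : Set F) (R : F → Rules K) (f : F) :
      f ∈ todo → affected RC (R f) ≠ ∅ →
      CombStep gt Sf (.propagating RC N todo R)
        (.updating RC N (todo \ {f}) R f (updStart (R f) RC))
  | update (RC N : Set (K × K)) (todo : Set F) (R : F → Rules K) (f : F) (st st' : UpdState K) :
      UpdateStep (gt f) st st' →
      CombStep gt Sf (.updating RC N todo R f st) (.updating RC N todo R f st')
  | endUpdate (RC N : Set (K × K)) (todo : Set F) (R : F → Rules K) (f : F)
      (Rf : Rules K) (NRC : Set (K × K)) :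
      CombStep gt Sf (.updating RC N todo R f ⟨Rf, NRC, ∅, ∅⟩)
        (.propagating RC (N ∪ NRC) todo (Function.update R f Rf))
  | finish (RC : Set (K × K)) (R : F → Rules K) :
      CombStep gt Sf (.propagating RC ∅ ∅ R) (.done RC R)
  | nextRound (RC N : Set (K × K)) (R : F → Rules K) :
      N ≠ ∅ →
      CombStep gt Sf (.propagating RC N ∅ R)
        (.propagating (constSystem (RC ∪ N)) ∅ Set.univ R)

/-- The first configuration of the algorithm on the constant equations `SC`. -/
def combStart {F K : Type*} [LinearOrder K] (SC : Set (K × K)) : Config F K :=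
  .firstLoop (constSystem SC) ∅ Set.univ (fun _ => ∅)

/-- The ground term pairs `c = d` for `(c, d) ∈ SC` and `f(A) = f(B)` for `(A, B) ∈ Sf f`, read as
equations or as rules. -/
def toTermPairs {F K : Type*} (SC : Set (K × K)) (Sf : F → Rules K) :
    Set (GTerm F K × GTerm F K) :=
  {e | (∃ c d, (c, d) ∈ SC ∧ e = (.const c, .const d)) ∨
    ∃ f A B, (A, B) ∈ Sf f ∧ IsMono f A e.1 ∧ IsMono f B e.2}

/-! ### Flattening and purification -/

section Purification

variable {F C K : Type*} [DecidableEq F]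

/-- The nonconstant subterms that are replaced by new constants in a flattened term that stands as
an argument of the symbol `h` (`h = none`: as a side of an equation between constants): those whose
outermost symbol differs from the symbol directly above. -/
def GTerm.aliens : Option F → GTerm F C → Set (GTerm F C)
  | _, .const _ => ∅
  | h, .app g s t =>
      {u | u = .app g s t ∧ h ≠ some g} ∪ GTerm.aliens (some g) s ∪ GTerm.aliens (some g) t

/-- The symbol `f` such that the purified equation is one between `f`-monomials; `none` if both
sides are constants or their outermost symbols differ, where the result is a constant equation. -/
def eqSymbol (e : GTerm F C × GTerm F C) : Option F :=
  match e.1.head, e.2.head with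
  | some f, some g => if f = g then some f else none
  | some f, none => some f
  | none, some g => some g
  | none, none => none

/-- All the nonconstant subterms of `S` that get a name. -/
def aliensOf (S : Set (GTerm F C × GTerm F C)) : Set (GTerm F C) :=
  {u | ∃ e ∈ S, u ∈ e.1.aliens (eqSymbol e) ∨ u ∈ e.2.aliens (eqSymbol e)}

/-- `K` is the set of constants of the extended signature, `i` the inclusion of the original
constants, and `ν` names the flattened nonconstant subterms by new constants, one for each. -/
structure IsNaming (i : C ↪ K) (S : Set (GTerm F C × GTerm F C)) (ν : ACTerm F C → K) :
    Prop where
  fresh : ∀ u ∈ aliensOf S, ∀ c, ν (Quotient.mk _ u) ≠ i c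
  inj : ∀ u ∈ aliensOf S, ∀ v ∈ aliensOf S, ν (Quotient.mk _ u) = ν (Quotient.mk _ v) →
    (Quotient.mk _ u : ACTerm F C) = Quotient.mk _ v

/-- The constant that stands for a term. -/
def GTerm.name (i : C ↪ K) (ν : ACTerm F C → K) : GTerm F C → K
  | .const c => i c
  | .app g s t => ν (Quotient.mk _ (.app g s t))

/-- The arguments of the flattened term under `f`, with nonconstant arguments replaced by their
names. -/
def GTerm.flat (i : C ↪ K) (ν : ACTerm F C → K) (f : F) : GTerm F C → Multiset K
  | .const c => {i c}
  | .app g s t =>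
      if g = f then GTerm.flat i ν f s + GTerm.flat i ν f t
      else {GTerm.name i ν (.app g s t)}

/-- The constant equations of the purified `S`. -/
def purifyConst (i : C ↪ K) (ν : ACTerm F C → K) (S : Set (GTerm F C × GTerm F C)) :
    Set (K × K) :=
  {p | ∃ e ∈ S, eqSymbol e = none ∧ p = (e.1.name i ν, e.2.name i ν)}

/-- The equations between `f`-monomials of the purified `S`: equations of `S`, and the
defining equations `f(⋯) = u` of the new constants. -/
def purifyAC (i : C ↪ K) (ν : ACTerm F C → K) (S : Set (GTerm F C × GTerm F C)) (f : F) :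
    Rules K :=
  {p | (∃ e ∈ S, eqSymbol e = some f ∧ p = (e.1.flat i ν f, e.2.flat i ν f)) ∨
    ∃ u ∈ aliensOf S, u.head = some f ∧ p = (u.flat i ν f, {u.name i ν})}

end Purification

end ACClosure

open ACClosure

set_option linter.unusedSectionVars false

/-! Completion is controlled by connectedness below a bound. While equations `P` are pending, a
critical pair of the rules `R` need not be joinable, but it is always connected by instances of `R ∪
P` through monomials smaller than the superposition (`Good`). Discarding an equation, adding a rule
and interreducing preserve this (`conn_discard`, `AddStep.good`), because whatever is replaced is
recovered by reductions, and these only descend. When nothing is pending, well-founded induction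
along the connections gives unique normal forms (`nf_unique`) and the Church-Rosser property
(`nf_eq_of_cong`).

A completion or update ends because the left side of an added rule is irreducible: the upward closed
set of reducible monomials grows strictly, which Dickson's lemma allows only finitely often
(`wellFounded_upperSet`), and between additions the pending equations are used up. The propagation
rounds end because every new constant rule has a left side irreducible by `RC`, so the number of
irreducible constants falls (`constSystem_union_dom_lt`).

On return, the constant rules of each `R f` belong to `RC`, and `R f` either contains `RC` or has
left sides without constants reducible by `RC`, so that no overlap with `RC` arises. Hence `RC ∪ R
f` has unique normal forms for each `f`, and all symbols agree on the constants
(`exists_normalForms`). Normalizing a term bottom up, the constants under each symbol at a time,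
yields a form that is invariant under the congruence closure and reachable by rewriting; this gives
confluence (`NormalForms.locallyConfluent`). For termination a term is cut into maximal blocks
formed with one symbol: a step lowers the number of blocks, or keeps it and decreases one block in
the ordering of its own symbol (`TermStep.blocks`). The orderings of different symbols need to agree
on constants only.

Presentations are compared semantically: the steps of the algorithm do not change which congruence
closures satisfy the current equations, and this determines the closure presented
(`accc_iff_of_sat_iff`). Conservativity of purification comes from interpreting each new constant by
the term it names (`accc_of_accc_map`). -/

namespace ACClosure


/-! ### Orderings of monomials -/

/-- The strict ordering of nonempty monomials given by `gt`. -/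
def ltOf {K : Type*} (gt : Multiset K → Multiset K → Prop) (A B : Multiset K) : Prop :=
  A ≠ 0 ∧ B ≠ 0 ∧ gt B A

/-- A well-founded ordering of nonempty multisets that is compatible with sums, extends the
ordering of the singletons, and has the singletons as an initial segment. -/
structure MonoOrder {K : Type*} [LinearOrder K] (lt : Multiset K → Multiset K → Prop) :
    Prop where
  wf : WellFounded lt
  trans : ∀ {A B C}, lt A B → lt B C → lt A C
  add : ∀ {A B} (C), lt A B → lt (A + C) (B + C)
  ne_zero : ∀ {A B}, lt A B → A ≠ 0 ∧ B ≠ 0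
  single : ∀ {a b : K}, b < a → lt {b} {a}
  of_single : ∀ {B} {a : K}, lt B {a} → ∃ b, B = {b} ∧ b < a

/-- Admissibility says nothing about the empty multiset; excluding it on both sides makes the
relation well founded on all multisets. Only singletons lie below a singleton, since `constSmall`
puts every larger monomial above it and the ordering is asymmetric. -/
theorem IsAdmissible.monoOrder {K : Type*} [LinearOrder K] {gt : Multiset K → Multiset K → Prop}
    (h : IsAdmissible gt) : MonoOrder (ltOf gt) where
  wf := by
    rw [wellFounded_iff_isEmpty_descending_chain]
    refine ⟨fun ⟨s, hs⟩ => h.wf ⟨s, fun n => (hs n).2.1, fun n => (hs n).2.2⟩⟩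
  trans := fun h1 h2 => ⟨h1.1, h2.2.1, h.trans _ _ _ h2.2.1 h1.2.1 h1.1 h2.2.2 h1.2.2⟩
  add := fun C h1 => ⟨by simp [h1.1], by simp [h1.2.1], h.compat _ _ C h1.2.1 h1.1 h1.2.2⟩
  ne_zero := fun h1 => ⟨h1.1, h1.2.1⟩
  single := fun h1 => ⟨by simp, by simp, h.extendsConst _ _ h1⟩
  of_single := by
    rintro B a ⟨hB, ha, hg⟩
    have key : ∀ C, C ≠ 0 → gt {a} C → ¬ gt C {a} := fun C hC h1 h2 =>
      h.irrefl {a} ha (h.trans _ _ _ ha hC ha h1 h2)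
    rcases Nat.lt_or_ge (Multiset.card B) 2 with h2 | h2
    · have : Multiset.card B = 1 := by
        have := Multiset.card_pos.2 hB
        omega
      obtain ⟨b, rfl⟩ := Multiset.card_eq_one.1 this
      refine ⟨b, rfl, ?_⟩
      rcases lt_trichotomy b a with hl | rfl | hl
      · exact hl
      · exact absurd hg (h.irrefl _ ha)
      · exact absurd (h.extendsConst _ _ hl) (key _ hB hg)
    · exact absurd (h.constSmall B a h2) (key _ hB hg)

/-! ### Connectedness of monomials below a bound -/

section Connected

variable {K : Type*}

/-- The equivalence generated by the equations `E` applied to monomials that satisfy `D`. -/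
def Conn (D : Multiset K → Prop) (E : Rules K) : Multiset K → Multiset K → Prop :=
  Relation.EqvGen fun x y => D x ∧ D y ∧ ∃ e ∈ E, ∃ C, x = e.1 + C ∧ y = e.2 + C

/-- The congruence generated by the equations `E`. -/
abbrev Cong (E : Rules K) : Multiset K → Multiset K → Prop := Conn (fun _ => True) E

variable {D D' : Multiset K → Prop} {E E' R : Rules K}

theorem Conn.refl (x : Multiset K) : Conn D E x x := Relation.EqvGen.refl x

theorem Conn.symm {x y : Multiset K} (h : Conn D E x y) : Conn D E y x :=
  Relation.EqvGen.symm _ _ h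

theorem Conn.trans {x y z : Multiset K} (h : Conn D E x y) (h' : Conn D E y z) : Conn D E x z :=
  Relation.EqvGen.trans _ _ _ h h'

theorem Conn.of_mem {e : Multiset K × Multiset K} (he : e ∈ E) (C : Multiset K)
    (h1 : D (e.1 + C)) (h2 : D (e.2 + C)) : Conn D E (e.1 + C) (e.2 + C) :=
  Relation.EqvGen.rel _ _ ⟨h1, h2, e, he, C, rfl, rfl⟩

theorem Conn.rec_on {Q : Multiset K → Multiset K → Prop} (hQ : Equivalence Q)
    (h : ∀ e ∈ E, ∀ C, D (e.1 + C) → D (e.2 + C) → Q (e.1 + C) (e.2 + C)) {x y : Multiset K}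
    (hxy : Conn D E x y) : Q x y := by
  induction hxy with
  | rel x y h' =>
    obtain ⟨h1, h2, e, he, C, rfl, rfl⟩ := h'
    exact h e he C h1 h2
  | refl x => exact hQ.refl x
  | symm x y _ ih => exact hQ.symm ih
  | trans x y z _ _ ih1 ih2 => exact hQ.trans ih1 ih2

theorem Conn.equivalence : Equivalence (Conn D E) :=
  ⟨Conn.refl, Conn.symm, Conn.trans⟩

theorem Conn.mono (hD : ∀ x, D x → D' x) (hE : E ⊆ E') {x y : Multiset K}
    (h : Conn D E x y) : Conn D' E' x y :=
  h.rec_on Conn.equivalence fun _ he C h1 h2 => .of_mem (hE he) C (hD _ h1) (hD _ h2)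

theorem Conn.add (C : Multiset K) (hD : ∀ x, D x → D' (x + C)) {x y : Multiset K}
    (h : Conn D E x y) : Conn D' E (x + C) (y + C) := by
  refine h.rec_on (Q := fun x y => Conn D' E (x + C) (y + C))
    ⟨fun _ => .refl _, fun h => h.symm, fun h h' => h.trans h'⟩ fun e he B h1 h2 => ?_
  have h1' := hD _ h1
  have h2' := hD _ h2
  rw [add_assoc] at h1' h2' ⊢
  rw [add_assoc]
  exact .of_mem he _ h1' h2'

theorem Cong.add_right (C : Multiset K) {x y : Multiset K} (h : Cong E x y) :
    Cong E (x + C) (y + C) := Conn.add C (fun _ _ => trivial) h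

theorem Cong.add_left (C : Multiset K) {x y : Multiset K} (h : Cong E x y) :
    Cong E (C + x) (C + y) := by
  simpa [add_comm C] using Cong.add_right C h

theorem Cong.of_mem {e : Multiset K × Multiset K} (he : e ∈ E) : Cong E e.1 e.2 := by
  simpa using Conn.of_mem (D := fun _ => True) he 0 trivial trivial

theorem Cong.of_forall (h : ∀ e ∈ E, Cong E' e.1 e.2) {x y : Multiset K} (hxy : Cong E x y) :
    Cong E' x y :=
  hxy.rec_on Conn.equivalence fun e he C _ _ => Cong.add_right C (h e he)

/-! ### Rewriting of monomials -/

section Rewriting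

variable [LinearOrder K]

theorem rstep_iff {M M' : Multiset K} :
    RStep R M M' ↔ ∃ p ∈ R, ∃ C, M = p.1 + C ∧ M' = p.2 + C := by
  constructor
  · rintro ⟨p, hp, hle, rfl⟩
    exact ⟨p, hp, M - p.1, (add_tsub_cancel_of_le hle).symm, add_comm _ _⟩
  · rintro ⟨p, hp, C, rfl, rfl⟩
    exact ⟨p, hp, Multiset.le_add_right _ _, by simp [add_comm]⟩

theorem RStep.of_mem {p : Multiset K × Multiset K} (hp : p ∈ R) (C : Multiset K) :
    RStep R (p.1 + C) (p.2 + C) := rstep_iff.2 ⟨p, hp, C, rfl, rfl⟩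

theorem RStep.mono (h : R ⊆ E) {M M' : Multiset K} (hs : RStep R M M') : RStep E M M' := by
  obtain ⟨p, hp, h'⟩ := hs
  exact ⟨p, h hp, h'⟩

theorem RStep.add (C : Multiset K) {M M' : Multiset K} (hs : RStep R M M') :
    RStep R (M + C) (M' + C) := by
  obtain ⟨p, hp, B, rfl, rfl⟩ := rstep_iff.1 hs
  exact rstep_iff.2 ⟨p, hp, B + C, add_assoc _ _ _, add_assoc _ _ _⟩

theorem normal_iff {M : Multiset K} : Normal R M ↔ ∀ p ∈ R, ¬ p.1 ≤ M :=
  ⟨fun h p hp hle => h _ ⟨p, hp, hle, rfl⟩, fun h _ ⟨p, hp, hle, _⟩ => h p hp hle⟩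

/-- All rules decrease. -/
def Oriented (lt : Multiset K → Multiset K → Prop) (R : Rules K) : Prop := ∀ p ∈ R, lt p.2 p.1

variable {lt : Multiset K → Multiset K → Prop}

theorem Oriented.rstep (hlt : MonoOrder lt) (hR : Oriented lt R) {M M' : Multiset K}
    (h : RStep R M M') : lt M' M := by
  obtain ⟨p, hp, C, rfl, rfl⟩ := rstep_iff.1 h
  exact hlt.add C (hR p hp)

theorem Oriented.rtc (hlt : MonoOrder lt) (hR : Oriented lt R) {M M' : Multiset K}
    (h : Relation.ReflTransGen (RStep R) M M') : M' = M ∨ lt M' M := by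
  induction h with
  | refl => exact .inl rfl
  | tail _ h ih =>
    refine .inr ?_
    rcases ih with rfl | ih
    · exact hR.rstep hlt h
    · exact hlt.trans (hR.rstep hlt h) ih

theorem Oriented.rtc_ne_zero (hlt : MonoOrder lt) (hR : Oriented lt R) {M M' : Multiset K}
    (h : Relation.ReflTransGen (RStep R) M M') (hM : M ≠ 0) : M' ≠ 0 := by
  rcases hR.rtc hlt h with rfl | h
  · exact hM
  · exact (hlt.ne_zero h).1

theorem Oriented.exists_nf (hlt : MonoOrder lt) (hR : Oriented lt R) (M : Multiset K) :
    ∃ N, IsNF R M N := by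
  induction M using hlt.wf.induction with
  | _ M ih =>
    by_cases h : Normal R M
    · exact ⟨M, .refl, h⟩
    · simp only [Normal, not_forall, not_not] at h
      obtain ⟨M', h⟩ := h
      obtain ⟨N, h1, h2⟩ := ih M' (hR.rstep hlt h)
      exact ⟨N, .head h h1, h2⟩

theorem Oriented.exists_computesNF (hlt : MonoOrder lt) (hR : Oriented lt R) :
    ∃ nf, ComputesNF R nf := by
  choose nf h using hR.exists_nf hlt
  exact ⟨nf, h⟩

theorem rtc_add (C : Multiset K) {M M' : Multiset K}
    (h : Relation.ReflTransGen (RStep R) M M') :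
    Relation.ReflTransGen (RStep R) (M + C) (M' + C) :=
  Relation.ReflTransGen.lift (p := RStep R) (· + C) (fun _ _ h => RStep.add C h) _ _ h

theorem cong_of_rtc {M M' : Multiset K} (h : Relation.ReflTransGen (RStep R) M M') :
    Cong R M M' := by
  induction h with
  | refl => exact .refl _
  | tail _ h ih =>
    obtain ⟨p, hp, C, rfl, rfl⟩ := rstep_iff.1 h
    exact ih.trans (.of_mem hp C trivial trivial)

/-- `D` is downward closed. -/
def DownClosed (lt : Multiset K → Multiset K → Prop) (D : Multiset K → Prop) : Prop :=
  ∀ x y, lt y x → D x → D y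

theorem MonoOrder.downClosed (hlt : MonoOrder lt) (M : Multiset K) :
    DownClosed lt (fun x => lt x M) := fun _ _ h h' => hlt.trans h h'

/-- Rewriting only descends, so a downward closed bound on the first monomial holds along the whole
derivation. -/
theorem conn_of_rtc (hlt : MonoOrder lt) (hR : Oriented lt R) (hD : DownClosed lt D)
    {M M' : Multiset K} (hM : D M) (h : Relation.ReflTransGen (RStep R) M M') :
    Conn D R M M' := by
  induction h using Relation.ReflTransGen.head_induction_on with
  | refl => exact .refl _
  | head h _ ih =>
    have hM' := hD _ _ (hR.rstep hlt h) hM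
    obtain ⟨p, hp, C, rfl, rfl⟩ := rstep_iff.1 h
    exact (Conn.of_mem hp C hM hM').trans (ih hM')

/-! ### Critical pairs -/

theorem superposition_eq (A B : Multiset K) : A + B - A ∩ B = A ∪ B := by
  rw [← Multiset.union_add_inter A B, add_tsub_cancel_right]

theorem critPair_eq (p q : Multiset K × Multiset K) :
    critPair p q = ((p.1 ∪ q.1 - p.1) + p.2, (p.1 ∪ q.1 - q.1) + q.2) := by
  simp [critPair, superposition_eq]

/-- The critical pair of `p` and `q` is connected by `E` below the superposition. -/
def CPConn (lt : Multiset K → Multiset K → Prop) (E : Rules K) (p q : Multiset K × Multiset K) :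
    Prop :=
  Conn (fun x => lt x (p.1 ∪ q.1)) E (critPair p q).1 (critPair p q).2

/-- All critical pairs of `R` are connected by `E` below the superpositions. -/
def CPComplete (lt : Multiset K → Multiset K → Prop) (R E : Rules K) : Prop :=
  ∀ p ∈ R, ∀ q ∈ R, CPConn lt E p q

theorem CPConn.symm {p q : Multiset K × Multiset K} (h : CPConn lt E p q) : CPConn lt E q p := by
  simp only [CPConn, critPair_eq] at h ⊢
  rw [Multiset.union_comm q.1 p.1]
  exact Conn.symm h

theorem CPConn.self (p : Multiset K × Multiset K) : CPConn lt E p p := Conn.refl _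

theorem CPConn.mono (h : E ⊆ E') {p q : Multiset K × Multiset K} (hc : CPConn lt E p q) :
    CPConn lt E' p q := Conn.mono (fun _ h => h) h hc

theorem lt_superposition (hlt : MonoOrder lt) {p : Multiset K × Multiset K} (hp : lt p.2 p.1)
    {M : Multiset K} (hM : p.1 ≤ M) : lt (M - p.1 + p.2) M := by
  have := hlt.add (M - p.1) hp
  rwa [add_tsub_cancel_of_le hM, add_comm] at this

theorem critPair_lt (hlt : MonoOrder lt) {p q : Multiset K × Multiset K} (hp : lt p.2 p.1)
    (hq : lt q.2 q.1) :
    lt (critPair p q).1 (p.1 ∪ q.1) ∧ lt (critPair p q).2 (p.1 ∪ q.1) := by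
  rw [critPair_eq]
  exact ⟨lt_superposition hlt hp Multiset.le_union_left,
    lt_superposition hlt hq Multiset.le_union_right⟩

theorem cong_critPair {p q : Multiset K × Multiset K} (hp : Cong E p.1 p.2)
    (hq : Cong E q.1 q.2) : Cong E (critPair p q).1 (critPair p q).2 := by
  rw [critPair_eq]
  have h1 := Cong.add_left (p.1 ∪ q.1 - p.1) hp
  have h2 := Cong.add_left (p.1 ∪ q.1 - q.1) hq
  rw [tsub_add_cancel_of_le Multiset.le_union_left] at h1
  rw [tsub_add_cancel_of_le Multiset.le_union_right] at h2
  exact h1.symm.trans h2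

/-- For coprime left sides both components of the critical pair rewrite to `p.2 + q.2`, without
leaving the region below the superposition. -/
theorem CPConn.of_disjoint (hlt : MonoOrder lt) {p q : Multiset K × Multiset K} (hp : p ∈ E)
    (hq : q ∈ E) (hp' : lt p.2 p.1) (hq' : lt q.2 q.1) (h : p.1 ∩ q.1 = 0) : CPConn lt E p q := by
  have hu : p.1 ∪ q.1 = p.1 + q.1 := by rw [← superposition_eq, h, tsub_zero]
  simp only [CPConn, critPair_eq, hu]
  rw [add_tsub_cancel_left, add_tsub_cancel_right]
  have hpq : lt (p.2 + q.2) (p.1 + q.1) := by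
    refine hlt.trans (hlt.add q.2 hp') ?_
    rw [add_comm p.1, add_comm p.1]
    exact hlt.add p.1 hq'
  have h1 : lt (q.1 + p.2) (p.1 + q.1) := by
    rw [add_comm q.1]
    exact hlt.add _ hp'
  have h2 : lt (p.1 + q.2) (p.1 + q.1) := by
    rw [add_comm p.1, add_comm p.1]
    exact hlt.add _ hq'
  refine (Conn.of_mem hq p.2 h1 (by rwa [add_comm])).trans ?_
  rw [add_comm q.2]
  exact (Conn.of_mem hp q.2 h2 hpq).symm

/-- The superposition depends on the left sides alone. Reducing the right sides only prolongs the
connection by derivations that start at the components of the critical pair and hence stay below it.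
-/
theorem CPConn.of_reducts (hlt : MonoOrder lt) (hE : Oriented lt R) (hRE : R ⊆ E)
    {p q p' q' : Multiset K × Multiset K} (h : CPConn lt E p q) (hp : lt p.2 p.1)
    (hq : lt q.2 q.1)
    (hp1 : p'.1 = p.1) (hq1 : q'.1 = q.1) (hp2 : Relation.ReflTransGen (RStep R) p.2 p'.2)
    (hq2 : Relation.ReflTransGen (RStep R) q.2 q'.2) : CPConn lt E p' q' := by
  have hlts := critPair_lt hlt hp hq
  simp only [CPConn, critPair_eq, hp1, hq1] at h hlts ⊢
  have aux : ∀ B A A', lt (B + A) (p.1 ∪ q.1) → Relation.ReflTransGen (RStep R) A A' →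
      Conn (fun x => lt x (p.1 ∪ q.1)) E (B + A) (B + A') := by
    intro B A A' hB hA
    have := conn_of_rtc hlt hE (hlt.downClosed (p.1 ∪ q.1)) hB
      (by simpa [add_comm] using rtc_add B hA)
    exact this.mono (fun _ h => h) hRE
  exact (aux _ _ _ hlts.1 hp2).symm.trans (h.trans (aux _ _ _ hlts.2 hq2))

/-- Normal forms are unique if all critical pairs are connected below the superpositions. -/
theorem nf_unique (hlt : MonoOrder lt) (hR : Oriented lt R) (hc : CPComplete lt R R)
    {nf : Multiset K → Multiset K} (hnf : ComputesNF R nf) (x n : Multiset K) (h : IsNF R x n) :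
    n = nf x := by
  induction x using hlt.wf.induction generalizing n with
  | _ x ih =>
    by_cases hx : Normal R x
    · have aux : ∀ n, IsNF R x n → n = x := fun n hn => by
        rcases hn.1.cases_head with h | ⟨y, hy, _⟩
        · exact h.symm
        · exact absurd hy (hx y)
      rw [aux n h, aux _ (hnf x)]
    · have aux : ∀ n, IsNF R x n → ∃ y, RStep R x y ∧ n = nf y := fun n hn => by
        rcases hn.1.cases_head with h | ⟨y, hy, h'⟩
        · exact absurd hn.2 (h ▸ hx)
        · exact ⟨y, hy, ih y (hR.rstep hlt hy) n ⟨h', hn.2⟩⟩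
      obtain ⟨y, hy, rfl⟩ := aux n h
      obtain ⟨z, hz, hz'⟩ := aux _ (hnf x)
      rw [hz']
      obtain ⟨p, hp, hpx, rfl⟩ := hy
      obtain ⟨q, hq, hqx, rfl⟩ := hz
      have hle : p.1 ∪ q.1 ≤ x := Multiset.union_le hpx hqx
      -- Both steps take place in the superposition with a common context `C`. Adding `C` to the
      -- connection of the critical pair turns its bound into `x`.
      obtain ⟨C, rfl⟩ := Multiset.le_iff_exists_add.1 hle
      have h1 := Conn.add C (D' := fun y => lt y (p.1 ∪ q.1 + C)) (fun y hy => hlt.add C hy)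
        (hc p hp q hq)
      rw [critPair_eq] at h1
      have h2 : ∀ A B : Multiset K, A ≤ p.1 ∪ q.1 →
          p.1 ∪ q.1 + C - A + B = p.1 ∪ q.1 - A + B + C := by
        intro A B hA
        rw [← tsub_add_eq_add_tsub hA, add_right_comm]
      rw [h2 _ _ Multiset.le_union_left, h2 _ _ Multiset.le_union_right]
      -- The monomials on the connection lie below `x`, so by induction each equation used on it,
      -- read as a rewrite step, preserves `nf`.
      refine Conn.rec_on (Q := fun a b => nf a = nf b)
        ⟨fun _ => rfl, fun h => h.symm, fun h h' => h.trans h'⟩ ?_ h1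
      intro e he B hD _
      exact (ih _ hD (nf (e.2 + B)) ⟨.head (RStep.of_mem he B) (hnf _).1, (hnf _).2⟩).symm

/-- The Church-Rosser property. -/
theorem nf_eq_of_cong (hlt : MonoOrder lt) (hR : Oriented lt R) (hc : CPComplete lt R R)
    {nf : Multiset K → Multiset K} (hnf : ComputesNF R nf) {x y : Multiset K} (h : Cong R x y) :
    nf x = nf y := by
  refine Conn.rec_on (Q := fun a b => nf a = nf b)
    ⟨fun _ => rfl, fun h => h.symm, fun h h' => h.trans h'⟩ ?_ h
  intro e he B _ _
  exact (nf_unique hlt hR hc hnf _ (nf (e.2 + B))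
    ⟨.head (RStep.of_mem he B) (hnf _).1, (hnf _).2⟩).symm

/-! ### Completion steps -/

theorem Orients.rule_lt {gt : Multiset K → Multiset K → Prop} {s t : Multiset K}
    {p : Multiset K × Multiset K} (h : Orients gt s t p) (hs : s ≠ 0) (ht : t ≠ 0) :
    ltOf gt p.2 p.1 := by
  obtain ⟨h, rfl | rfl⟩ := h
  · exact ⟨ht, hs, h⟩
  · exact ⟨hs, ht, h⟩

theorem Oriented.insert_kept {p : Multiset K × Multiset K} (hR : Oriented lt R)
    (hp : lt p.2 p.1) : Oriented lt (insert p (keptBy R p)) := by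
  rintro q (rfl | hq)
  · exact hp
  · exact hR q hq.1

theorem insert_kept_subset (R : Rules K) (p : Multiset K × Multiset K) :
    insert p (keptBy R p) ⊆ insert p R :=
  Set.insert_subset_insert fun _ h => h.1

/-- Every rule after interreduction comes from a rule with the same left side. -/
theorem interreduce_origin {p : Multiset K × Multiset K} {nf : Multiset K → Multiset K}
    (hnf : ComputesNF (insert p (keptBy R p)) nf) {x : Multiset K × Multiset K}
    (hx : x ∈ interreduce R p nf) :
    ∃ q ∈ insert p (keptBy R p), x.1 = q.1 ∧
      Relation.ReflTransGen (RStep (insert p (keptBy R p))) q.2 x.2 := by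
  rcases hx with rfl | ⟨q, hq, rfl⟩
  · exact ⟨x, Set.mem_insert _ _, rfl, .refl⟩
  · refine ⟨q, Set.mem_insert_of_mem _ hq, ?_⟩
    split_ifs with h
    · exact ⟨rfl, .head ⟨p, Set.mem_insert _ _, h, rfl⟩ (hnf _).1⟩
    · exact ⟨rfl, .refl⟩

theorem interreduce_image {p : Multiset K × Multiset K} {nf : Multiset K → Multiset K}
    (hnf : ComputesNF (insert p (keptBy R p)) nf) {q : Multiset K × Multiset K}
    (hq : q ∈ keptBy R p) :
    ∃ x ∈ interreduce R p nf, x.1 = q.1 ∧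
      Relation.ReflTransGen (RStep (insert p (keptBy R p))) q.2 x.2 := by
  refine ⟨_, Set.mem_insert_of_mem _ ⟨q, hq, rfl⟩, ?_⟩
  split_ifs with h
  · exact ⟨rfl, .head ⟨p, Set.mem_insert _ _, h, rfl⟩ (hnf _).1⟩
  · exact ⟨rfl, .refl⟩

theorem interreduce_oriented (hlt : MonoOrder lt) {p : Multiset K × Multiset K}
    {nf : Multiset K → Multiset K} (hR : Oriented lt R) (hp : lt p.2 p.1)
    (hnf : ComputesNF (insert p (keptBy R p)) nf) : Oriented lt (interreduce R p nf) := by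
  intro x hx
  obtain ⟨q, hq, h1, h2⟩ := interreduce_origin hnf hx
  have ho := hR.insert_kept hp
  rw [h1]
  rcases ho.rtc hlt h2 with h | h
  · rw [h]; exact ho q hq
  · exact hlt.trans h (ho q hq)

theorem interreduce_finite {p : Multiset K × Multiset K} {nf : Multiset K → Multiset K}
    (hR : R.Finite) : (interreduce R p nf).Finite := by
  refine Set.Finite.insert _ (Set.Finite.subset ((hR.subset (fun q h => h.1 : keptBy R p ⊆ R)).image
    fun q => if p.1 ≤ q.2 then (q.1, nf ((q.2 - p.1) + p.2)) else q) ?_)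
  rintro x ⟨q, hq, rfl⟩
  exact ⟨q, hq, rfl⟩

/-- Interreduction does not lose connections. -/
theorem conn_interreduce (hlt : MonoOrder lt) {p : Multiset K × Multiset K}
    {nf : Multiset K → Multiset K} (hR : Oriented lt R) (hp : lt p.2 p.1)
    (hnf : ComputesNF (insert p (keptBy R p)) nf) {P : Rules K} (hP : removedBy R p ⊆ P)
    (hD : DownClosed lt D) {x y : Multiset K} (h : Conn D (insert p R ∪ P) x y) :
    Conn D (interreduce R p nf ∪ P) x y := by
  have ho := hR.insert_kept hp
  -- Induction on the rewritten monomial `z`. The rule `q` is simulated by the interreduced rule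
  -- with the same left side, followed backwards by the reduction of the right side. The steps of
  -- that reduction start strictly below `z`, so the induction hypothesis covers them.
  have key : ∀ z, D z → ∀ q ∈ insert p (keptBy R p), ∀ C, z = q.1 + C →
      Conn D (interreduce R p nf ∪ P) z (q.2 + C) := by
    intro z
    induction z using hlt.wf.induction with
    | _ z ih =>
      rintro hz q hq C rfl
      have hlt1 := hlt.add C (ho q hq)
      have hq2 := hD _ _ hlt1 hz
      rcases hq with rfl | hq
      · exact .of_mem (.inl (Set.mem_insert _ _)) C hz hq2
      · obtain ⟨x, hx, hx1, hx2⟩ := interreduce_image hnf hq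
        have hred : ∀ M, M = q.2 + C ∨ lt M (q.2 + C) → ∀ M',
            Relation.ReflTransGen (RStep (insert p (keptBy R p))) M M' →
            Conn D (interreduce R p nf ∪ P) M M' := by
          intro M hM M' hMM'
          induction hMM' using Relation.ReflTransGen.head_induction_on with
          | refl => exact .refl _
          | head h _ ih2 =>
            have hlt2 := ho.rstep hlt h
            obtain ⟨r, hr, B, rfl, rfl⟩ := rstep_iff.1 h
            have hlt3 : lt (r.1 + B) (q.1 + C) := by
              rcases hM with hM | hM
              · rw [hM]; exact hlt1
              · exact hlt.trans hM hlt1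
            refine (ih _ hlt3 (hD _ _ hlt3 hz) r hr B rfl).trans (ih2 (.inr ?_))
            rcases hM with hM | hM
            · rw [← hM]; exact hlt2
            · exact hlt.trans hlt2 hM
        have h1 := hred (q.2 + C) (.inl rfl) (x.2 + C) (rtc_add C hx2)
        have hx3 : D (x.2 + C) := by
          rcases ho.rtc hlt (rtc_add C hx2) with h | h
          · rwa [h]
          · exact hD _ _ h hq2
        have h2 : Conn D (interreduce R p nf ∪ P) (x.1 + C) (x.2 + C) :=
          .of_mem (.inl hx) C (by rwa [hx1]) hx3
        rw [hx1] at h2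
        exact h2.trans h1.symm
  refine h.rec_on Conn.equivalence ?_
  rintro e (he | he) C h1 h2
  · by_cases hk : e ∈ insert p (keptBy R p)
    · exact key _ h1 e hk C rfl
    · have hr : e ∈ removedBy R p := by
        rcases he with rfl | he
        · exact absurd (Set.mem_insert _ _) hk
        · refine ⟨he, ?_⟩
          by_contra hn
          exact hk (Set.mem_insert_of_mem _ ⟨he, hn⟩)
      exact .of_mem (.inr (hP hr)) C h1 h2
  · exact .of_mem (.inr he) C h1 h2

/-- The invariant of completion with rules `R` and pending equations `P`. -/
structure Good (lt : Multiset K → Multiset K → Prop) (R P : Rules K) : Prop where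
  finite_rules : R.Finite
  finite_pending : P.Finite
  oriented : Oriented lt R
  ne_zero : ∀ e ∈ P, e.1 ≠ 0 ∧ e.2 ≠ 0
  complete : CPComplete lt R (R ∪ P)

/-- An equation whose sides have a common normal form is replaced by the two derivations to it,
which stay in `D` in every context. -/
theorem conn_discard (hlt : MonoOrder lt) {P : Rules K} (hR : Oriented lt R)
    {nf : Multiset K → Multiset K} (hnf : ComputesNF R nf) {e : Multiset K × Multiset K}
    (he : nf e.1 = nf e.2) (hD : DownClosed lt D) {x y : Multiset K} (h : Conn D (R ∪ P) x y) :
    Conn D (R ∪ P \ {e}) x y := by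
  refine h.rec_on Conn.equivalence fun d hd C h1 h2 => ?_
  by_cases hde : d = e
  · subst hde
    have h1' := conn_of_rtc hlt hR hD h1 (rtc_add C (hnf d.1).1)
    have h2' := conn_of_rtc hlt hR hD h2 (rtc_add C (hnf d.2).1)
    rw [he] at h1'
    exact (h1'.trans h2'.symm).mono (fun _ h => h) Set.subset_union_left
  · exact .of_mem (hd.imp id fun h => ⟨h, hde⟩) C h1 h2

theorem Good.discard (hlt : MonoOrder lt) {P : Rules K} (hg : Good lt R P)
    {nf : Multiset K → Multiset K} (hnf : ComputesNF R nf) {e : Multiset K × Multiset K}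
    (he : nf e.1 = nf e.2) : Good lt R (P \ {e}) where
  finite_rules := hg.finite_rules
  finite_pending := hg.finite_pending.subset Set.sdiff_subset
  oriented := hg.oriented
  ne_zero := fun d hd => hg.ne_zero d hd.1
  complete := fun p hp q hq =>
    conn_discard hlt hg.oriented hnf he (hlt.downClosed _) (hg.complete p hp q hq)

/-- The data of a completion step that adds a rule `p` obtained from the pending equation `e`. -/
structure AddStep (gt : Multiset K → Multiset K → Prop) (R P : Rules K)
    (e p : Multiset K × Multiset K) (nf nf' : Multiset K → Multiset K) (P' : Rules K) : Prop where
  mem : e ∈ P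
  nf_spec : ComputesNF R nf
  orients : Orients gt (nf e.1) (nf e.2) p
  nf'_spec : ComputesNF (insert p (keptBy R p)) nf'
  pending_subset : P \ {e} ⊆ P'
  removed_subset : removedBy R p ⊆ P'
  pending_finite : P'.Finite
  pending_cases : ∀ d ∈ P', d ∈ P ∨ d ∈ R ∨ (∃ q ∈ R, d = critPair p q) ∨
    ∃ q ∈ R, d = (nf (critPair p q).1, nf (critPair p q).2)
  crit : ∀ q ∈ R, critPair p q ∈ P' ∨ nf (critPair p q).1 = nf (critPair p q).2 ∨
    (nf (critPair p q).1, nf (critPair p q).2) ∈ P'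

/-! ### The effect of adding a rule -/

section AddStep

variable {gt : Multiset K → Multiset K → Prop} {P P' : Rules K} {e p : Multiset K × Multiset K}
  {nf nf' : Multiset K → Multiset K}

theorem AddStep.normal (h : AddStep gt R P e p nf nf' P') : Normal R p.1 := by
  obtain ⟨_, h1 | h1⟩ := h.orients <;> rw [h1]
  · exact (h.nf_spec _).2
  · exact (h.nf_spec _).2

theorem AddStep.rule_lt (hlt : MonoOrder (ltOf gt)) (hg : Good (ltOf gt) R P)
    (h : AddStep gt R P e p nf nf' P') : ltOf gt p.2 p.1 :=
  h.orients.rule_lt (hg.oriented.rtc_ne_zero hlt (h.nf_spec _).1 (hg.ne_zero e h.mem).1)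
    (hg.oriented.rtc_ne_zero hlt (h.nf_spec _).1 (hg.ne_zero e h.mem).2)

/-- The processed equation `e` is recovered by descending from one side to its normal form, crossing
`p`, and climbing back to the other side. The normal forms lie in `D` because they descend from
monomials in `D`. -/
theorem AddStep.conn_insert (hlt : MonoOrder (ltOf gt)) (hg : Good (ltOf gt) R P)
    (h : AddStep gt R P e p nf nf' P') (hD : DownClosed (ltOf gt) D) {x y : Multiset K}
    (hxy : Conn D (R ∪ P) x y) : Conn D (insert p R ∪ P') x y := by
  refine hxy.rec_on Conn.equivalence fun d hd C h1 h2 => ?_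
  by_cases hde : d = e
  · subst hde
    have hsub : R ⊆ insert p R ∪ P' := fun _ h => .inl (Set.mem_insert_of_mem _ h)
    have aux : ∀ z, D (z + C) → Conn D (insert p R ∪ P') (z + C) (nf z + C) ∧ D (nf z + C) := by
      intro z hz
      have hr := rtc_add C (h.nf_spec z).1
      refine ⟨(conn_of_rtc hlt hg.oriented hD hz hr).mono (fun _ h => h) hsub, ?_⟩
      rcases hg.oriented.rtc hlt hr with h | h
      · rwa [h]
      · exact hD _ _ h hz
    obtain ⟨a1, b1⟩ := aux _ h1
    obtain ⟨a2, b2⟩ := aux _ h2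
    refine a1.trans (Conn.trans ?_ a2.symm)
    have hp : p ∈ insert p R ∪ P' := .inl (Set.mem_insert _ _)
    obtain ⟨_, ho | ho⟩ := h.orients
    · have := Conn.of_mem (D := D) hp C (by rwa [ho]) (by rwa [ho])
      rwa [congrArg Prod.fst ho, congrArg Prod.snd ho] at this
    · have := Conn.of_mem (D := D) hp C (by rwa [ho]) (by rwa [ho])
      rw [congrArg Prod.fst ho, congrArg Prod.snd ho] at this
      exact this.symm
  · refine .of_mem ?_ C h1 h2
    rcases hd with hd | hd
    · exact .inl (Set.mem_insert_of_mem _ hd)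
    · exact .inr (h.pending_subset ⟨hd, hde⟩)

theorem AddStep.conn (hlt : MonoOrder (ltOf gt)) (hg : Good (ltOf gt) R P)
    (h : AddStep gt R P e p nf nf' P') (hD : DownClosed (ltOf gt) D) {x y : Multiset K}
    (hxy : Conn D (R ∪ P) x y) : Conn D (interreduce R p nf' ∪ P') x y :=
  conn_interreduce hlt hg.oriented (h.rule_lt hlt hg) h.nf'_spec h.removed_subset hD
    (h.conn_insert hlt hg hD hxy)

/-- The components of the critical pair lie below the superposition, and so do their normal forms.
Each of the three alternatives in `crit` therefore yields a connection below it. -/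
theorem AddStep.cpConn_new (hlt : MonoOrder (ltOf gt)) (hg : Good (ltOf gt) R P)
    (h : AddStep gt R P e p nf nf' P') {q : Multiset K × Multiset K} (hq : q ∈ R) :
    CPConn (ltOf gt) (insert p R ∪ P') p q := by
  have hlts := critPair_lt hlt (h.rule_lt hlt hg) (hg.oriented q hq)
  have hmem : ∀ d ∈ P', ltOf gt d.1 (p.1 ∪ q.1) → ltOf gt d.2 (p.1 ∪ q.1) →
      Conn (fun x => ltOf gt x (p.1 ∪ q.1)) (insert p R ∪ P') d.1 d.2 := by
    intro d hd h1 h2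
    simpa using Conn.of_mem (D := fun x => ltOf gt x (p.1 ∪ q.1)) (E := insert p R ∪ P')
      (.inr hd) 0 (by simpa using h1) (by simpa using h2)
  have aux : ∀ z, ltOf gt z (p.1 ∪ q.1) → ltOf gt (nf z) (p.1 ∪ q.1) ∧
      Conn (fun x => ltOf gt x (p.1 ∪ q.1)) (insert p R ∪ P') z (nf z) := by
    intro z hz
    refine ⟨?_, (conn_of_rtc hlt hg.oriented (hlt.downClosed _) hz (h.nf_spec z).1).mono
      (fun _ h => h) fun _ h => .inl (Set.mem_insert_of_mem _ h)⟩
    rcases hg.oriented.rtc hlt (h.nf_spec z).1 with h | h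
    · rwa [h]
    · exact hlt.trans h hz
  obtain ⟨a1, b1⟩ := aux _ hlts.1
  obtain ⟨a2, b2⟩ := aux _ hlts.2
  rcases h.crit q hq with hc | hc | hc
  · exact hmem _ hc hlts.1 hlts.2
  · exact b1.trans (hc ▸ b2.symm)
  · exact b1.trans ((hmem _ hc a1 a2).trans b2.symm)

theorem AddStep.good (hlt : MonoOrder (ltOf gt)) (hg : Good (ltOf gt) R P)
    (h : AddStep gt R P e p nf nf' P') : Good (ltOf gt) (interreduce R p nf') P' where
  finite_rules := interreduce_finite hg.finite_rules
  finite_pending := h.pending_finite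
  oriented := interreduce_oriented hlt hg.oriented (h.rule_lt hlt hg) h.nf'_spec
  ne_zero := by
    intro d hd
    have hcrit : ∀ q ∈ R, (critPair p q).1 ≠ 0 ∧ (critPair p q).2 ≠ 0 := fun q hq =>
      have hlts := critPair_lt hlt (h.rule_lt hlt hg) (hg.oriented q hq)
      ⟨(hlt.ne_zero hlts.1).1, (hlt.ne_zero hlts.2).1⟩
    rcases h.pending_cases d hd with hd | hd | ⟨q, hq, rfl⟩ | ⟨q, hq, rfl⟩
    · exact hg.ne_zero d hd
    · exact (hlt.ne_zero (hg.oriented d hd)).symm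
    · exact hcrit q hq
    · exact ⟨hg.oriented.rtc_ne_zero hlt (h.nf_spec _).1 (hcrit q hq).1,
        hg.oriented.rtc_ne_zero hlt (h.nf_spec _).1 (hcrit q hq).2⟩
  complete := by
    have hp := h.rule_lt hlt hg
    -- Connectedness is proved first for the rules before interreduction, with all of `R` present.
    -- The interreduced rules have the same left sides and reduced right sides, so
    -- `CPConn.of_reducts` and `conn_interreduce` transfer it.
    have hcomp : CPComplete (ltOf gt) (insert p R) (insert p R ∪ P') := by
      rintro x (rfl | hx) y (rfl | hy)
      · exact .self _
      · exact h.cpConn_new hlt hg hy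
      · exact (h.cpConn_new hlt hg hx).symm
      · exact h.conn_insert hlt hg (hlt.downClosed _) (hg.complete x hx y hy)
    have hoR : Oriented (ltOf gt) (insert p R) := by
      rintro x (rfl | hx)
      · exact hp
      · exact hg.oriented x hx
    intro x hx y hy
    obtain ⟨x', hx', hx1, hx2⟩ := interreduce_origin h.nf'_spec hx
    obtain ⟨y', hy', hy1, hy2⟩ := interreduce_origin h.nf'_spec hy
    have hx' := insert_kept_subset R p hx'
    have hy' := insert_kept_subset R p hy'
    have hmono : ∀ {M M'}, Relation.ReflTransGen (RStep (insert p (keptBy R p))) M M' →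
        Relation.ReflTransGen (RStep (insert p R)) M M' := fun hM =>
      Relation.ReflTransGen.mono (fun _ _ h => RStep.mono (insert_kept_subset R p) h) _ _ hM
    exact conn_interreduce hlt hg.oriented hp h.nf'_spec h.removed_subset (hlt.downClosed _)
      (CPConn.of_reducts hlt hoR Set.subset_union_left (hcomp x' hx' y' hy') (hoR x' hx')
        (hoR y' hy') hx1 hy1 (hmono hx2) (hmono hy2))

theorem Cong.rule_add (h : AddStep gt R P e p nf nf' P') : Cong (R ∪ P) p.1 p.2 := by
  have aux : ∀ z, Cong (R ∪ P) z (nf z) := fun z =>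
    (cong_of_rtc (h.nf_spec z).1).mono (fun _ h => h) Set.subset_union_left
  have key : Cong (R ∪ P) (nf e.1) (nf e.2) :=
    (aux _).symm.trans ((Cong.of_mem (.inr h.mem)).trans (aux _))
  obtain ⟨_, ho | ho⟩ := h.orients <;> rw [ho]
  · exact key
  · exact key.symm

theorem AddStep.sound (h : AddStep gt R P e p nf nf' P') {d : Multiset K × Multiset K}
    (hd : d ∈ interreduce R p nf' ∪ P') : Cong (R ∪ P) d.1 d.2 := by
  have hp := Cong.rule_add h
  have hins : ∀ q ∈ insert p (keptBy R p), Cong (R ∪ P) q.1 q.2 := by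
    rintro q (rfl | hq)
    · exact hp
    · exact Cong.of_mem (.inl hq.1)
  rcases hd with hd | hd
  · obtain ⟨q, hq, h1, h2⟩ := interreduce_origin h.nf'_spec hd
    rw [h1]
    exact (hins q hq).trans (Cong.of_forall hins (cong_of_rtc h2))
  · have aux : ∀ z, Cong (R ∪ P) z (nf z) := fun z =>
      (cong_of_rtc (h.nf_spec z).1).mono (fun _ h => h) Set.subset_union_left
    rcases h.pending_cases d hd with hd | hd | ⟨q, hq, rfl⟩ | ⟨q, hq, rfl⟩
    · exact Cong.of_mem (.inr hd)
    · exact Cong.of_mem (.inl hd)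
    · exact cong_critPair hp (Cong.of_mem (.inl hq))
    · exact (aux _).symm.trans ((cong_critPair hp (Cong.of_mem (.inl hq))).trans (aux _))

/-- Adding a rule does not change the congruence. -/
theorem AddStep.cong_iff (hlt : MonoOrder (ltOf gt)) (hg : Good (ltOf gt) R P)
    (h : AddStep gt R P e p nf nf' P') {x y : Multiset K} :
    Cong (interreduce R p nf' ∪ P') x y ↔ Cong (R ∪ P) x y :=
  ⟨Cong.of_forall fun _ => h.sound, h.conn hlt hg fun _ _ _ _ => trivial⟩

/-- The left sides of the rules generate this upward closed set of reducible monomials. -/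
def leftIdeal (R : Rules K) : Set (Multiset K) := {M | ∃ q ∈ R, q.1 ≤ M}

/-- `p.1` is irreducible by `R`, hence new. Nothing is lost: a dropped rule has its left side above
`p.1`, and the other rules keep theirs. -/
theorem AddStep.leftIdeal_lt (h : AddStep gt R P e p nf nf' P') :
    leftIdeal R ⊂ leftIdeal (interreduce R p nf') := by
  rw [Set.ssubset_iff_of_subset]
  · exact ⟨p.1, ⟨p, Set.mem_insert _ _, le_rfl⟩, fun ⟨q, hq, hle⟩ => normal_iff.1 h.normal q hq hle⟩
  · rintro M ⟨q, hq, hle⟩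
    by_cases hpq : p.1 ≤ q.1
    · exact ⟨p, Set.mem_insert _ _, hpq.trans hle⟩
    · obtain ⟨x, hx, hx1, _⟩ := interreduce_image h.nf'_spec ⟨hq, hpq⟩
      exact ⟨x, hx, hx1 ▸ hle⟩

end AddStep

end Rewriting

end Connected

/-! ### The ascending chain condition from Dickson's lemma -/

/-- Upward closed sets of multisets over a finite type satisfy the ascending chain condition. -/
theorem wellFounded_upperSet {K : Type*} [Finite K] :
    WellFounded fun U V : UpperSet (Multiset K) => (V : Set (Multiset K)) ⊂ U := by
  classical
  rw [wellFounded_iff_isEmpty_descending_chain]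
  refine ⟨fun ⟨s, hs⟩ => ?_⟩
  -- `x n` enters the chain at stage `n + 1`. Dickson's lemma gives `m < n` with `x m ≤ x n`, so `x
  -- n` would already belong to stage `n`.
  choose x hx using fun n => Set.exists_of_ssubset (hs n)
  obtain ⟨m, n, hmn, hle⟩ :=
    (wellQuasiOrdered_le (α := K →₀ ℕ)) fun n => Finsupp.orderIsoMultiset.symm (x n)
  have hle : x m ≤ x n := Finsupp.orderIsoMultiset.symm.le_iff_le.1 hle
  have hmono : Monotone fun n => (s n : Set (Multiset K)) :=
    monotone_nat_of_le_succ fun n => (hs n).subset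
  exact (hx n).2 ((s n).upper hle (hmono hmn (hx m).1))


section Constants

variable {K : Type*} [LinearOrder K]

/-! ### Canonical systems of constants -/

/-- The constants that are left sides of rules. -/
def cdom (RC : Set (K × K)) : Set K := {a | ∃ b, (a, b) ∈ RC}

theorem cdom_union (A B : Set (K × K)) : cdom (A ∪ B) = cdom A ∪ cdom B := by
  ext a
  simp [cdom, exists_or]

/-- `RC` is a canonical system of constants. -/
structure IsConstSystem (RC : Set (K × K)) : Prop where
  func : ∀ {a b c}, (a, b) ∈ RC → (a, c) ∈ RC → b = c
  irred : ∀ {a b}, (a, b) ∈ RC → b ∉ cdom RC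
  lt : ∀ {a b}, (a, b) ∈ RC → b < a

theorem isConstSystem_constSystem (E : Set (K × K)) : IsConstSystem (constSystem E) where
  func := fun h1 h2 => le_antisymm (h1.2.2 _ h2.2.1) (h2.2.2 _ h1.2.1)
  irred := by
    rintro a b ⟨_, h1, h2⟩ ⟨c, h3, h4, h5⟩
    exact h3 (le_antisymm (h2 _ (h1.trans _ _ _ h4)) (h5 _ (.refl _)))
  lt := fun h => lt_of_le_of_ne (h.2.2 _ (.refl _)) h.1.symm

theorem exists_least_eqvGen [Finite K] (E : Set (K × K)) (a : K) :
    ∃ m, Relation.EqvGen (fun a b => (a, b) ∈ E) a m ∧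
      ∀ e, Relation.EqvGen (fun a b => (a, b) ∈ E) a e → m ≤ e := by
  obtain ⟨m, hm, h⟩ := Set.exists_min_image {e | Relation.EqvGen (fun a b => (a, b) ∈ E) a e} id
    (Set.toFinite _) ⟨a, .refl _⟩
  exact ⟨m, hm, fun e he => h e he⟩

theorem mem_cdom_constSystem [Finite K] {E : Set (K × K)} {a : K} :
    a ∈ cdom (constSystem E) ↔ ∃ b < a, Relation.EqvGen (fun a b => (a, b) ∈ E) a b := by
  constructor
  · rintro ⟨b, h⟩
    exact ⟨b, (isConstSystem_constSystem E).lt h, h.2.1⟩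
  · rintro ⟨b, hb, h⟩
    obtain ⟨m, hm, hmin⟩ := exists_least_eqvGen E a
    exact ⟨m, ((hmin _ h).trans_lt hb).ne', hm, hmin⟩

theorem eqvGen_constSystem_of_mem [Finite K] {E : Set (K × K)} {a b : K} (h : (a, b) ∈ E) :
    Relation.EqvGen (fun a b => (a, b) ∈ constSystem E) a b := by
  have key : ∀ c m, Relation.EqvGen (fun a b => (a, b) ∈ E) c m →
      (∀ e, Relation.EqvGen (fun a b => (a, b) ∈ E) c e → m ≤ e) →
      Relation.EqvGen (fun a b => (a, b) ∈ constSystem E) c m := by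
    intro c m h1 h2
    by_cases hc : c = m
    · rw [hc]; exact .refl _
    · exact .rel _ _ ⟨hc, h1, h2⟩
  have hab : Relation.EqvGen (fun a b => (a, b) ∈ E) a b := .rel _ _ h
  obtain ⟨m, hm, hmin⟩ := exists_least_eqvGen E a
  exact (key a m hm hmin).trans _ _ _ ((key b m ((hab.symm _ _).trans _ _ _ hm)
    fun e he => hmin e (hab.trans _ _ _ he)).symm _ _)

/-- A constant with a smaller one in its class is not least there, hence reducible in the canonical
system. So reducible constants stay reducible. -/
theorem cdom_subset_constSystem_union [Finite K] {RC N : Set (K × K)}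
    (hRC : ∀ p ∈ RC, p.2 < p.1) (hN : ∀ p ∈ N, p.2 < p.1) :
    cdom RC ∪ cdom N ⊆ cdom (constSystem (RC ∪ N)) := by
  rintro a (⟨b, h⟩ | ⟨b, h⟩)
  · exact mem_cdom_constSystem.2 ⟨b, hRC _ h, .rel _ _ (.inl h)⟩
  · exact mem_cdom_constSystem.2 ⟨b, hN _ h, .rel _ _ (.inr h)⟩

open Classical in
/-- The canonical form of a constant. -/
noncomputable def canonConst (RC : Set (K × K)) (c : K) : K :=
  if h : ∃ d, (c, d) ∈ RC then h.choose else c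

theorem canonConst_of_mem {RC : Set (K × K)} (hRC : IsConstSystem RC) {c d : K}
    (h : (c, d) ∈ RC) : canonConst RC c = d := by
  have h' : ∃ d, (c, d) ∈ RC := ⟨d, h⟩
  rw [canonConst, dif_pos h']
  exact hRC.func h'.choose_spec h

theorem canonConst_of_notMem {RC : Set (K × K)} {c : K} (h : c ∉ cdom RC) :
    canonConst RC c = c := dif_neg h

theorem normal_constRules {RC : Set (K × K)} {M : Multiset K} :
    Normal (constRules RC) M ↔ ∀ c ∈ M, c ∉ cdom RC := by
  rw [normal_iff]
  constructor
  · rintro h c hc ⟨d, hd⟩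
    exact h _ ⟨c, d, hd, rfl⟩ (Multiset.singleton_le.2 hc)
  · rintro h _ ⟨c, d, hd, rfl⟩ hle
    exact h c (Multiset.singleton_le.1 hle) ⟨d, hd⟩

theorem map_canonConst_of_rtc {RC : Set (K × K)} (hRC : IsConstSystem RC) {M M' : Multiset K}
    (h : Relation.ReflTransGen (RStep (constRules RC)) M M') :
    M.map (canonConst RC) = M'.map (canonConst RC) := by
  induction h with
  | refl => rfl
  | tail _ h ih =>
    obtain ⟨_, ⟨c, d, hcd, rfl⟩, C, rfl, rfl⟩ := rstep_iff.1 h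
    rw [ih]
    simp [canonConst_of_mem hRC hcd, canonConst_of_notMem (hRC.irred hcd)]

/-- `canonConst` takes the same value at both ends of a constant rule, which makes these normal
forms unique. One consequence is that `normalizeBy` keeps a finite system finite. -/
theorem isNF_constRules {RC : Set (K × K)} (hRC : IsConstSystem RC) {M N : Multiset K}
    (h : IsNF (constRules RC) M N) : N = M.map (canonConst RC) := by
  rw [map_canonConst_of_rtc hRC h.1]
  have := normal_constRules.1 h.2
  exact ((Multiset.map_congr rfl fun c hc => canonConst_of_notMem (this c hc)).trans
    (Multiset.map_id' _)).symm

variable {lt : Multiset K → Multiset K → Prop}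

theorem oriented_constRules (hlt : MonoOrder lt) {RC : Set (K × K)}
    (hRC : ∀ p ∈ RC, p.2 < p.1) : Oriented lt (constRules RC) := by
  rintro _ ⟨c, d, h, rfl⟩
  exact hlt.single (hRC _ h)

/-- All constants of `P` belong to `W`. -/
def Over (W : Set K) (P : Rules K) : Prop :=
  ∀ p ∈ P, (∀ c ∈ p.1, c ∈ W) ∧ ∀ c ∈ p.2, c ∈ W

theorem good_normalizeBy (hlt : MonoOrder lt) {RC : Set (K × K)} (hRC : IsConstSystem RC)
    {S : Rules K} (hS : S.Finite) (hne : ∀ e ∈ S, e.1 ≠ 0 ∧ e.2 ≠ 0) :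
    Good lt ∅ (normalizeBy RC S) where
  finite_rules := Set.finite_empty
  finite_pending := by
    refine (hS.image fun e => (e.1.map (canonConst RC), e.2.map (canonConst RC))).subset ?_
    rintro ⟨a, b⟩ ⟨e, he, h1, h2⟩
    exact ⟨e, he, Prod.ext (isNF_constRules hRC h1).symm (isNF_constRules hRC h2).symm⟩
  oriented := fun _ h => h.elim
  ne_zero := by
    rintro d ⟨e, he, h1, h2⟩
    have := oriented_constRules hlt fun p hp => hRC.lt hp
    exact ⟨this.rtc_ne_zero hlt h1.1 (hne e he).1, this.rtc_ne_zero hlt h2.1 (hne e he).2⟩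
  complete := fun _ h => h.elim

theorem over_normalizeBy {RC : Set (K × K)} {S : Rules K} :
    Over (cdom RC)ᶜ (normalizeBy RC S) := by
  rintro d ⟨e, _, h1, h2⟩
  exact ⟨normal_constRules.1 h1.2, normal_constRules.1 h2.2⟩

/-- The critical pairs with constant rules are trivial when the left sides avoid their left
sides. -/
theorem CPComplete.union_constRules (hlt : MonoOrder lt) {RC : Set (K × K)}
    (hRC : IsConstSystem RC) {R P : Rules K} (hR : Oriented lt R)
    (hav : ∀ q ∈ R, ∀ c ∈ q.1, c ∉ cdom RC) (hc : CPComplete lt R P) (hsub : R ⊆ P)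
    (hsub' : constRules RC ⊆ P) :
    CPComplete lt (constRules RC ∪ R) P := by
  have hoC := oriented_constRules hlt fun p hp => hRC.lt hp
  have haux : ∀ p ∈ constRules RC, ∀ q ∈ R, CPConn lt P p q := by
    intro p hp q hq
    refine .of_disjoint hlt (hsub' hp) (hsub hq) (hoC p hp) (hR q hq) ?_
    obtain ⟨c, d, hcd, rfl⟩ := hp
    refine Multiset.eq_zero_of_forall_notMem fun x hx => ?_
    obtain ⟨h1, h2⟩ := Multiset.mem_inter.1 hx
    rw [Multiset.mem_singleton] at h1
    exact hav q hq x h2 (h1 ▸ ⟨d, hcd⟩)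
  rintro p (hp | hp) q (hq | hq)
  · by_cases hpq : p = q
    · rw [hpq]; exact .self _
    · refine .of_disjoint hlt (hsub' hp) (hsub' hq) (hoC p hp) (hoC q hq) ?_
      obtain ⟨c, d, hcd, rfl⟩ := hp
      obtain ⟨c', d', hcd', rfl⟩ := hq
      refine Multiset.eq_zero_of_forall_notMem fun x hx => ?_
      obtain ⟨h1, h2⟩ := Multiset.mem_inter.1 hx
      rw [Multiset.mem_singleton] at h1 h2
      subst h1
      subst h2
      exact hpq (by rw [hRC.func hcd hcd'])
  · exact haux p hp q hq
  · exact (haux q hq p hp).symm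
  · exact hc p hp q hq

/-! ### Invariants and termination of completion -/

theorem over_rtc {W : Set K} {R : Rules K} (hR : Over W R) {M M' : Multiset K}
    (h : Relation.ReflTransGen (RStep R) M M') (hM : ∀ c ∈ M, c ∈ W) : ∀ c ∈ M', c ∈ W := by
  induction h with
  | refl => exact hM
  | tail _ h ih =>
    obtain ⟨p, hp, C, rfl, rfl⟩ := rstep_iff.1 h
    intro c hc
    rcases Multiset.mem_add.1 hc with hc | hc
    · exact (hR p hp).2 c hc
    · exact ih c (Multiset.mem_add.2 (.inr hc))

theorem over_critPair {W : Set K} {p q : Multiset K × Multiset K}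
    (hp : (∀ c ∈ p.1, c ∈ W) ∧ ∀ c ∈ p.2, c ∈ W) (hq : (∀ c ∈ q.1, c ∈ W) ∧ ∀ c ∈ q.2, c ∈ W) :
    (∀ c ∈ (critPair p q).1, c ∈ W) ∧ ∀ c ∈ (critPair p q).2, c ∈ W := by
  rw [critPair_eq]
  have hu : ∀ c ∈ p.1 ∪ q.1, c ∈ W := fun c hc =>
    (Multiset.mem_union.1 hc).elim (hp.1 c) (hq.1 c)
  constructor
  · intro c hc
    rcases Multiset.mem_add.1 hc with hc | hc
    · exact hu c (Multiset.mem_of_le (Multiset.sub_le_self _ _) hc)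
    · exact hp.2 c hc
  · intro c hc
    rcases Multiset.mem_add.1 hc with hc | hc
    · exact hu c (Multiset.mem_of_le (Multiset.sub_le_self _ _) hc)
    · exact hq.2 c hc

section AddStep

variable {gt : Multiset K → Multiset K → Prop} {R P P' : Rules K} {e p : Multiset K × Multiset K}
  {nf nf' : Multiset K → Multiset K}

theorem AddStep.over {W : Set K} (h : AddStep gt R P e p nf nf' P') (hW : Over W (R ∪ P)) :
    Over W (interreduce R p nf' ∪ P') := by
  have hR : Over W R := fun q hq => hW q (.inl hq)
  have hnf : ∀ z, (∀ c ∈ z, c ∈ W) → ∀ c ∈ nf z, c ∈ W := fun z => over_rtc hR (h.nf_spec z).1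
  have he := hW e (.inr h.mem)
  have hp : (∀ c ∈ p.1, c ∈ W) ∧ ∀ c ∈ p.2, c ∈ W := by
    obtain ⟨_, rfl | rfl⟩ := h.orients
    · exact ⟨hnf _ he.1, hnf _ he.2⟩
    · exact ⟨hnf _ he.2, hnf _ he.1⟩
  have hk : Over W (insert p (keptBy R p)) := by
    rintro q (rfl | hq)
    · exact hp
    · exact hR q hq.1
  rintro d (hd | hd)
  · obtain ⟨q, hq, h1, h2⟩ := interreduce_origin h.nf'_spec hd
    rw [h1]
    exact ⟨(hk q hq).1, over_rtc hk h2 (hk q hq).2⟩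
  · rcases h.pending_cases d hd with hd | hd | ⟨q, hq, rfl⟩ | ⟨q, hq, rfl⟩
    · exact hW d (.inr hd)
    · exact hR d hd
    · exact over_critPair hp (hR q hq)
    · exact ⟨hnf _ (over_critPair hp (hR q hq)).1, hnf _ (over_critPair hp (hR q hq)).2⟩

end AddStep

/-- The upward closed set of reducible monomials. -/
def leftUpper (R : Rules K) : UpperSet (Multiset K) :=
  ⟨leftIdeal R, fun _ _ hab ⟨q, hq, hle⟩ => ⟨q, hq, hle.trans hab⟩⟩

/-- The ordering of measures in which completion decreases. -/
abbrev InnerLt : UpperSet (Multiset K) × ℕ → UpperSet (Multiset K) × ℕ → Prop :=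
  Prod.Lex (fun U V => (V : Set (Multiset K)) ⊂ U) (· < ·)

theorem wellFounded_innerLt [Finite K] :
    WellFounded (InnerLt : UpperSet (Multiset K) × ℕ → UpperSet (Multiset K) × ℕ → Prop) :=
  wellFounded_upperSet.prod_lex wellFounded_lt

variable {gt : Multiset K → Multiset K → Prop}

theorem cong_iff_of_discard (hlt : MonoOrder lt) {R P P' : Rules K} (hR : Oriented lt R)
    {nf : Multiset K → Multiset K} (hnf : ComputesNF R nf) {e : Multiset K × Multiset K}
    (he : nf e.1 = nf e.2) (h1 : P \ {e} ⊆ P') (h2 : P' ⊆ P) {x y : Multiset K} :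
    Cong (R ∪ P') x y ↔ Cong (R ∪ P) x y :=
  ⟨fun h => h.mono (fun _ h => h) (Set.union_subset_union_right _ h2),
    fun h => (conn_discard hlt hR hnf he (fun _ _ _ _ => trivial) h).mono (fun _ h => h)
      (Set.union_subset_union_right _ h1)⟩

theorem finite_image_rules {R : Rules K} (hR : R.Finite)
    (g : Multiset K × Multiset K → Multiset K × Multiset K)
    (p : Multiset K × Multiset K → Prop) : {c | ∃ q ∈ R, p q ∧ c = g q}.Finite := by
  refine (hR.image g).subset ?_
  rintro c ⟨q, hq, _, rfl⟩
  exact ⟨q, hq, rfl⟩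

theorem addStep_of_completion {R T : Rules K} {e p : Multiset K × Multiset K}
    {nf nf' : Multiset K → Multiset K} (hR : R.Finite) (hT : T.Finite) (he : e ∈ T)
    (hnf : ComputesNF R nf) (ho : Orients gt (nf e.1) (nf e.2) p)
    (hnf' : ComputesNF (insert p (keptBy R p)) nf') :
    AddStep gt R T e p nf nf' ((T \ {e}) ∪ {c | ∃ q ∈ R, c = critPair p q} ∪ removedBy R p) where
  mem := he
  nf_spec := hnf
  orients := ho
  nf'_spec := hnf'
  pending_subset := fun _ h => .inl (.inl h)
  removed_subset := fun _ h => .inr h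
  pending_finite := by
    refine ((hT.subset Set.sdiff_subset).union ?_).union (hR.subset fun q h => h.1)
    simpa using finite_image_rules hR (critPair p) (fun _ => True)
  pending_cases := by
    rintro d ((h | h) | h)
    · exact .inl h.1
    · exact .inr (.inr (.inl h))
    · exact .inr (.inl h.1)
  crit := fun q hq => .inl (.inl (.inr ⟨q, hq, rfl⟩))

/-- An added rule enlarges the set of reducible monomials, however many equations become pending; a
discarded equation leaves that set alone and lowers the count. Preservation of `Over` keeps
constants reducible by `RC` out of the whole completion. -/
theorem CompletionStep.invariant (hlt : MonoOrder (ltOf gt)) {st st' : Rules K × Rules K}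
    (h : CompletionStep gt st st') (hg : Good (ltOf gt) st.1 st.2) :
    Good (ltOf gt) st'.1 st'.2 ∧
    (∀ x y, Cong (st'.1 ∪ st'.2) x y ↔ Cong (st.1 ∪ st.2) x y) ∧
    (∀ W, Over W (st.1 ∪ st.2) → Over W (st'.1 ∪ st'.2)) ∧
    InnerLt (leftUpper st'.1, st'.2.ncard) (leftUpper st.1, st.2.ncard) := by
  cases h with
  | discard R T e nf he hnf hd =>
    refine ⟨hg.discard hlt hnf hd, fun x y => cong_iff_of_discard hlt hg.oriented hnf hd
      subset_rfl Set.sdiff_subset, ?_, ?_⟩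
    · rintro W hW d (h | h)
      · exact hW d (.inl h)
      · exact hW d (.inr h.1)
    · exact .right _ (Set.ncard_sdiff_singleton_lt_of_mem he hg.finite_pending)
  | add R T e p nf nf' he hnf hne ho hnf' =>
    have ha := addStep_of_completion hg.finite_rules hg.finite_pending he hnf ho hnf'
    exact ⟨ha.good hlt hg, fun x y => ha.cong_iff hlt hg, fun W => ha.over,
      .left _ _ ha.leftIdeal_lt⟩

/-! ### Invariants and termination of updates -/

theorem addStep_of_update {R S T : Rules K} {e p : Multiset K × Multiset K}
    {nf nf' : Multiset K → Multiset K} (hR : R.Finite) (hST : (S ∪ T).Finite) (he : e ∈ S)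
    (hnf : ComputesNF R nf) (ho : Orients gt (nf e.1) (nf e.2) p)
    (hnf' : ComputesNF (insert p (keptBy R p)) nf') :
    AddStep gt R (S ∪ T) e p nf nf' (S \ {e} ∪ (T ∪ {c | ∃ q ∈ R,
      nf (critPair p q).1 ≠ nf (critPair p q).2 ∧
      c = (nf (critPair p q).1, nf (critPair p q).2)} ∪ removedBy R p)) where
  mem := .inl he
  nf_spec := hnf
  orients := ho
  nf'_spec := hnf'
  pending_subset := by
    rintro d ⟨h | h, hd⟩
    · exact .inl ⟨h, hd⟩
    · exact .inr (.inl (.inl h))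
  removed_subset := fun _ h => .inr (.inr h)
  pending_finite := by
    refine (hST.subset (Set.sdiff_subset.trans Set.subset_union_left)).union
      (((hST.subset Set.subset_union_right).union ?_).union (hR.subset fun q h => h.1))
    exact finite_image_rules hR _ _
  pending_cases := by
    rintro d (h | ((h | h) | h))
    · exact .inl (.inl h.1)
    · exact .inl (.inr h)
    · obtain ⟨q, hq, _, h⟩ := h
      exact .inr (.inr (.inr ⟨q, hq, h⟩))
    · exact .inr (.inl h.1)
  crit := by
    intro q hq
    by_cases h : nf (critPair p q).1 = nf (critPair p q).2
    · exact .inr (.inl h)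
    · exact .inr (.inr (.inr (.inl (.inr ⟨q, hq, h, rfl⟩))))

/-- The relation between the constant system `RC` and the state of an update with it. -/
structure UpdInv (RC : Set (K × K)) (R : Rules K) (NRC : Set (K × K)) : Prop where
  left_mem : ∀ q ∈ R, ∀ a, q.1 = {a} → a ∈ cdom RC ∪ cdom NRC
  left_of : ∀ a ∈ cdom RC, ∃ q ∈ R, q.1 = {a}
  new : ∀ p ∈ NRC, p.2 < p.1 ∧ p.1 ∉ cdom RC
  same : NRC = ∅ → constRules RC ⊆ R ∧ constPart R ⊆ RC

/-- The new rule cannot reduce a singleton left side: its own left side would be that singleton,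
although it is irreducible. So the constants of `cdom RC` remain left sides, and a new constant rule
has its left side outside `cdom RC`. -/
theorem UpdInv.add (hlt : MonoOrder (ltOf gt)) {RC NRC : Set (K × K)} {R P P' : Rules K}
    {e p : Multiset K × Multiset K} {nf nf' : Multiset K → Multiset K}
    (hg : Good (ltOf gt) R P) (h : AddStep gt R P e p nf nf' P') (hu : UpdInv RC R NRC) :
    UpdInv RC (interreduce R p nf') (NRC ∪ constPart {p}) := by
  have hplt := h.rule_lt hlt hg
  have hnorm := normal_iff.1 h.normal
  have hpconst : ∀ a, p.1 = {a} → ∃ b < a, p = ({a}, {b}) := by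
    intro a ha
    rw [ha] at hplt
    obtain ⟨b, hb, hlt'⟩ := hlt.of_single hplt
    exact ⟨b, hlt', Prod.ext ha hb⟩
  have hle : ∀ a, p.1 ≤ {a} → p.1 = {a} := fun a ha =>
    (Multiset.le_singleton.1 ha).resolve_left (hlt.ne_zero hplt).2
  have hnot : ∀ q ∈ R, ∀ a, q.1 = {a} → ¬ p.1 ≤ q.1 := by
    intro q hq a ha hpq
    rw [ha] at hpq
    exact hnorm q hq (by rw [ha, hle a hpq])
  refine ⟨?_, ?_, ?_, ?_⟩
  · intro x hx a ha
    obtain ⟨q, hq, h1, _⟩ := interreduce_origin h.nf'_spec hx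
    rw [h1] at ha
    rw [cdom_union, ← Set.union_assoc]
    rcases hq with rfl | hq
    · obtain ⟨b, _, hb⟩ := hpconst a ha
      exact .inr ⟨b, hb.symm⟩
    · exact .inl (hu.left_mem q hq.1 a ha)
  · intro a ha
    obtain ⟨q, hq, hqa⟩ := hu.left_of a ha
    obtain ⟨x, hx, h1, _⟩ := interreduce_image h.nf'_spec ⟨hq, hnot q hq a hqa⟩
    exact ⟨x, hx, h1.trans hqa⟩
  · rintro ⟨a, b⟩ (hp | hp)
    · exact hu.new _ hp
    · have hp : ({a}, {b}) = p := hp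
      subst hp
      obtain ⟨b', hb', hb⟩ := hpconst a rfl
      have hb := (Prod.ext_iff.1 hb).2
      simp only [Multiset.singleton_inj] at hb
      subst hb
      refine ⟨hb', fun ha => ?_⟩
      obtain ⟨q, hq, hqa⟩ := hu.left_of a ha
      exact hnorm q hq hqa.le
  · intro hN
    rw [Set.union_empty_iff] at hN
    obtain ⟨h1, h2⟩ := hu.same hN.1
    have hpn : ∀ a, p.1 ≠ {a} := by
      intro a ha
      obtain ⟨b, _, hb⟩ := hpconst a ha
      have : (a, b) ∈ constPart {p} := hb.symm
      rw [hN.2] at this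
      exact this
    -- A rule that is not a constant rule reduces no singleton, so the constant rules keep both
    -- sides.
    have hpn' : ∀ a, ¬ p.1 ≤ {a} := fun a ha => hpn a (hle a ha)
    constructor
    · rintro _ ⟨c, d, hcd, rfl⟩
      refine Set.mem_insert_of_mem _ ⟨({c}, {d}), ⟨h1 ⟨c, d, hcd, rfl⟩, hpn' c⟩, ?_⟩
      rw [if_neg (hpn' d)]
    · rintro ⟨a, b⟩ hx
      rcases hx with hx | ⟨q, hq, hx⟩
      · exact absurd (congrArg Prod.fst hx).symm (hpn a)
      · split_ifs at hx with hpq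
        · have h1 : {a} = q.1 := congrArg Prod.fst hx
          have := hg.oriented q hq.1
          rw [← h1] at this
          obtain ⟨b', hb', _⟩ := hlt.of_single this
          rw [hb'] at hpq
          exact absurd hpq (hpn' b')
        · rw [← hx] at hq
          exact h2 hq.1

/-- A new pass moves `T` to `S`; the weight `2` on `T` turns this into a decrease. A new constant
rule is a consequence of the state in which it arises, so recording it does not affect the
presentation. -/
theorem UpdateStep.invariant (hlt : MonoOrder (ltOf gt)) {RC : Set (K × K)} {st st' : UpdState K}
    (h : UpdateStep gt st st') (hg : Good (ltOf gt) st.R (st.S ∪ st.T))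
    (hu : UpdInv RC st.R st.NRC) :
    Good (ltOf gt) st'.R (st'.S ∪ st'.T) ∧ UpdInv RC st'.R st'.NRC ∧
    (∀ x y, Cong (st'.R ∪ (st'.S ∪ st'.T)) x y ↔ Cong (st.R ∪ (st.S ∪ st.T)) x y) ∧
    (st.NRC ⊆ st'.NRC ∧ ∀ p ∈ st'.NRC, p ∈ st.NRC ∨ Cong (st.R ∪ (st.S ∪ st.T)) {p.1} {p.2}) ∧
    InnerLt (leftUpper st'.R, 2 * st'.T.ncard + st'.S.ncard)
      (leftUpper st.R, 2 * st.T.ncard + st.S.ncard) := by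
  cases h with
  | discard R NRC S T e nf he hnf hd =>
    have hsub1 : (S ∪ T) \ {e} ⊆ S \ {e} ∪ T := by
      rintro d ⟨h | h, hd⟩
      · exact .inl ⟨h, hd⟩
      · exact .inr h
    have hsub2 : S \ {e} ∪ T ⊆ S ∪ T := Set.union_subset_union_left _ Set.sdiff_subset
    refine ⟨⟨hg.finite_rules, hg.finite_pending.subset hsub2, hg.oriented,
      fun d hd => hg.ne_zero d (hsub2 hd), fun p hp q hq =>
        ((hg.discard hlt hnf hd).complete p hp q hq).mono (Set.union_subset_union_right _ hsub1)⟩,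
      hu, fun x y => cong_iff_of_discard hlt hg.oriented hnf hd hsub1 hsub2,
      ⟨subset_rfl, fun p hp => .inl hp⟩, ?_⟩
    exact .right _ (Nat.add_lt_add_left (Set.ncard_sdiff_singleton_lt_of_mem he
      (hg.finite_pending.subset Set.subset_union_left)) _)
  | add R NRC S T e p nf nf' he hnf hne ho hnf' =>
    have ha := addStep_of_update hg.finite_rules hg.finite_pending he hnf ho hnf'
    refine ⟨ha.good hlt hg, hu.add hlt hg ha, fun x y => ha.cong_iff hlt hg,
      ⟨Set.subset_union_left, ?_⟩, .left _ _ ha.leftIdeal_lt⟩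
    rintro ⟨a, b⟩ (hp | hp)
    · exact .inl hp
    · have hp : ({a}, {b}) = p := hp
      subst hp
      exact .inr (Cong.rule_add ha)
  | nextPass R NRC T hT =>
    simp only [Set.empty_union, Set.union_empty] at hg ⊢
    refine ⟨hg, hu, fun x y => trivial, ⟨subset_rfl, fun p hp => .inl hp⟩, .right _ ?_⟩
    have := (Set.ncard_pos hg.finite_pending).2 (Set.nonempty_iff_ne_empty.2 hT)
    simp only [Set.ncard_empty]
    omega

/-- Without the affected rules all left sides avoid `cdom RC`, so the constant rules overlap none of
them. The critical pairs of the remaining rules stay connected because the affected rules are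
pending. -/
theorem updStart_good (hlt : MonoOrder lt) {RC : Set (K × K)} (hRC : IsConstSystem RC)
    {R : Rules K} [Finite K] (hg : Good lt R ∅) :
    Good lt (updStart R RC).R ((updStart R RC).S ∪ (updStart R RC).T) := by
  have hoC := oriented_constRules hlt fun p hp => hRC.lt hp
  have hsub : R \ affected RC R ⊆ R := Set.sdiff_subset
  have hcover : R ⊆ (constRules RC ∪ R \ affected RC R) ∪ (affected RC R ∪ ∅) := by
    intro q hq
    by_cases h : q ∈ affected RC R
    · exact .inr (.inl h)
    · exact .inl (.inr ⟨hq, h⟩)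
  refine ⟨?_, ?_, ?_, ?_, ?_⟩
  · refine Set.Finite.union ?_ (hg.finite_rules.subset hsub)
    refine ((Set.toFinite RC).image fun p => (({p.1} : Multiset K), ({p.2} : Multiset K))).subset ?_
    rintro _ ⟨c, d, h, rfl⟩
    exact ⟨(c, d), h, rfl⟩
  · exact (hg.finite_rules.subset fun q h => h.1).union Set.finite_empty
  · rintro q (hq | hq)
    · exact hoC q hq
    · exact hg.oriented q hq.1
  · rintro q (hq | hq)
    · exact (hlt.ne_zero (hg.oriented q hq.1)).symm
    · exact hq.elim
  · refine CPComplete.union_constRules hlt hRC (fun q hq => hg.oriented q hq.1) ?_ ?_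
      (fun q hq => .inl (.inr hq)) fun q hq => .inl (.inl hq)
    · intro q hq
      rw [← normal_constRules]
      by_contra h
      exact hq.2 ⟨hq.1, h⟩
    · exact fun p hp q hq => (hg.complete p hp.1 q hq.1).mono
        (by rw [Set.union_empty]; exact hcover)

/-- By hypothesis every constant rule of `R` is affected, so the only constant rules at the start
are those of `RC`. -/
theorem updStart_inv {RC : Set (K × K)} {R : Rules K}
    (hR : ∀ q ∈ R, ∀ a, q.1 = {a} → a ∈ cdom RC) :
    UpdInv RC (updStart R RC).R (updStart R RC).NRC := by
  have key : ∀ q ∈ R \ affected RC R, ∀ a, q.1 ≠ {a} := by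
    intro q hq a ha
    refine hq.2 ⟨hq.1, fun hn => ?_⟩
    rw [normal_constRules, ha] at hn
    exact hn a (by simp) (hR q hq.1 a ha)
  refine ⟨?_, ?_, fun p hp => hp.elim, fun _ => ⟨Set.subset_union_left, ?_⟩⟩
  · rintro q (⟨c, d, h, rfl⟩ | hq) a ha
    · have : c = a := by simpa using ha
      exact .inl (this ▸ ⟨d, h⟩)
    · exact absurd ha (key q hq a)
  · rintro a ⟨b, h⟩
    exact ⟨_, .inl ⟨a, b, h, rfl⟩, rfl⟩
  · rintro ⟨a, b⟩ (⟨c, d, h, he⟩ | hq)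
    · simp only [Prod.mk.injEq, Multiset.singleton_inj] at he
      obtain ⟨rfl, rfl⟩ := he
      exact h
    · exact absurd rfl (key _ hq a)

/-! ### Progress -/

theorem exists_orients (hgt : IsAdmissible gt) {s t : Multiset K} (hs : s ≠ 0) (ht : t ≠ 0)
    (h : s ≠ t) : ∃ p, Orients gt s t p := by
  rcases hgt.total s t hs ht h with h | h
  · exact ⟨(s, t), h, .inl rfl⟩
  · exact ⟨(t, s), h, .inr rfl⟩

theorem exists_completionStep (hgt : IsAdmissible gt) {R T : Rules K} (hg : Good (ltOf gt) R T)
    (hT : T ≠ ∅) : ∃ st', CompletionStep gt (R, T) st' := by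
  have hlt := hgt.monoOrder
  obtain ⟨e, he⟩ := Set.nonempty_iff_ne_empty.2 hT
  obtain ⟨nf, hnf⟩ := hg.oriented.exists_computesNF hlt
  by_cases hd : nf e.1 = nf e.2
  · exact ⟨_, .discard R T e nf he hnf hd⟩
  · have h1 := hg.oriented.rtc_ne_zero hlt (hnf e.1).1 (hg.ne_zero e he).1
    have h2 := hg.oriented.rtc_ne_zero hlt (hnf e.2).1 (hg.ne_zero e he).2
    obtain ⟨p, hp⟩ := exists_orients hgt h1 h2 hd
    obtain ⟨nf', hnf'⟩ := (hg.oriented.insert_kept (hp.rule_lt h1 h2)).exists_computesNF hlt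
    exact ⟨_, .add R T e p nf nf' he hnf hd hp hnf'⟩

theorem exists_updateStep (hgt : IsAdmissible gt) {R S T : Rules K} {NRC : Set (K × K)}
    (hg : Good (ltOf gt) R (S ∪ T)) (hST : ¬ (S = ∅ ∧ T = ∅)) :
    ∃ st', UpdateStep gt ⟨R, NRC, S, T⟩ st' := by
  have hlt := hgt.monoOrder
  rcases S.eq_empty_or_nonempty with rfl | ⟨e, he⟩
  · exact ⟨_, .nextPass R NRC T fun h => hST ⟨rfl, h⟩⟩
  obtain ⟨nf, hnf⟩ := hg.oriented.exists_computesNF hlt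
  by_cases hd : nf e.1 = nf e.2
  · exact ⟨_, .discard R NRC S T e nf he hnf hd⟩
  · have h1 := hg.oriented.rtc_ne_zero hlt (hnf e.1).1 (hg.ne_zero e (.inl he)).1
    have h2 := hg.oriented.rtc_ne_zero hlt (hnf e.2).1 (hg.ne_zero e (.inl he)).2
    obtain ⟨p, hp⟩ := exists_orients hgt h1 h2 hd
    obtain ⟨nf', hnf'⟩ := (hg.oriented.insert_kept (hp.rule_lt h1 h2)).exists_computesNF hlt
    exact ⟨_, .add R NRC S T e p nf nf' he hnf hd hp hnf'⟩

end Constants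


/-! ### Values of monomials in quotients of the term algebra -/

section Semantics

variable {F C K : Type*}

theorem ACCC.of_forall {E E' : Set (GTerm F C × GTerm F C)} (h : ∀ e ∈ E, ACCC E' e.1 e.2)
    {s t : GTerm F C} (hst : ACCC E s t) : ACCC E' s t := by
  induction hst with
  | ax s t hm => exact h _ hm
  | refl s => exact .refl s
  | symm s t _ ih => exact .symm _ _ ih
  | trans s t u _ _ ih1 ih2 => exact .trans _ _ _ ih1 ih2
  | congr f s s' t t' _ _ ih1 ih2 => exact .congr f _ _ _ _ ih1 ih2
  | comm f s t => exact .comm f s t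
  | assoc f s t u => exact .assoc f s t u

theorem ACCC.mono {E E' : Set (GTerm F C × GTerm F C)} (h : E ⊆ E') {s t : GTerm F C}
    (hst : ACCC E s t) : ACCC E' s t := hst.of_forall fun _ he => .ax _ _ (h he)

/-- The congruence closure of `E` as a setoid. -/
def closureSetoid (E : Set (GTerm F C × GTerm F C)) : Setoid (GTerm F C) where
  r := ACCC E
  iseqv := ⟨ACCC.refl, fun {s t} h => ACCC.symm s t h, fun {s t u} h h' => ACCC.trans s t u h h'⟩

/-- The term algebra modulo `E`, as a semigroup under the symbol `f`. -/
def TermSemigroup (E : Set (GTerm F C × GTerm F C)) (_ : F) : Type _ :=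
  Quotient (closureSetoid E)

/-- The class of a term. -/
def TermSemigroup.mk (E : Set (GTerm F C × GTerm F C)) (f : F) (t : GTerm F C) :
    TermSemigroup E f := Quotient.mk (closureSetoid E) t

theorem TermSemigroup.mk_eq {E : Set (GTerm F C × GTerm F C)} {f : F} {s t : GTerm F C} :
    TermSemigroup.mk E f s = TermSemigroup.mk E f t ↔ ACCC E s t :=
  ⟨fun h => Quotient.exact h, fun h => Quotient.sound (s := closureSetoid E) h⟩

instance (E : Set (GTerm F C × GTerm F C)) (f : F) : CommSemigroup (TermSemigroup E f) where
  mul := Quotient.map₂ (GTerm.app f) fun _ _ h1 _ _ h2 => ACCC.congr f _ _ _ _ h1 h2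
  mul_assoc := by
    rintro ⟨a⟩ ⟨b⟩ ⟨c⟩
    exact Quotient.sound (s := closureSetoid E) ((ACCC.assoc f a b c).symm _ _)
  mul_comm := by
    rintro ⟨a⟩ ⟨b⟩
    exact Quotient.sound (s := closureSetoid E) (ACCC.comm f a b)

/-- The class of a term in the monoid obtained by adjoining a unit. -/
def termClass (E : Set (GTerm F C × GTerm F C)) (f : F) (t : GTerm F C) :
    WithOne (TermSemigroup E f) := (TermSemigroup.mk E f t : WithOne (TermSemigroup E f))

theorem termClass_eq {E : Set (GTerm F C × GTerm F C)} {f : F} {s t : GTerm F C} :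
    termClass E f s = termClass E f t ↔ ACCC E s t := by
  rw [termClass, termClass, WithOne.coe_inj, TermSemigroup.mk_eq]

theorem termClass_app {E : Set (GTerm F C × GTerm F C)} {f : F} {s t : GTerm F C} :
    termClass E f (.app f s t) = termClass E f s * termClass E f t := rfl

/-- Replacing the constants by terms. -/
def GTerm.subst (φ : K → GTerm F C) : GTerm F K → GTerm F C
  | .const c => φ c
  | .app f s t => .app f (s.subst φ) (t.subst φ)

theorem GTerm.subst_const (t : GTerm F K) : t.subst .const = t := by
  induction t with
  | const c => rfl
  | app f s t ih1 ih2 => rw [GTerm.subst, ih1, ih2]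

/-- The value of an `f`-monomial under an interpretation of the constants. -/
def monoVal (E : Set (GTerm F C × GTerm F C)) (φ : K → GTerm F C) (f : F) (M : Multiset K) :
    WithOne (TermSemigroup E f) := (M.map fun c => termClass E f (φ c)).prod

variable {E : Set (GTerm F C × GTerm F C)} {φ : K → GTerm F C} {f : F}

theorem monoVal_add (A B : Multiset K) :
    monoVal E φ f (A + B) = monoVal E φ f A * monoVal E φ f B := by
  simp [monoVal]

theorem monoVal_singleton (c : K) : monoVal E φ f {c} = termClass E f (φ c) := by
  simp [monoVal]

theorem IsMono.monoVal {M : Multiset K} {t : GTerm F K} (h : IsMono f M t) :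
    monoVal E φ f M = termClass E f (t.subst φ) := by
  induction h with
  | const c => exact monoVal_singleton c
  | app A B s t _ _ ih1 ih2 => rw [monoVal_add, ih1, ih2]; rfl

theorem exists_isMono (f : F) {M : Multiset K} (hM : M ≠ 0) : ∃ t, IsMono f M t := by
  induction M using Multiset.induction_on with
  | empty => exact absurd rfl hM
  | cons a M ih =>
    by_cases h : M = 0
    · exact ⟨.const a, h ▸ .const a⟩
    · obtain ⟨t, ht⟩ := ih h
      exact ⟨_, .app {a} M _ _ (.const a) ht⟩

theorem IsMono.eq_const {a : K} {t : GTerm F K} (h : IsMono f {a} t) : t = .const a := by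
  have key : ∀ {M : Multiset K} {t : GTerm F K}, IsMono f M t → M ≠ 0 := by
    intro M t h
    induction h with
    | const c => simp
    | app A B s t _ _ ih1 _ => simp [ih1]
  generalize hM : ({a} : Multiset K) = M at h
  cases h with
  | const c => rw [Multiset.singleton_inj.1 hM]
  | app A B s t h1 h2 =>
    have := congrArg Multiset.card hM
    have h1 := Multiset.card_pos.2 (key h1)
    have h2 := Multiset.card_pos.2 (key h2)
    simp only [Multiset.card_singleton, Multiset.card_add] at this
    omega

/-- The interpretation satisfies the constant equations `A`. -/
def SatC (E : Set (GTerm F C × GTerm F C)) (φ : K → GTerm F C) (A : Set (K × K)) : Prop :=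
  ∀ p ∈ A, ACCC E (φ p.1) (φ p.2)

/-- The interpretation satisfies the equations `P` between `f`-monomials. -/
def SatF (E : Set (GTerm F C × GTerm F C)) (φ : K → GTerm F C) (f : F) (P : Rules K) : Prop :=
  ∀ p ∈ P, monoVal E φ f p.1 = monoVal E φ f p.2

/-- The interpretation satisfies all equations of a presentation. -/
def Sat (E : Set (GTerm F C × GTerm F C)) (φ : K → GTerm F C) (A : Set (K × K))
    (P : F → Rules K) : Prop := SatC E φ A ∧ ∀ f, SatF E φ f (P f)

theorem Sat.accc {A : Set (K × K)} {P : F → Rules K} (h : Sat E φ A P) {s t : GTerm F K}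
    (hst : ACCC (toTermPairs A P) s t) : ACCC E (s.subst φ) (t.subst φ) := by
  induction hst with
  | ax s t hm =>
    rcases hm with ⟨c, d, hcd, he⟩ | ⟨f, M, N, hMN, h1, h2⟩
    · obtain ⟨rfl, rfl⟩ := Prod.mk.inj he
      exact h.1 _ hcd
    · rw [← termClass_eq (f := f), ← h1.monoVal, ← h2.monoVal]
      exact h.2 f _ hMN
  | refl s => exact .refl _
  | symm s t _ ih => exact .symm _ _ ih
  | trans s t u _ _ ih1 ih2 => exact .trans _ _ _ ih1 ih2
  | congr f s s' t t' _ _ ih1 ih2 => exact .congr f _ _ _ _ ih1 ih2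
  | comm f s t => exact .comm f _ _
  | assoc f s t u => exact .assoc f _ _ _

/-- Nonempty sides matter: no term represents the empty multiset, so an equation with an empty side
would contribute no term pair. -/
theorem sat_toTermPairs {A : Set (K × K)} {P : F → Rules K}
    (hP : ∀ f, ∀ p ∈ P f, p.1 ≠ 0 ∧ p.2 ≠ 0) : Sat (toTermPairs A P) .const A P := by
  refine ⟨fun p hp => .ax _ _ (.inl ⟨p.1, p.2, hp, rfl⟩), fun f p hp => ?_⟩
  obtain ⟨s, hs⟩ := exists_isMono f (hP f p hp).1
  obtain ⟨t, ht⟩ := exists_isMono f (hP f p hp).2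
  rw [hs.monoVal, ht.monoVal, termClass_eq, GTerm.subst_const, GTerm.subst_const]
  exact .ax _ _ (.inr ⟨f, p.1, p.2, hp, hs, ht⟩)

/-- Each closure satisfies its own presentation, by `h` also the other one, and so contains the
other closure. -/
theorem accc_iff_of_sat_iff {A A' : Set (K × K)} {P P' : F → Rules K}
    (hP : ∀ f, ∀ p ∈ P f, p.1 ≠ 0 ∧ p.2 ≠ 0) (hP' : ∀ f, ∀ p ∈ P' f, p.1 ≠ 0 ∧ p.2 ≠ 0)
    (h : ∀ E : Set (GTerm F K × GTerm F K), Sat E .const A P ↔ Sat E .const A' P')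
    (s t : GTerm F K) : ACCC (toTermPairs A P) s t ↔ ACCC (toTermPairs A' P') s t := by
  have h1 := ((h _).1 (sat_toTermPairs hP)).accc (s := s) (t := t)
  have h2 := ((h _).2 (sat_toTermPairs hP')).accc (s := s) (t := t)
  simp only [GTerm.subst_const] at h1 h2
  exact ⟨h2, h1⟩

theorem SatF.cong {P : Rules K} (h : SatF E φ f P) {x y : Multiset K} (hxy : Cong P x y) :
    monoVal E φ f x = monoVal E φ f y :=
  hxy.rec_on (Q := fun x y => monoVal E φ f x = monoVal E φ f y)
    ⟨fun _ => rfl, fun h => h.symm, fun h h' => h.trans h'⟩ fun e he C _ _ => by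
      rw [monoVal_add, monoVal_add, h e he]

theorem satF_congr {P P' : Rules K} (h : ∀ x y, Cong P x y ↔ Cong P' x y) :
    SatF E φ f P ↔ SatF E φ f P' :=
  ⟨fun hs _ he => hs.cong ((h _ _).2 (.of_mem he)), fun hs _ he =>
    hs.cong ((h _ _).1 (.of_mem he))⟩

theorem satF_union {P P' : Rules K} :
    SatF E φ f (P ∪ P') ↔ SatF E φ f P ∧ SatF E φ f P' := by
  simp only [SatF, Set.mem_union, or_imp, forall_and]

theorem satC_union {A A' : Set (K × K)} :
    SatC E φ (A ∪ A') ↔ SatC E φ A ∧ SatC E φ A' := by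
  simp only [SatC, Set.mem_union, or_imp, forall_and]

theorem satF_empty : SatF E φ f ∅ := fun _ h => h.elim

theorem satC_empty : SatC E φ ∅ := fun _ h => h.elim

theorem satF_constRules {A : Set (K × K)} :
    SatF E φ f (constRules A) ↔ SatC E φ A := by
  constructor
  · intro h p hp
    have := h _ ⟨p.1, p.2, hp, rfl⟩
    rwa [monoVal_singleton, monoVal_singleton, termClass_eq] at this
  · rintro h _ ⟨c, d, hcd, rfl⟩
    rw [monoVal_singleton, monoVal_singleton, termClass_eq]
    exact h _ hcd

theorem SatF.satC_constPart {P : Rules K} (h : SatF E φ f P) : SatC E φ (constPart P) := by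
  intro p hp
  have := h _ hp
  rwa [monoVal_singleton, monoVal_singleton, termClass_eq] at this

theorem SatC.eqvGen {A : Set (K × K)} (h : SatC E φ A) {a b : K}
    (hab : Relation.EqvGen (fun a b => (a, b) ∈ A) a b) : ACCC E (φ a) (φ b) := by
  induction hab with
  | rel a b hm => exact h _ hm
  | refl a => exact .refl _
  | symm a b _ ih => exact .symm _ _ ih
  | trans a b c _ _ ih1 ih2 => exact .trans _ _ _ ih1 ih2

theorem satC_constSystem [LinearOrder K] [Finite K] {A : Set (K × K)} :
    SatC E φ (constSystem A) ↔ SatC E φ A :=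
  ⟨fun h _ hp => h.eqvGen (eqvGen_constSystem_of_mem hp), fun h _ hp => h.eqvGen hp.2.1⟩

theorem satF_normalizeBy [LinearOrder K] {lt : Multiset K → Multiset K → Prop}
    (hlt : MonoOrder lt) {RC : Set (K × K)} (hRC : ∀ p ∈ RC, p.2 < p.1) {S : Rules K}
    (h : SatC E φ RC) : SatF E φ f (normalizeBy RC S) ↔ SatF E φ f S := by
  have hnf : ∀ {M N}, IsNF (constRules RC) M N → monoVal E φ f M = monoVal E φ f N :=
    fun hMN => (satF_constRules.2 h).cong (cong_of_rtc hMN.1)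
  constructor
  · intro hs e he
    obtain ⟨a, ha⟩ := (oriented_constRules hlt hRC).exists_nf hlt e.1
    obtain ⟨b, hb⟩ := (oriented_constRules hlt hRC).exists_nf hlt e.2
    rw [hnf ha, hnf hb]
    exact hs (a, b) ⟨e, he, ha, hb⟩
  · rintro hs d ⟨e, he, h1, h2⟩
    rw [← hnf h1, ← hnf h2]
    exact hs e he

end Semantics

/-! ### Purification -/

section Purification

variable {F C K : Type*} [DecidableEq F] {i : C ↪ K} {S : Set (GTerm F C × GTerm F C)}
  {ν : ACTerm F C → K}

theorem GTerm.aliens_subset_of_mem {t : GTerm F C} {h : Option F} {g : F} {a b : GTerm F C}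
    (hu : .app g a b ∈ t.aliens h) :
    a.aliens (some g) ⊆ t.aliens h ∧ b.aliens (some g) ⊆ t.aliens h := by
  induction t generalizing h with
  | const c => exact hu.elim
  | app k s t ih1 ih2 =>
    rcases hu with (⟨hu, _⟩ | hu) | hu
    · obtain ⟨rfl, rfl, rfl⟩ := GTerm.app.inj hu
      exact ⟨fun x hx => .inl (.inr hx), fun x hx => .inr hx⟩
    · exact ⟨fun x hx => .inl (.inr ((ih1 hu).1 hx)), fun x hx => .inl (.inr ((ih1 hu).2 hx))⟩
    · exact ⟨fun x hx => .inr ((ih2 hu).1 hx), fun x hx => .inr ((ih2 hu).2 hx)⟩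

theorem aliens_subset_aliensOf {g : F} {a b : GTerm F C} (hu : .app g a b ∈ aliensOf S) :
    a.aliens (some g) ⊆ aliensOf S ∧ b.aliens (some g) ⊆ aliensOf S := by
  obtain ⟨e, he, hu | hu⟩ := hu
  · obtain ⟨h1, h2⟩ := GTerm.aliens_subset_of_mem hu
    exact ⟨fun x hx => ⟨e, he, .inl (h1 hx)⟩, fun x hx => ⟨e, he, .inl (h2 hx)⟩⟩
  · obtain ⟨h1, h2⟩ := GTerm.aliens_subset_of_mem hu
    exact ⟨fun x hx => ⟨e, he, .inr (h1 hx)⟩, fun x hx => ⟨e, he, .inr (h2 hx)⟩⟩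

theorem GTerm.aliens_finite (t : GTerm F C) (h : Option F) : (t.aliens h).Finite := by
  induction t generalizing h with
  | const c => exact Set.finite_empty
  | app g s t ih1 ih2 =>
    refine (Set.Finite.union ?_ (ih1 _)).union (ih2 _)
    exact (Set.finite_singleton (GTerm.app g s t)).subset fun u hu => hu.1

theorem aliensOf_finite (hS : S.Finite) : (aliensOf S).Finite := by
  refine (hS.biUnion fun e _ => (e.1.aliens_finite (eqSymbol e)).union
    (e.2.aliens_finite (eqSymbol e))).subset ?_
  rintro u ⟨e, he, hu⟩
  exact Set.mem_biUnion he hu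

theorem GTerm.flat_ne_zero (f : F) (t : GTerm F C) : t.flat i ν f ≠ 0 := by
  induction t with
  | const c => simp [GTerm.flat]
  | app g s t ih1 _ =>
    rw [GTerm.flat]
    split_ifs <;> simp [ih1]

theorem purifyAC_ne_zero (f : F) : ∀ e ∈ purifyAC i ν S f, e.1 ≠ 0 ∧ e.2 ≠ 0 := by
  rintro p (⟨e, _, _, rfl⟩ | ⟨u, _, _, rfl⟩)
  · exact ⟨GTerm.flat_ne_zero _ _, GTerm.flat_ne_zero _ _⟩
  · exact ⟨GTerm.flat_ne_zero _ _, by simp⟩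

theorem purifyAC_finite (hS : S.Finite) (f : F) : (purifyAC i ν S f).Finite := by
  refine ((hS.image fun e => (e.1.flat i ν f, e.2.flat i ν f)).union
    ((aliensOf_finite hS).image fun u => (u.flat i ν f, {u.name i ν}))).subset ?_
  rintro p (⟨e, he, _, rfl⟩ | ⟨u, hu, _, rfl⟩)
  · exact .inl ⟨e, he, rfl⟩
  · exact .inr ⟨u, hu, rfl⟩

/-- `t` is a constant or has a name. -/
def HasName (S : Set (GTerm F C × GTerm F C)) (t : GTerm F C) : Prop :=
  t.head = none ∨ t ∈ aliensOf S

theorem hasName_of_aliens {t : GTerm F C} {h : Option F} (ht : t.aliens h ⊆ aliensOf S)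
    (hh : h = none ∨ t.head ≠ h) : HasName S t := by
  cases t with
  | const c => exact .inl rfl
  | app g s t =>
    refine .inr (ht (.inl (.inl ⟨rfl, ?_⟩)))
    rcases hh with rfl | hh
    · simp
    · exact hh.symm

/-- Flattening and naming preserve values if named terms have the values of their names. -/
theorem monoVal_flat {D : Type*} {E : Set (GTerm F D × GTerm F D)} {φ : K → GTerm F D}
    {ψ : C → GTerm F D} (hφ : ∀ c, φ (i c) = ψ c) {f : F} (t : GTerm F C)
    (ht : t.aliens (some f) ⊆ aliensOf S)
    (hn : ∀ g a b, .app g a b ∈ t.aliens (some f) →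
      ACCC E (φ (GTerm.name i ν (.app g a b))) ((GTerm.app g a b).subst ψ)) :
    monoVal E φ f (t.flat i ν f) = termClass E f (t.subst ψ) := by
  induction t with
  | const c => rw [GTerm.flat, monoVal_singleton, hφ]; rfl
  | app g s t ih1 ih2 =>
    rw [GTerm.flat]
    split_ifs with hg
    · subst hg
      rw [monoVal_add, ih1 (fun x hx => ht (.inl (.inr hx))) fun k a b h => hn k a b (.inl (.inr h)),
        ih2 (fun x hx => ht (.inr hx)) fun k a b h => hn k a b (.inr h)]
      rfl
    · rw [monoVal_singleton, termClass_eq]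
      exact hn _ _ _ (.inl (.inl ⟨rfl, by simpa using Ne.symm hg⟩))

theorem eqSymbol_eq_none {e : GTerm F C × GTerm F C} (h : eqSymbol e = none) :
    ∀ u, u = e.1 ∨ u = e.2 → HasName {e} u := by
  rintro u (rfl | rfl)
  · exact hasName_of_aliens (h := none) (fun x hx => ⟨e, rfl, .inl (h ▸ hx)⟩) (.inl rfl)
  · exact hasName_of_aliens (h := none) (fun x hx => ⟨e, rfl, .inr (h ▸ hx)⟩) (.inl rfl)

/-- The equations of `S` follow from the purified equations. -/
theorem accc_map_of_accc {u v : GTerm F C} (h : ACCC S u v) :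
    ACCC (toTermPairs (purifyConst i ν S) (purifyAC i ν S)) (u.map i) (v.map i) := by
  set E := toTermPairs (purifyConst i ν S) (purifyAC i ν S) with hE
  have hmap : ∀ t : GTerm F C, t.map i = t.subst fun c => .const (i c) := by
    intro t
    induction t with
    | const c => rfl
    | app f s t ih1 ih2 => rw [GTerm.map, ih1, ih2]; rfl
  have hsat : Sat E .const (purifyConst i ν S) (purifyAC i ν S) :=
    sat_toTermPairs fun f => purifyAC_ne_zero f
  -- The claim covers `t` and all its aliens in any context `h`, so that the induction on `t`
  -- reaches the aliens of its arguments. For `t` itself the defining equation of its name then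
  -- suffices.
  have hname : ∀ t : GTerm F C, ∀ g a b, t = .app g a b ∨ (∃ h, .app g a b ∈ t.aliens h) →
      .app g a b ∈ aliensOf S → ACCC E (.const (GTerm.name i ν (.app g a b)))
        ((GTerm.app g a b).subst fun c => .const (i c)) := by
    intro t
    induction t with
    | const c => rintro g a b (h | ⟨h, h'⟩) <;> cases h <;> exact h'.elim
    | app k s t ih1 ih2 =>
      intro g a b hgab hmem
      have hsub : ∀ g a b, (∃ h, .app g a b ∈ s.aliens h) ∨ (∃ h, .app g a b ∈ t.aliens h) →
          .app g a b ∈ aliensOf S → ACCC E (.const (GTerm.name i ν (.app g a b)))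
            ((GTerm.app g a b).subst fun c => .const (i c)) := by
        rintro g a b (h | h) hm
        · exact ih1 g a b (.inr h) hm
        · exact ih2 g a b (.inr h) hm
      by_cases heq : GTerm.app k s t = .app g a b
      · obtain ⟨rfl, rfl, rfl⟩ := GTerm.app.inj heq
        obtain ⟨h1, h2⟩ := aliens_subset_aliensOf hmem
        have e1 := monoVal_flat (E := E) (φ := GTerm.const) (ψ := fun c => .const (i c)) (i := i)
          (ν := ν) (S := S) (fun _ => rfl) s h1 fun g a b h => hsub g a b (.inl ⟨_, h⟩) (h1 h)
        have e2 := monoVal_flat (E := E) (φ := GTerm.const) (ψ := fun c => .const (i c)) (i := i)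
          (ν := ν) (S := S) (fun _ => rfl) t h2 fun g a b h => hsub g a b (.inr ⟨_, h⟩) (h2 h)
        have e3 := hsat.2 k _ (.inr ⟨_, hmem, rfl, rfl⟩)
        simp only [GTerm.flat, if_true, monoVal_add, monoVal_singleton] at e3
        rw [e1, e2, ← termClass_app, termClass_eq] at e3
        exact e3.symm _ _
      · rcases hgab with h | ⟨h, (⟨h', _⟩ | h') | h'⟩
        · exact absurd h heq
        · exact absurd h'.symm heq
        · exact hsub g a b (.inl ⟨_, h'⟩) hmem
        · exact hsub g a b (.inr ⟨_, h'⟩) hmem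
  have hname' : ∀ t : GTerm F C, HasName S t →
      ACCC E (.const (t.name i ν)) (t.subst fun c => .const (i c)) := by
    rintro (c | ⟨g, a, b⟩) ht
    · exact .refl _
    · exact hname _ g a b (.inl rfl) (ht.resolve_left (by simp [GTerm.head]))
  have hflat : ∀ (f : F) (t : GTerm F C), t.aliens (some f) ⊆ aliensOf S →
      monoVal E .const f (t.flat i ν f) = termClass E f (t.subst fun c => .const (i c)) :=
    fun f t ht => monoVal_flat (fun _ => rfl) t ht fun g a b h =>
      hname t g a b (.inr ⟨_, h⟩) (ht h)
  have hS : ∀ e ∈ S, ACCC E (e.1.map i) (e.2.map i) := by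
    intro e he
    rw [hmap, hmap]
    cases hs : eqSymbol e with
    | none =>
      have hn : ∀ u, u = e.1 ∨ u = e.2 → HasName S u := fun u hu =>
        (eqSymbol_eq_none hs u hu).imp id fun ⟨e', h1, h2⟩ => ⟨e', h1 ▸ he, h2⟩
      have h1 := hname' e.1 (hn _ (.inl rfl))
      have h2 := hname' e.2 (hn _ (.inr rfl))
      exact (h1.symm _ _).trans _ _ _ ((hsat.1 _ ⟨e, he, hs, rfl⟩).trans _ _ _ h2)
    | some f =>
      have h := hsat.2 f _ (.inl ⟨e, he, hs, rfl⟩)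
      rw [hflat f e.1 fun x hx => ⟨e, he, .inl (hs ▸ hx)⟩,
        hflat f e.2 fun x hx => ⟨e, he, .inr (hs ▸ hx)⟩, termClass_eq] at h
      exact h
  induction h with
  | ax s t hm => exact hS _ hm
  | refl s => exact .refl _
  | symm s t _ ih => exact .symm _ _ ih
  | trans s t u _ _ ih1 ih2 => exact .trans _ _ _ ih1 ih2
  | congr f s s' t t' _ _ ih1 ih2 => exact .congr f _ _ _ _ ih1 ih2
  | comm f s t => exact .comm f _ _
  | assoc f s t u => exact .assoc f _ _ _

open Classical in
/-- The term named by a constant. -/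
noncomputable def unname (i : C ↪ K) (S : Set (GTerm F C × GTerm F C)) (ν : ACTerm F C → K)
    (d : GTerm F C) (k : K) : GTerm F C :=
  if h : ∃ c, i c = k then .const h.choose
  else if h : ∃ u ∈ aliensOf S, ν (Quotient.mk _ u) = k then h.choose else d

theorem unname_const (d : GTerm F C) (c : C) : unname i S ν d (i c) = .const c := by
  have h : ∃ c', i c' = i c := ⟨c, rfl⟩
  rw [unname, dif_pos h, i.injective h.choose_spec]

/-- The term chosen for the name need not be `t`, but injectivity of the naming makes the two equal
modulo AC. Freshness excludes that the name is read as an original constant. -/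
theorem unname_name (hν : IsNaming i S ν) (d : GTerm F C) {t : GTerm F C} (ht : HasName S t) :
    ACCC S (unname i S ν d (t.name i ν)) t := by
  cases t with
  | const c => rw [GTerm.name, unname_const]; exact .refl _
  | app g a b =>
    have hm : .app g a b ∈ aliensOf S := ht.resolve_left (by simp [GTerm.head])
    have h : ∃ u ∈ aliensOf S, ν (Quotient.mk _ u) = ν (Quotient.mk _ (.app g a b)) :=
      ⟨_, hm, rfl⟩
    have h' : ¬ ∃ c, i c = ν (Quotient.mk _ (.app g a b)) := fun ⟨c, hc⟩ =>
      hν.fresh _ hm c hc.symm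
    rw [GTerm.name, unname, dif_neg h', dif_pos h]
    have := hν.inj _ h.choose_spec.1 _ hm h.choose_spec.2
    exact ACCC.mono (Set.empty_subset S) (Quotient.exact this)

/-- The purified equations are conservative over `S`. -/
theorem accc_of_accc_map (hν : IsNaming i S ν) {u v : GTerm F C}
    (h : ACCC (toTermPairs (purifyConst i ν S) (purifyAC i ν S)) (u.map i) (v.map i)) :
    ACCC S u v := by
  -- The interpretation fixes the original terms. `u` is only the default value for constants that
  -- name nothing.
  have hsubst : ∀ t : GTerm F C, (t.map i).subst (unname i S ν u) = t := by
    intro t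
    induction t with
    | const c => exact unname_const u c
    | app f s t ih1 ih2 => rw [GTerm.map, GTerm.subst, ih1, ih2]
  have hflat : ∀ (f : F) (t : GTerm F C), t.aliens (some f) ⊆ aliensOf S →
      monoVal S (unname i S ν u) f (t.flat i ν f) = termClass S f t := by
    intro f t ht
    have := monoVal_flat (E := S) (φ := unname i S ν u) (ψ := GTerm.const) (i := i) (ν := ν)
      (unname_const u) t ht fun g a b h => by
        rw [GTerm.subst_const]
        exact unname_name hν u (.inr (ht h))
    rwa [GTerm.subst_const] at this
  have hsat : Sat S (unname i S ν u) (purifyConst i ν S) (purifyAC i ν S) := by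
    constructor
    · rintro p ⟨e, he, hs, rfl⟩
      have hn : ∀ u, u = e.1 ∨ u = e.2 → HasName S u := fun u hu =>
        (eqSymbol_eq_none hs u hu).imp id fun ⟨e', h1, h2⟩ => ⟨e', h1 ▸ he, h2⟩
      have h1 := unname_name hν u (hn _ (.inl rfl))
      have h2 := unname_name hν u (hn _ (.inr rfl))
      exact h1.trans _ _ _ ((ACCC.ax _ _ he).trans _ _ _ (h2.symm _ _))
    · rintro f p (⟨e, he, hs, rfl⟩ | ⟨t, ht, hh, rfl⟩)
      · rw [hflat f e.1 fun x hx => ⟨e, he, .inl (hs ▸ hx)⟩,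
          hflat f e.2 fun x hx => ⟨e, he, .inr (hs ▸ hx)⟩, termClass_eq]
        exact .ax _ _ he
      · have hal : t.aliens (some f) ⊆ aliensOf S := by
          cases t with
          | const c => exact fun x hx => hx.elim
          | app g a b =>
            obtain rfl : g = f := by simpa [GTerm.head] using hh
            obtain ⟨h1, h2⟩ := aliens_subset_aliensOf ht
            rintro x ((⟨_, hx⟩ | hx) | hx)
            · exact absurd rfl hx
            · exact h1 hx
            · exact h2 hx
        rw [hflat f t hal, monoVal_singleton, termClass_eq]
        exact (unname_name hν u (.inr ht)).symm _ _
  have := hsat.accc h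
  rwa [hsubst, hsubst] at this

end Purification


section Terms

variable {F K : Type*} [DecidableEq F]

/-! ### Flattened terms as monomials with alien arguments -/

/-- The term `t` modulo AC. -/
def GTerm.toAC (t : GTerm F K) : ACTerm F K := Quotient.mk _ t

theorem toAC_eq {s t : GTerm F K} : s.toAC = t.toAC ↔ ACCC ∅ s t :=
  ⟨fun h => Quotient.exact h, fun h => Quotient.sound h⟩

/-- The arguments of a term under `f`: the constants, and the terms with another outermost
symbol. -/
def GTerm.args (f : F) : GTerm F K → Multiset K × Multiset (ACTerm F K)
  | .const c => ({c}, 0)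
  | .app g s t => if g = f then s.args f + t.args f else (0, {(GTerm.app g s t).toAC})

theorem GTerm.args_congr (f : F) {s t : GTerm F K} (h : ACCC ∅ s t) : s.args f = t.args f := by
  induction h with
  | ax s t h => exact h.elim
  | refl s => rfl
  | symm s t _ ih => exact ih.symm
  | trans s t u _ _ ih1 ih2 => exact ih1.trans ih2
  | congr g s s' t t' h1 h2 ih1 ih2 =>
    simp only [GTerm.args, ih1, ih2, toAC_eq.2 (ACCC.congr g s s' t t' h1 h2)]
  | comm g s t => simp only [GTerm.args, toAC_eq.2 (ACCC.comm g s t), add_comm]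
  | assoc g s t u =>
    simp only [GTerm.args, toAC_eq.2 (ACCC.assoc g s t u)]
    split_ifs
    · rw [add_assoc]
    · rfl

/-- The arguments under `f` of a term modulo AC. -/
def acArgs (f : F) : ACTerm F K → Multiset K × Multiset (ACTerm F K) :=
  Quotient.lift (GTerm.args f) fun _ _ h => GTerm.args_congr f h

theorem acArgs_toAC (f : F) (t : GTerm F K) : acArgs f t.toAC = t.args f := rfl

/-- The class of a term modulo AC in the monoid of the symbol `f`. -/
def acClass (f : F) : ACTerm F K → WithOne (TermSemigroup (∅ : Set (GTerm F K × GTerm F K)) f) :=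
  Quotient.lift (termClass ∅ f) fun _ _ h => termClass_eq.2 h

theorem args_prod (f : F) (t : GTerm F K) :
    monoVal ∅ GTerm.const f (t.args f).1 * ((t.args f).2.map (acClass f)).prod =
      termClass ∅ f t := by
  induction t with
  | const c => simp [GTerm.args, monoVal_singleton]
  | app g s t ih1 ih2 =>
    rw [GTerm.args]
    split_ifs with h
    · subst h
      rw [termClass_app, ← ih1, ← ih2, Prod.fst_add, Prod.snd_add, monoVal_add, Multiset.map_add,
        Multiset.prod_add, mul_mul_mul_comm]
    · simp [monoVal, acClass, GTerm.toAC]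

/-- By `args_prod` the class of a term is the product of the classes of its arguments under `f`. -/
theorem acArgs_injective (f : F) : Function.Injective (acArgs f : ACTerm F K → _) := by
  rintro ⟨s⟩ ⟨t⟩ h
  have h : s.args f = t.args f := h
  refine toAC_eq.2 ((termClass_eq (f := f)).1 ?_)
  rw [← args_prod, h, args_prod]

theorem GTerm.args_ne_zero (f : F) (t : GTerm F K) : t.args f ≠ 0 := by
  induction t with
  | const c => simp [GTerm.args, Prod.ext_iff]
  | app g s t ih1 _ =>
    rw [GTerm.args]
    split_ifs
    · intro h
      refine ih1 ?_
      have h1 := congrArg Prod.fst h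
      have h2 := congrArg Prod.snd h
      simp only [Prod.fst_add, Prod.snd_add, Prod.fst_zero, Prod.snd_zero, add_eq_zero] at h1 h2
      exact Prod.ext h1.1 h2.1
    · simp [Prod.ext_iff]

theorem acArgs_alien (f : F) (x : ACTerm F K) : ∀ n ∈ (acArgs f x).2, acArgs f n = (0, {n}) := by
  obtain ⟨t⟩ := x
  change ∀ n ∈ (t.args f).2, acArgs f n = (0, {n})
  induction t with
  | const c => simp [GTerm.args]
  | app g s t ih1 ih2 =>
    rw [GTerm.args]
    split_ifs with h
    · intro n hn
      exact (Multiset.mem_add.1 hn).elim (ih1 n) (ih2 n)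
    · intro n hn
      obtain rfl := Multiset.mem_singleton.1 hn
      rw [acArgs_toAC, GTerm.args, if_neg h]

/-- Application of a symbol to terms modulo AC. -/
def acApp (f : F) : ACTerm F K → ACTerm F K → ACTerm F K :=
  Quotient.map₂ (GTerm.app f) fun _ _ h1 _ _ h2 => ACCC.congr f _ _ _ _ h1 h2

theorem acArgs_acApp (f : F) (x y : ACTerm F K) :
    acArgs f (acApp f x y) = acArgs f x + acArgs f y := by
  obtain ⟨s⟩ := x
  obtain ⟨t⟩ := y
  change (GTerm.app f s t).args f = s.args f + t.args f
  rw [GTerm.args, if_pos rfl]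

theorem acArgs_of_isMono {f : F} {M : Multiset K} {t : GTerm F K} (h : IsMono f M t) :
    acArgs f t.toAC = (M, 0) := by
  rw [acArgs_toAC]
  induction h with
  | const c => rfl
  | app A B s t _ _ ih1 ih2 => simp [GTerm.args, ih1, ih2]

/-- The term is assembled with `acApp` from a monomial and single aliens. `key` lets either part be
empty, since no term has an empty argument list. -/
theorem exists_acArgs (f : F) (M : Multiset K) (N : Multiset (ACTerm F K))
    (hN : ∀ n ∈ N, acArgs f n = (0, {n})) (h0 : ¬ (M = 0 ∧ N = 0)) :
    ∃ z, acArgs f z = (M, N) := by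
  have key : ∀ X Y : Multiset K × Multiset (ACTerm F K), (X = 0 ∨ ∃ z, acArgs f z = X) →
      (Y = 0 ∨ ∃ z, acArgs f z = Y) → X + Y = 0 ∨ ∃ z, acArgs f z = X + Y := by
    rintro X Y (rfl | ⟨x, rfl⟩) (rfl | ⟨y, rfl⟩)
    · simp
    · exact .inr ⟨y, by simp⟩
    · exact .inr ⟨x, by simp⟩
    · exact .inr ⟨acApp f x y, acArgs_acApp f x y⟩
  have h1 : (M, (0 : Multiset (ACTerm F K))) = 0 ∨ ∃ z, acArgs f z = (M, 0) := by
    by_cases hM : M = 0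
    · exact .inl (by rw [hM]; rfl)
    · obtain ⟨t, ht⟩ := exists_isMono f hM
      exact .inr ⟨_, acArgs_of_isMono ht⟩
  have h2 : ((0 : Multiset K), N) = 0 ∨ ∃ z, acArgs f z = (0, N) := by
    clear h0 h1
    induction N using Multiset.induction_on with
    | empty => exact .inl rfl
    | cons a N ih =>
      have := key (0, {a}) (0, N) (.inr ⟨a, hN a (by simp)⟩)
        (ih fun n hn => hN n (Multiset.mem_cons_of_mem hn))
      simpa using this
  have h3 := key _ _ h1 h2
  simp only [Prod.mk_add_mk, add_zero, zero_add] at h3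
  exact h3.resolve_left fun h => h0 ⟨congrArg Prod.fst h, congrArg Prod.snd h⟩

/-! ### Rewriting of flattened terms -/

variable {E : Set (GTerm F K × GTerm F K)}

theorem acStep_acApp_left {f : F} {x x' : ACTerm F K} (h : ACStep E x x') (y : ACTerm F K) :
    ACStep E (acApp f x y) (acApp f x' y) := by
  obtain ⟨s, t, rfl, rfl, h⟩ := h
  obtain ⟨u⟩ := y
  exact ⟨_, _, rfl, rfl, .left f s t u h⟩

theorem acStep_acApp_right {f : F} {y y' : ACTerm F K} (h : ACStep E y y') (x : ACTerm F K) :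
    ACStep E (acApp f x y) (acApp f x y') := by
  obtain ⟨s, t, rfl, rfl, h⟩ := h
  obtain ⟨u⟩ := x
  exact ⟨_, _, rfl, rfl, .right f u s t h⟩

theorem rtc_acApp {f : F} {x x' y y' : ACTerm F K} (hx : Relation.ReflTransGen (ACStep E) x x')
    (hy : Relation.ReflTransGen (ACStep E) y y') :
    Relation.ReflTransGen (ACStep E) (acApp f x y) (acApp f x' y') :=
  (Relation.ReflTransGen.lift (p := ACStep E) (fun z => acApp f z y)
    (fun _ _ h => acStep_acApp_left h y) _ _ hx).trans
  (Relation.ReflTransGen.lift (p := ACStep E) (acApp f x')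
    (fun _ _ h => acStep_acApp_right h x') _ _ hy)

variable [LinearOrder K]

/-- Rewriting the constant arguments under `f`. -/
theorem exists_acStep {f : F} {G : Rules K} (hG0 : ∀ p ∈ G, p.1 ≠ 0 ∧ p.2 ≠ 0)
    (hG : ∀ p ∈ G, ∀ s t, IsMono f p.1 s → IsMono f p.2 t → (s, t) ∈ E)
    {M M' : Multiset K} (h : RStep G M M') {z : ACTerm F K} {N : Multiset (ACTerm F K)}
    (hz : acArgs f z = (M, N)) : ∃ z', acArgs f z' = (M', N) ∧ ACStep E z z' := by
  obtain ⟨p, hp, C, rfl, rfl⟩ := rstep_iff.1 h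
  obtain ⟨s, hs⟩ := exists_isMono f (hG0 p hp).1
  obtain ⟨t, ht⟩ := exists_isMono f (hG0 p hp).2
  have hst : ACStep E s.toAC t.toAC := ⟨s, t, rfl, rfl, .rule _ _ (hG p hp s t hs ht)⟩
  -- With nothing beside the redex the term is the left side itself. Otherwise the rest is a term
  -- `w`, and the step takes place in an argument of `f`.
  by_cases h0 : C = 0 ∧ N = 0
  · obtain ⟨rfl, rfl⟩ := h0
    refine ⟨t.toAC, by simpa using acArgs_of_isMono ht, ?_⟩
    rwa [show z = s.toAC from acArgs_injective f (by simpa [acArgs_of_isMono hs] using hz)]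
  · have hN : ∀ n ∈ N, acArgs f n = (0, {n}) := by
      have := acArgs_alien f z
      rwa [hz] at this
    obtain ⟨w, hw⟩ := exists_acArgs f C N hN h0
    refine ⟨acApp f t.toAC w, by simp [acArgs_acApp, acArgs_of_isMono ht, hw], ?_⟩
    rw [show z = acApp f s.toAC w from
      acArgs_injective f (by simp [acArgs_acApp, acArgs_of_isMono hs, hw, hz])]
    exact acStep_acApp_left hst w

theorem exists_rtc {f : F} {G : Rules K} (hG0 : ∀ p ∈ G, p.1 ≠ 0 ∧ p.2 ≠ 0)
    (hG : ∀ p ∈ G, ∀ s t, IsMono f p.1 s → IsMono f p.2 t → (s, t) ∈ E)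
    {M M' : Multiset K} (h : Relation.ReflTransGen (RStep G) M M') {z : ACTerm F K}
    {N : Multiset (ACTerm F K)} (hz : acArgs f z = (M, N)) :
    ∃ z', acArgs f z' = (M', N) ∧ Relation.ReflTransGen (ACStep E) z z' := by
  induction h with
  | refl => exact ⟨z, hz, .refl⟩
  | tail _ h ih =>
    obtain ⟨z1, h1, h2⟩ := ih
    obtain ⟨z2, h3, h4⟩ := exists_acStep hG0 hG h h1
    exact ⟨z2, h3, h2.tail h4⟩

/-! ### Canonical forms of terms -/

/-- Normal forms of the monomials of all symbols that fit together. -/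
structure NormalForms (RC : Set (K × K)) (R : F → Rules K) (hat : K → K)
    (nf : F → Multiset K → Multiset K) : Prop where
  rules_ne_zero : ∀ f, ∀ p ∈ constRules RC ∪ R f, p.1 ≠ 0 ∧ p.2 ≠ 0
  reach : ∀ f M, Relation.ReflTransGen (RStep (constRules RC ∪ R f)) M (nf f M)
  nf_add : ∀ f A B, nf f (nf f A + B) = nf f (A + B)
  nf_rule : ∀ f, ∀ p ∈ constRules RC ∪ R f, nf f p.1 = nf f p.2
  nf_const : ∀ f c, nf f {c} = {hat c}
  nf_ne_zero : ∀ f M, M ≠ 0 → nf f M ≠ 0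
  hat_mem : ∀ c, hat c = c ∨ (c, hat c) ∈ RC
  hat_rule : ∀ c d, (c, d) ∈ RC → hat c = hat d

section NormalForms

variable {RC : Set (K × K)} {R : F → Rules K} {hat : K → K} {nf : F → Multiset K → Multiset K}

theorem NormalForms.exists_op (h : NormalForms RC R hat nf) (f : F) (x y : ACTerm F K) :
    ∃ z, acArgs f z =
      (nf f ((acArgs f x).1 + (acArgs f y).1), (acArgs f x).2 + (acArgs f y).2) := by
  refine exists_acArgs f _ _ ?_ ?_
  · intro n hn
    exact (Multiset.mem_add.1 hn).elim (acArgs_alien f x n) (acArgs_alien f y n)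
  · rintro ⟨h1, h2⟩
    have hx : acArgs f x ≠ 0 := by
      obtain ⟨s⟩ := x
      exact s.args_ne_zero f
    have h1 : (acArgs f x).1 + (acArgs f y).1 = 0 := by
      by_contra hne
      exact h.nf_ne_zero f _ hne h1
    simp only [add_eq_zero] at h1 h2
    exact hx (Prod.ext h1.1 h2.1)

open Classical in
/-- Application of `f`, followed by normalization of the constant arguments. -/
noncomputable def canonOp (nf : F → Multiset K → Multiset K) (f : F) (x y : ACTerm F K) :
    ACTerm F K :=
  if h : ∃ z, acArgs f z =
      (nf f ((acArgs f x).1 + (acArgs f y).1), (acArgs f x).2 + (acArgs f y).2) then h.choose else x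

theorem NormalForms.acArgs_canonOp (h : NormalForms RC R hat nf) (f : F) (x y : ACTerm F K) :
    acArgs f (canonOp nf f x y) =
      (nf f ((acArgs f x).1 + (acArgs f y).1), (acArgs f x).2 + (acArgs f y).2) := by
  rw [canonOp, dif_pos (h.exists_op f x y)]
  exact (h.exists_op f x y).choose_spec

/-- The canonical form of a term. -/
noncomputable def canonTerm (hat : K → K) (nf : F → Multiset K → Multiset K) :
    GTerm F K → ACTerm F K
  | .const c => (GTerm.const (hat c)).toAC
  | .app f s t => canonOp nf f (canonTerm hat nf s) (canonTerm hat nf t)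

theorem NormalForms.acArgs_canonTerm (h : NormalForms RC R hat nf) {f : F} {M : Multiset K}
    {t : GTerm F K} (ht : IsMono f M t) : acArgs f (canonTerm hat nf t) = (nf f M, 0) := by
  induction ht with
  | const c => rw [h.nf_const]; rfl
  | app A B s t _ _ ih1 ih2 =>
    rw [canonTerm, h.acArgs_canonOp, ih1, ih2]
    simp only [add_zero]
    rw [h.nf_add, add_comm A, h.nf_add, add_comm]

/-- By `nf_add`, normalizing bottom up gives a monomial the same result as normalizing it at once,
so the rules of `R f` become equalities and associativity holds. The systems fit together because
`nf_const` has the same `hat` for every symbol. -/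
theorem NormalForms.canonTerm_congr (h : NormalForms RC R hat nf) {s t : GTerm F K}
    (hst : ACCC (toTermPairs RC R) s t) : canonTerm hat nf s = canonTerm hat nf t := by
  induction hst with
  | ax s t hm =>
    rcases hm with ⟨c, d, hcd, he⟩ | ⟨f, A, B, hAB, h1, h2⟩
    · obtain ⟨rfl, rfl⟩ := Prod.mk.inj he
      rw [canonTerm, canonTerm, h.hat_rule c d hcd]
    · refine acArgs_injective f ?_
      rw [h.acArgs_canonTerm h1, h.acArgs_canonTerm h2, h.nf_rule f (A, B) (.inr hAB)]
  | refl s => rfl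
  | symm s t _ ih => exact ih.symm
  | trans s t u _ _ ih1 ih2 => exact ih1.trans ih2
  | congr f s s' t t' _ _ ih1 ih2 => rw [canonTerm, canonTerm, ih1, ih2]
  | comm f s t =>
    refine acArgs_injective f ?_
    simp only [canonTerm, h.acArgs_canonOp, add_comm]
  | assoc f s t u =>
    refine acArgs_injective f ?_
    simp only [canonTerm, h.acArgs_canonOp]
    rw [h.nf_add, add_comm _ (nf f _), h.nf_add]
    simp only [Prod.mk.injEq]
    exact ⟨by congr 1; abel, by abel⟩

theorem NormalForms.mem_toTermPairs {f : F} :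
    ∀ p ∈ constRules RC ∪ R f, ∀ s t, IsMono f p.1 s → IsMono f p.2 t →
      (s, t) ∈ toTermPairs RC R := by
  rintro p (⟨c, d, hcd, rfl⟩ | hp) s t hs ht
  · rw [hs.eq_const, ht.eq_const]
    exact .inl ⟨c, d, hcd, rfl⟩
  · exact .inr ⟨f, p.1, p.2, hp, hs, ht⟩

theorem NormalForms.rtc_canonTerm (h : NormalForms RC R hat nf) (t : GTerm F K) :
    Relation.ReflTransGen (ACStep (toTermPairs RC R)) t.toAC (canonTerm hat nf t) := by
  induction t with
  | const c =>
    rcases h.hat_mem c with hc | hc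
    · rw [canonTerm, hc]
    · exact .single ⟨_, _, rfl, rfl, .rule _ _ (.inl ⟨c, _, hc, rfl⟩)⟩
  | app f s t ih1 ih2 =>
    refine (rtc_acApp ih1 ih2 : Relation.ReflTransGen _ (acApp f s.toAC t.toAC) _).trans ?_
    obtain ⟨z, hz, hr⟩ := exists_rtc (h.rules_ne_zero f) NormalForms.mem_toTermPairs
      (h.reach f ((acArgs f (canonTerm hat nf s)).1 + (acArgs f (canonTerm hat nf t)).1))
      (acArgs_acApp f (canonTerm hat nf s) (canonTerm hat nf t))
    rwa [show canonTerm hat nf (.app f s t) = z from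
      acArgs_injective f ((h.acArgs_canonOp f _ _).trans hz.symm)]

/-- The canonical form is constant on congruence classes and reachable from every term, so it joins
any two reducts. -/
theorem NormalForms.locallyConfluent (h : NormalForms RC R hat nf) :
    LocallyConfluent (ACStep (toTermPairs RC R)) := by
  have hstep : ∀ {s t : GTerm F K}, TermStep (toTermPairs RC R) s t →
      ACCC (toTermPairs RC R) s t := by
    intro s t hst
    induction hst with
    | rule s t hm => exact .ax _ _ hm
    | left f s s' t _ ih => exact .congr _ _ _ _ _ ih (.refl _)
    | right f s t t' _ ih => exact .congr _ _ _ _ _ (.refl _) ih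
  rintro t u₁ u₂ ⟨s1, t1, hs1, rfl, h1⟩ ⟨s2, t2, hs2, rfl, h2⟩
  have hs : ACCC (toTermPairs RC R) s1 s2 :=
    ACCC.mono (Set.empty_subset _) (Quotient.exact (hs1.trans hs2.symm))
  have heq := h.canonTerm_congr
    (((hstep h1).symm _ _).trans _ _ _ (hs.trans _ _ _ (hstep h2)))
  exact ⟨_, h.rtc_canonTerm t1, heq ▸ h.rtc_canonTerm t2⟩

end NormalForms

/-! ### Termination of rewriting of flattened terms -/

/-- The constants in the topmost block of a term that stands as an argument of `h`. -/
def GTerm.topBlock (h : Option F) : GTerm F K → Multiset K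
  | .const c => {c}
  | .app g s t => if h = some g then s.topBlock h + t.topBlock h else 0

/-- The further blocks of a term that stands as an argument of `h`: the maximal parts formed with
one symbol, with the constants in them. -/
def GTerm.lowerBlocks (h : Option F) : GTerm F K → Multiset (Option F × Multiset K)
  | .const _ => 0
  | .app g s t =>
      (if h = some g then 0 else {(some g, s.topBlock (some g) + t.topBlock (some g))}) +
        (s.lowerBlocks (some g) + t.lowerBlocks (some g))

theorem blocks_congr {s t : GTerm F K} (hst : ACCC ∅ s t) (h : Option F) :
    s.topBlock h = t.topBlock h ∧ s.lowerBlocks h = t.lowerBlocks h := by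
  induction hst generalizing h with
  | ax s t hm => exact hm.elim
  | refl s => exact ⟨rfl, rfl⟩
  | symm s t _ ih => exact ⟨(ih h).1.symm, (ih h).2.symm⟩
  | trans s t u _ _ ih1 ih2 => exact ⟨(ih1 h).1.trans (ih2 h).1, (ih1 h).2.trans (ih2 h).2⟩
  | congr g s s' t t' _ _ ih1 ih2 => simp only [GTerm.topBlock, GTerm.lowerBlocks, ih1, ih2, and_self]
  | comm g s t => simp only [GTerm.topBlock, GTerm.lowerBlocks, add_comm, and_self]
  | assoc g s t u =>
    simp only [GTerm.topBlock, GTerm.lowerBlocks, if_true, zero_add]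
    constructor
    · split_ifs
      · rw [add_assoc]
      · rfl
    · simp only [add_assoc]

theorem blocks_of_isMono {f : F} {M : Multiset K} {t : GTerm F K} (ht : IsMono f M t) :
    t.topBlock (some f) = M ∧ t.lowerBlocks (some f) = 0 := by
  induction ht with
  | const c => exact ⟨rfl, rfl⟩
  | app A B s t _ _ ih1 ih2 => simp [GTerm.topBlock, GTerm.lowerBlocks, ih1, ih2]

/-- The ordering of the constants of a block. -/
def blockLt (lt : F → Multiset K → Multiset K → Prop) : Option F → Multiset K → Multiset K → Prop
  | none => fun A B => ∃ a b, A = {a} ∧ B = {b} ∧ a < b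
  | some f => lt f

/-- The ordering of blocks. -/
def BlockRel (lt : F → Multiset K → Multiset K → Prop) (x y : Option F × Multiset K) : Prop :=
  x.1 = y.1 ∧ blockLt lt x.1 x.2 y.2

variable {lt : F → Multiset K → Multiset K → Prop}

theorem wellFounded_blockRel [Finite K] (hlt : ∀ f, MonoOrder (lt f)) :
    WellFounded (BlockRel lt) := by
  have hwf : ∀ h, WellFounded (blockLt lt h) := by
    rintro (_ | f)
    · have key : ∀ a : K, Acc (blockLt lt none) {a} := by
        intro a
        induction a using (wellFounded_lt (α := K)).induction with
        | _ a ih =>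
          refine ⟨_, ?_⟩
          rintro _ ⟨b, c, rfl, hc, hbc⟩
          exact ih b (by rwa [Multiset.singleton_inj.1 hc])
      refine ⟨fun A => ⟨_, ?_⟩⟩
      rintro _ ⟨b, c, rfl, -, -⟩
      exact key b
    · exact (hlt f).wf
  refine ⟨fun ⟨h, A⟩ => ?_⟩
  induction A using (hwf h).induction with
  | _ A ih =>
    refine ⟨_, ?_⟩
    rintro ⟨h', B⟩ ⟨h1, h2⟩
    obtain rfl : h' = h := h1
    exact ih B h2

/-- The effect of a rewrite step on the blocks. -/
theorem TermStep.blocks {RC : Set (K × K)} {R : F → Rules K} (hlt : ∀ f, MonoOrder (lt f))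
    (hRC : ∀ p ∈ RC, p.2 < p.1) (hR : ∀ f, Oriented (lt f) (R f)) {s t : GTerm F K}
    (hst : TermStep (toTermPairs RC R) s t) (h : Option F) :
    Multiset.card (t.lowerBlocks h) < Multiset.card (s.lowerBlocks h) ∨
    (t.lowerBlocks h = s.lowerBlocks h ∧ blockLt lt h (t.topBlock h) (s.topBlock h)) ∨
    (t.topBlock h = s.topBlock h ∧
      Multiset.card (t.lowerBlocks h) = Multiset.card (s.lowerBlocks h) ∧
      Relation.CutExpand (BlockRel lt) (t.lowerBlocks h) (s.lowerBlocks h)) := by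
  have hconst : ∀ {c d : K} (h : Option F), d < c → blockLt lt h {d} {c} := by
    rintro c d (_ | f) hcd
    · exact ⟨d, c, rfl, rfl, hcd⟩
    · exact (hlt f).single hcd
  -- Stated for all terms with the blocks of `app f s t`, so that a step in the right argument is
  -- covered by commutativity.
  have hctx : ∀ {f : F} {s s' : GTerm F K} (t : GTerm F K) {x y : GTerm F K},
      (∀ h, x.topBlock h = (GTerm.app f s t).topBlock h ∧
        x.lowerBlocks h = (GTerm.app f s t).lowerBlocks h) →
      (∀ h, y.topBlock h = (GTerm.app f s' t).topBlock h ∧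
        y.lowerBlocks h = (GTerm.app f s' t).lowerBlocks h) →
      (Multiset.card (s'.lowerBlocks (some f)) < Multiset.card (s.lowerBlocks (some f)) ∨
      (s'.lowerBlocks (some f) = s.lowerBlocks (some f) ∧
        blockLt lt (some f) (s'.topBlock (some f)) (s.topBlock (some f))) ∨
      (s'.topBlock (some f) = s.topBlock (some f) ∧
        Multiset.card (s'.lowerBlocks (some f)) = Multiset.card (s.lowerBlocks (some f)) ∧
        Relation.CutExpand (BlockRel lt) (s'.lowerBlocks (some f)) (s.lowerBlocks (some f)))) →
      ∀ h, Multiset.card (y.lowerBlocks h) < Multiset.card (x.lowerBlocks h) ∨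
      (y.lowerBlocks h = x.lowerBlocks h ∧ blockLt lt h (y.topBlock h) (x.topBlock h)) ∨
      (y.topBlock h = x.topBlock h ∧
        Multiset.card (y.lowerBlocks h) = Multiset.card (x.lowerBlocks h) ∧
        Relation.CutExpand (BlockRel lt) (y.lowerBlocks h) (x.lowerBlocks h)) := by
    intro f s s' t x y hx hy ih h
    rw [(hx h).1, (hx h).2, (hy h).1, (hy h).2]
    simp only [GTerm.topBlock, GTerm.lowerBlocks]
    by_cases hf : h = some f
    · subst hf
      simp only [if_true, zero_add, Multiset.card_add]
      rcases ih with ih | ⟨ih1, ih2⟩ | ⟨ih1, ih2, ih3⟩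
      · exact .inl (Nat.add_lt_add_right ih _)
      · exact .inr (.inl ⟨by rw [ih1], (hlt f).add _ ih2⟩)
      · exact .inr (.inr ⟨by rw [ih1], by rw [ih2], (Relation.cutExpand_add_right _).2 ih3⟩)
    · simp only [if_neg hf, Multiset.card_add, Multiset.card_singleton]
      rcases ih with ih | ⟨ih1, ih2⟩ | ⟨ih1, ih2, ih3⟩
      · exact .inl (by omega)
      · refine .inr (.inr ⟨trivial, by rw [ih1], ?_⟩)
        rw [ih1]
        exact Relation.cutExpand_single_add ⟨rfl, (hlt f).add _ ih2⟩ _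
      · refine .inr (.inr ⟨trivial, by rw [ih2], ?_⟩)
        rw [ih1]
        exact (Relation.cutExpand_add_left _).2 ((Relation.cutExpand_add_right _).2 ih3)
  induction hst generalizing h with
  | rule s t hm =>
    rcases hm with ⟨c, d, hcd, he⟩ | ⟨f, A, B, hAB, h1, h2⟩
    · obtain ⟨rfl, rfl⟩ := Prod.mk.inj he
      exact .inr (.inl ⟨rfl, hconst h (hRC _ hcd)⟩)
    · have hlt' := hR f _ hAB
      obtain ⟨a1, a2⟩ := blocks_of_isMono h1
      obtain ⟨b1, b2⟩ := blocks_of_isMono h2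
      by_cases hf : h = some f
      · subst hf
        simp only at a1 a2 b1 b2
        exact .inr (.inl ⟨by rw [a2, b2], by rw [a1, b1]; exact hlt'⟩)
      -- Under a different symbol there are three cases: a constant goes to a smaller constant,
      -- which every block ordering respects; a whole block collapses to a constant and the count
      -- drops; or a block decreases in the ordering of `f`.
      · cases h1 with
        | const c =>
          obtain ⟨d, hd, hdc⟩ := (hlt f).of_single hlt'
          simp only at hd
          subst hd
          obtain rfl := h2.eq_const
          exact .inr (.inl ⟨rfl, hconst h hdc⟩)
        | app A1 A2 s1 s2 m1 m2 =>
          simp only [GTerm.topBlock, GTerm.lowerBlocks, if_true, zero_add] at a1 a2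
          cases h2 with
          | const d => exact .inl (by simp [GTerm.lowerBlocks, hf])
          | app B1 B2 t1 t2 n1 n2 =>
            simp only [GTerm.topBlock, GTerm.lowerBlocks, if_true, zero_add] at b1 b2
            simp only [GTerm.topBlock, GTerm.lowerBlocks, if_neg hf, a1, a2, b1, b2]
            have hb : BlockRel lt (some f, B1 + B2) (some f, A1 + A2) := ⟨rfl, hlt'⟩
            exact .inr (.inr ⟨trivial, by simp, by
              simpa only [add_zero] using Relation.cutExpand_singleton_singleton hb⟩)
  | left f s s' t _ ih => exact hctx t (fun _ => ⟨rfl, rfl⟩) (fun _ => ⟨rfl, rfl⟩) (ih _) h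
  | right f s t t' _ ih =>
    exact hctx s (fun h => blocks_congr (.comm f s t) h) (fun h => blocks_congr (.comm f s t') h)
      (ih _) h

/-- All blocks of a term. -/
def acBlocks : ACTerm F K → Multiset (Option F × Multiset K) :=
  Quotient.lift (fun t => {(none, t.topBlock none)} + t.lowerBlocks none) fun _ _ h => by
    simp only [blocks_congr h]

/-- The number of blocks comes first in the measure, because a block that collapses to a constant
makes the surrounding block grow. -/
theorem terminating_acStep [Finite K] {RC : Set (K × K)} {R : F → Rules K}
    (hlt : ∀ f, MonoOrder (lt f)) (hRC : ∀ p ∈ RC, p.2 < p.1)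
    (hR : ∀ f, Oriented (lt f) (R f)) : Terminating (ACStep (toTermPairs RC R)) := by
  have hwf : WellFounded (Prod.Lex (· < · : ℕ → ℕ → Prop) (Relation.CutExpand (BlockRel lt))) :=
    wellFounded_lt.prod_lex (wellFounded_blockRel hlt).cutExpand
  have hdec : ∀ x y, ACStep (toTermPairs RC R) x y →
      Prod.Lex (· < · : ℕ → ℕ → Prop) (Relation.CutExpand (BlockRel lt))
        (Multiset.card (acBlocks y), acBlocks y) (Multiset.card (acBlocks x), acBlocks x) := by
    rintro x y ⟨s, t, rfl, rfl, h⟩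
    have hs : acBlocks (Quotient.mk _ s) = {(none, s.topBlock none)} + s.lowerBlocks none := rfl
    have ht : acBlocks (Quotient.mk _ t) = {(none, t.topBlock none)} + t.lowerBlocks none := rfl
    rw [hs, ht]
    rcases h.blocks hlt hRC hR none with h | ⟨h1, h2⟩ | ⟨h1, h2, h3⟩
    · exact .left _ _ (by simpa using h)
    · rw [h1, Multiset.card_add, Multiset.card_add, Multiset.card_singleton,
        Multiset.card_singleton]
      exact .right _ (Relation.cutExpand_single_add ⟨rfl, h2⟩ _)
    · rw [h1, Multiset.card_add, Multiset.card_add, h2]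
      exact .right _ ((Relation.cutExpand_add_left _).2 h3)
  rintro ⟨u, hu⟩
  have := wellFounded_iff_isEmpty_descending_chain.1
    (InvImage.wf (fun x => (Multiset.card (acBlocks x), acBlocks x)) hwf)
  exact this.elim ⟨u, fun n => hdec _ _ (hu n)⟩

end Terms


section Combination

variable {F K : Type*} [LinearOrder K]

/-! ### Final systems are canonical -/

/-- The constant rules of `R` belong to `RC`, and either `R` contains `RC` or the left sides of `R`
are in canonical form with respect to `RC`. -/
def FitsConst (RC : Set (K × K)) (R : Rules K) : Prop :=
  constPart R ⊆ RC ∧ (constRules RC ⊆ R ∨ ∀ q ∈ R, ∀ c ∈ q.1, c ∉ cdom RC)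

theorem FitsConst.cpComplete {lt : Multiset K → Multiset K → Prop} (hlt : MonoOrder lt)
    {RC : Set (K × K)} (hRC : IsConstSystem RC) {R : Rules K} (h : FitsConst RC R)
    (hg : Good lt R ∅) : CPComplete lt (constRules RC ∪ R) (constRules RC ∪ R) := by
  have hc := hg.complete
  rw [Set.union_empty] at hc
  rcases h.2 with h | h
  · rwa [Set.union_eq_self_of_subset_left h]
  · exact CPComplete.union_constRules hlt hRC hg.oriented h
      (fun p hp q hq => (hc p hp q hq).mono Set.subset_union_right) Set.subset_union_right
      Set.subset_union_left

/-- No `R f` has constant rules outside `RC`, so `canonConst RC c` is irreducible in every system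
and the symbols agree on constants. -/
theorem exists_normalForms {lt : F → Multiset K → Multiset K → Prop}
    (hlt : ∀ f, MonoOrder (lt f)) {RC : Set (K × K)} (hRC : IsConstSystem RC) {R : F → Rules K}
    (h : ∀ f, FitsConst RC (R f)) (hg : ∀ f, Good (lt f) (R f) ∅) :
    ∃ nf, NormalForms RC R (canonConst RC) nf := by
  have ho : ∀ f, Oriented (lt f) (constRules RC ∪ R f) := by
    rintro f p (hp | hp)
    · exact oriented_constRules (hlt f) (fun p hp => hRC.lt hp) p hp
    · exact (hg f).oriented p hp
  choose nf hnf using fun f => (ho f).exists_computesNF (hlt f)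
  have hc := fun f => (h f).cpComplete (hlt f) hRC (hg f)
  have hcr : ∀ f {x y}, Cong (constRules RC ∪ R f) x y → nf f x = nf f y :=
    fun f _ _ hxy => nf_eq_of_cong (hlt f) (ho f) (hc f) (hnf f) hxy
  have hhat : ∀ c, canonConst RC c = c ∨ (c, canonConst RC c) ∈ RC := by
    intro c
    by_cases hc : c ∈ cdom RC
    · obtain ⟨d, hd⟩ := hc
      exact .inr (by rwa [canonConst_of_mem hRC hd])
    · exact .inl (canonConst_of_notMem hc)
  have hirr : ∀ c, canonConst RC c ∉ cdom RC := by
    intro c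
    by_cases hc : c ∈ cdom RC
    · obtain ⟨d, hd⟩ := hc
      rw [canonConst_of_mem hRC hd]
      exact hRC.irred hd
    · rwa [canonConst_of_notMem hc]
  refine ⟨nf, ⟨fun f p hp => ((hlt f).ne_zero (ho f p hp)).symm, fun f M => (hnf f M).1, ?_,
    fun f p hp => hcr f (.of_mem hp), ?_,
    fun f M => (ho f).rtc_ne_zero (hlt f) (hnf f M).1, hhat, ?_⟩⟩
  · exact fun f A B => (hcr f (Cong.add_right B (cong_of_rtc (hnf f A).1))).symm
  · intro f c
    refine (nf_unique (hlt f) (ho f) (hc f) (hnf f) _ _ ⟨?_, normal_iff.2 ?_⟩).symm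
    · rcases hhat c with hc | hc
      · rw [hc]
      · exact .single ⟨_, .inl ⟨c, _, hc, rfl⟩, le_rfl, by simp⟩
    · intro p hp hle
      have hlt' := ho f p hp
      have hp1 := (Multiset.le_singleton.1 hle).resolve_left ((hlt f).ne_zero hlt').2
      rw [hp1] at hlt'
      obtain ⟨b, hb, _⟩ := (hlt f).of_single hlt'
      have hpe : p = ({canonConst RC c}, {b}) := Prod.ext hp1 hb
      refine hirr c ⟨b, ?_⟩
      rcases hp with ⟨c', d, hcd, hp⟩ | hp
      · rw [hp] at hpe
        simp only [Prod.mk.injEq, Multiset.singleton_inj] at hpe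
        rwa [← hpe.1, ← hpe.2]
      · rw [hpe] at hp
        exact (h f).1 hp
  · intro c d hcd
    rw [canonConst_of_mem hRC hcd, canonConst_of_notMem (hRC.irred hcd)]

/-! ### The invariant of the combination algorithm -/

variable [DecidableEq F] (gt : F → Multiset K → Multiset K → Prop) (SC : Set (K × K))
  (Sf : F → Rules K)

/-- The presentation by `A` and `P` is equivalent to the given one. -/
def Presents (A : Set (K × K)) (P : F → Rules K) : Prop :=
  ∀ E : Set (GTerm F K × GTerm F K), Sat E .const A P ↔ Sat E .const SC Sf

/-- The systems of the symbols together with the equations not yet completed. -/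
def withTodo (todo : Set F) (R : F → Rules K) (f : F) : Rules K :=
  R f ∪ {p | f ∈ todo ∧ p ∈ Sf f}

variable {gt SC Sf} in
theorem Presents.of_sat_iff {A A' : Set (K × K)} {P P' : F → Rules K} (h : Presents SC Sf A P)
    (hs : ∀ E : Set (GTerm F K × GTerm F K), Sat E .const A' P' ↔ Sat E .const A P) :
    Presents SC Sf A' P' := fun E => (hs E).trans (h E)

/-- The invariant of the loop that completes the systems of the symbols. -/
structure FirstInv (RC N : Set (K × K)) (todo : Set F) (R : F → Rules K) : Prop where
  const : IsConstSystem RC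
  good : ∀ f, Good (ltOf (gt f)) (R f) ∅
  avoids : ∀ f, Over (cdom RC)ᶜ (R f)
  part : ∀ f, constPart (R f) ⊆ N
  new : ∀ p ∈ N, p.2 < p.1 ∧ p.1 ∉ cdom RC
  todo_empty : ∀ f ∈ todo, R f = ∅

/-- The invariant of the loop that propagates the constant rules. The symbols in `todo` are still to
be visited, those in `visited` have been visited. -/
structure PropInv (RC N : Set (K × K)) (todo visited : Set F) (R : F → Rules K) : Prop where
  const : IsConstSystem RC
  good : ∀ f, Good (ltOf (gt f)) (R f) ∅
  -- An update may produce constant left sides outside `cdom RC`; these are in `N` and become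
  -- reducible in the next round.
  left : ∀ f, ∀ q ∈ R f, ∀ a, q.1 = {a} → a ∈ cdom RC ∪ cdom N
  left_todo : ∀ f ∉ visited, ∀ q ∈ R f, ∀ a, q.1 = {a} → a ∈ cdom RC
  new : ∀ p ∈ N, p.2 < p.1 ∧ p.1 ∉ cdom RC
  fits : N = ∅ → ∀ f ∈ visited, FitsConst RC (R f)

/-- The invariant of the combination algorithm. -/
def ConfigInv : Config F K → Prop
  | .firstLoop RC N todo R => FirstInv gt RC N todo R ∧ Presents SC Sf (RC ∪ N) (withTodo Sf todo R)
  | .completing RC N todo R f st => FirstInv gt RC N todo R ∧ f ∉ todo ∧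
      Good (ltOf (gt f)) st.1 st.2 ∧ Over (cdom RC)ᶜ (st.1 ∪ st.2) ∧
      Presents SC Sf (RC ∪ N) (Function.update (withTodo Sf todo R) f (st.1 ∪ st.2))
  | .propagating RC N todo R => PropInv gt RC N todo todoᶜ R ∧ Presents SC Sf (RC ∪ N) R
  | .updating RC N todo R f st => PropInv gt RC N todo {g | g ∉ todo ∧ g ≠ f} R ∧ f ∉ todo ∧
      Good (ltOf (gt f)) st.R (st.S ∪ st.T) ∧ UpdInv RC st.R st.NRC ∧
      Presents SC Sf (RC ∪ N ∪ st.NRC) (Function.update R f (st.R ∪ (st.S ∪ st.T)))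
  | .done RC R => IsConstSystem RC ∧ (∀ f, Good (ltOf (gt f)) (R f) ∅) ∧
      (∀ f, FitsConst RC (R f)) ∧ Presents SC Sf RC R

/-- The measure that decreases in every step of the combination algorithm. -/
noncomputable def configMeasure : Config F K → ℕ × ℕ × ℕ × UpperSet (Multiset K) × ℕ
  | .firstLoop _ _ todo _ => (2, 0, 2 * todo.ncard, leftUpper ∅, 0)
  | .completing _ _ todo _ _ st => (2, 0, 2 * todo.ncard + 1, leftUpper st.1, st.2.ncard)
  | .propagating RC _ todo _ => (1, (cdom RC)ᶜ.ncard, 2 * todo.ncard, leftUpper ∅, 0)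
  | .updating RC _ todo _ _ st =>
      (1, (cdom RC)ᶜ.ncard, 2 * todo.ncard + 1, leftUpper st.R, 2 * st.T.ncard + st.S.ncard)
  | .done _ _ => (0, 0, 0, leftUpper ∅, 0)

/-- The ordering of the measures. -/
abbrev MeasureLt : ℕ × ℕ × ℕ × UpperSet (Multiset K) × ℕ →
    ℕ × ℕ × ℕ × UpperSet (Multiset K) × ℕ → Prop :=
  Prod.Lex (· < ·) (Prod.Lex (· < ·) (Prod.Lex (· < ·) InnerLt))

theorem wellFounded_measureLt [Finite K] :
    WellFounded (MeasureLt : ℕ × ℕ × ℕ × UpperSet (Multiset K) × ℕ → _ → Prop) :=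
  wellFounded_lt.prod_lex (wellFounded_lt.prod_lex (wellFounded_lt.prod_lex wellFounded_innerLt))

/-! ### Preservation of the invariant by the single steps -/

section Steps

variable {gt SC Sf} {RC N : Set (K × K)} {todo : Set F} {R : F → Rules K} {f : F}

theorem good_empty {lt : Multiset K → Multiset K → Prop} : Good lt (∅ : Rules K) ∅ :=
  ⟨Set.finite_empty, Set.finite_empty, fun _ h => h.elim, fun _ h => h.elim, fun _ h => h.elim⟩

theorem sat_update {E : Set (GTerm F K × GTerm F K)} {A : Set (K × K)} {P : F → Rules K}
    {X : Rules K} : Sat E .const A (Function.update P f X) ↔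
      SatC E .const A ∧ SatF E .const f X ∧ ∀ g ≠ f, SatF E .const g (P g) := by
  unfold Sat
  rw [Function.forall_update_iff P (p := fun g Y => SatF E .const g Y)]

theorem satF_withTodo {E : Set (GTerm F K × GTerm F K)} :
    SatF E .const f (withTodo Sf todo R f) ↔
      SatF E .const f (R f) ∧ (f ∈ todo → SatF E .const f (Sf f)) := by
  rw [withTodo, satF_union]
  refine and_congr_right fun _ => ?_
  constructor
  · exact fun h hf p hp => h p ⟨hf, hp⟩
  · exact fun h p hp => h hp.1 p hp.2

/-- The left side of a new rule is irreducible by `RC` and reducible afterwards, and no constant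
becomes irreducible again. -/
theorem constSystem_union_dom_lt [Finite K] (hRC : IsConstSystem RC)
    (hN : ∀ p ∈ N, p.2 < p.1 ∧ p.1 ∉ cdom RC) (hne : N.Nonempty) :
    (cdom (constSystem (RC ∪ N)))ᶜ.ncard < (cdom RC)ᶜ.ncard := by
  have hsub := cdom_subset_constSystem_union (RC := RC) (N := N) (fun p hp => hRC.lt hp)
    fun p hp => (hN p hp).1
  obtain ⟨p, hp⟩ := hne
  refine Set.ncard_lt_ncard ?_ (Set.toFinite _)
  rw [Set.ssubset_iff_of_subset
    (Set.compl_subset_compl.2 (Set.subset_union_left.trans hsub))]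
  exact ⟨p.1, (hN p hp).2, fun h => h (hsub (.inr ⟨p.2, hp⟩))⟩

theorem presents_constSystem [Finite K] {P : F → Rules K} (h : Presents SC Sf (RC ∪ N) P) :
    Presents SC Sf (constSystem (RC ∪ N) ∪ ∅) P := by
  refine h.of_sat_iff fun E => ?_
  rw [Set.union_empty]
  exact and_congr satC_constSystem Iff.rfl

theorem withTodo_empty : withTodo Sf ∅ R = R := by
  funext f
  simp [withTodo]

theorem FirstInv.beginCompletion (hgt : ∀ f, IsAdmissible (gt f))
    (hfin : ∀ f, (Sf f).Finite) (hne : ∀ f, ∀ e ∈ Sf f, e.1 ≠ 0 ∧ e.2 ≠ 0)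
    (h : FirstInv gt RC N todo R) (hp : Presents SC Sf (RC ∪ N) (withTodo Sf todo R))
    (hf : f ∈ todo) :
    ConfigInv gt SC Sf (.completing RC N (todo \ {f}) R f (∅, normalizeBy RC (Sf f))) := by
  have hlt := (hgt f).monoOrder
  refine ⟨⟨h.const, h.good, h.avoids, h.part, h.new, fun g hg => h.todo_empty g hg.1⟩,
    fun hf' => hf'.2 rfl, good_normalizeBy hlt h.const (hfin f) (hne f), ?_, ?_⟩
  · rw [Set.empty_union]
    exact over_normalizeBy
  · refine hp.of_sat_iff fun E => ?_
    rw [sat_update, Sat]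
    refine and_congr_right fun hA => ?_
    rw [Set.empty_union, satF_normalizeBy hlt (fun p hp => h.const.lt hp) (satC_union.1 hA).1]
    constructor
    · rintro ⟨h1, h2⟩ g
      rw [satF_withTodo]
      by_cases hg : g = f
      · subst hg
        rw [h.todo_empty g hf]
        exact ⟨satF_empty, fun _ => h1⟩
      · have := satF_withTodo.1 (h2 g hg)
        exact ⟨this.1, fun hgt => this.2 ⟨hgt, hg⟩⟩
    · intro h1
      refine ⟨(satF_withTodo.1 (h1 f)).2 hf, fun g hg => ?_⟩
      have := satF_withTodo.1 (h1 g)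
      exact satF_withTodo.2 ⟨this.1, fun hgt => this.2 hgt.1⟩

theorem FirstInv.endCompletion (hgt : ∀ f, IsAdmissible (gt f)) {Rf : Rules K}
    (h : FirstInv gt RC N todo R) (hf : f ∉ todo) (hg : Good (ltOf (gt f)) Rf ∅)
    (ho : Over (cdom RC)ᶜ (Rf ∪ ∅))
    (hp : Presents SC Sf (RC ∪ N) (Function.update (withTodo Sf todo R) f (Rf ∪ ∅))) :
    ConfigInv gt SC Sf (.firstLoop RC (N ∪ constPart Rf) todo (Function.update R f Rf)) := by
  have hlt := (hgt f).monoOrder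
  rw [Set.union_empty] at hp ho
  refine ⟨⟨h.const, ?_, ?_, ?_, ?_, ?_⟩, ?_⟩
  · rw [Function.forall_update_iff R (p := fun g X => Good (ltOf (gt g)) X ∅)]
    exact ⟨hg, fun g _ => h.good g⟩
  · rw [Function.forall_update_iff R (p := fun _ X => Over (cdom RC)ᶜ X)]
    exact ⟨ho, fun g _ => h.avoids g⟩
  · rw [Function.forall_update_iff R (p := fun _ X => constPart X ⊆ N ∪ constPart Rf)]
    exact ⟨Set.subset_union_right, fun g _ => (h.part g).trans Set.subset_union_left⟩
  · rintro p (hp | hp)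
    · exact h.new p hp
    · obtain ⟨b, hb, hba⟩ := hlt.of_single (hg.oriented _ hp)
      have hb : ({p.2} : Multiset K) = {b} := hb
      rw [Multiset.singleton_inj.1 hb]
      exact ⟨hba, (ho _ hp).1 p.1 (by simp)⟩
  · intro g hgt
    rw [Function.update_of_ne (ne_of_mem_of_not_mem hgt hf)]
    exact h.todo_empty g hgt
  · refine hp.of_sat_iff fun E => ?_
    rw [sat_update, Sat, ← Set.union_assoc, satC_union]
    constructor
    · rintro ⟨⟨h1, h2⟩, h3⟩
      refine ⟨h1, by simpa using (satF_withTodo.1 (h3 f)).1, fun g hg => ?_⟩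
      have := satF_withTodo.1 (h3 g)
      rw [Function.update_of_ne hg] at this
      exact satF_withTodo.2 this
    · rintro ⟨h1, h2, h3⟩
      refine ⟨⟨h1, h2.satC_constPart⟩, fun g => satF_withTodo.2 ?_⟩
      by_cases hg : g = f
      · subst hg
        rw [Function.update_self]
        exact ⟨h2, fun h => absurd h hf⟩
      · rw [Function.update_of_ne hg]
        exact satF_withTodo.1 (h3 g hg)

/-- A nonempty `N` would have lowered the number of irreducible constants, so an unchanged `RC`
means that `N` is empty. -/
theorem FirstInv.done [Finite K] (h : FirstInv gt RC N ∅ R)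
    (hp : Presents SC Sf (RC ∪ N) (withTodo Sf ∅ R)) (hN : constSystem (RC ∪ N) = RC) :
    ConfigInv gt SC Sf (.done RC R) := by
  have hN0 : N = ∅ := by
    by_contra hne
    have := constSystem_union_dom_lt h.const h.new (Set.nonempty_iff_ne_empty.2 hne)
    rw [hN] at this
    exact this.false
  subst hN0
  refine ⟨h.const, h.good, fun f => ⟨(h.part f).trans (Set.empty_subset _), .inr ?_⟩, ?_⟩
  · exact fun q hq => (h.avoids f q hq).1
  · rwa [Set.union_empty, withTodo_empty] at hp

theorem FirstInv.propagate [Finite K] (hgt : ∀ f, IsAdmissible (gt f)) (h : FirstInv gt RC N ∅ R)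
    (hp : Presents SC Sf (RC ∪ N) (withTodo Sf ∅ R)) :
    ConfigInv gt SC Sf (.propagating (constSystem (RC ∪ N)) ∅ Set.univ R) := by
  have hsub := cdom_subset_constSystem_union (RC := RC) (N := N) (fun p hp => h.const.lt hp)
    fun p hp => (h.new p hp).1
  have hleft : ∀ f, ∀ q ∈ R f, ∀ a, q.1 = {a} → a ∈ cdom (constSystem (RC ∪ N)) := by
    intro f q hq a ha
    have hlt := (h.good f).oriented q hq
    rw [ha] at hlt
    obtain ⟨b, hb, _⟩ := (hgt f).monoOrder.of_single hlt
    have hqe : q = ({a}, {b}) := Prod.ext ha hb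
    exact hsub (.inr ⟨b, h.part f (by rwa [hqe] at hq)⟩)
  rw [withTodo_empty] at hp
  exact ⟨⟨isConstSystem_constSystem _, h.good, fun f q hq a ha => .inl (hleft f q hq a ha),
    fun f _ => hleft f, fun p hp => hp.elim, fun _ f hf => absurd (Set.mem_univ f) hf⟩,
    presents_constSystem hp⟩

/-- A constant rule of `R f` would have its left side in `cdom RC` and so be affected; hence an
unaffected system has no constant rules. -/
theorem PropInv.skip (h : PropInv gt RC N todo todoᶜ R) (hp : Presents SC Sf (RC ∪ N) R)
    (hf : f ∈ todo) (ha : affected RC (R f) = ∅) :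
    ConfigInv gt SC Sf (.propagating RC N (todo \ {f}) R) := by
  have hnorm : ∀ q ∈ R f, ∀ c ∈ q.1, c ∉ cdom RC := by
    intro q hq
    rw [← normal_constRules]
    by_contra hn
    exact Set.eq_empty_iff_forall_notMem.1 ha q ⟨hq, hn⟩
  refine ⟨⟨h.const, h.good, h.left, ?_, h.new, ?_⟩, hp⟩
  · intro g hg
    exact h.left_todo g fun hg' => hg fun h => hg' h.1
  · intro hN g hg
    by_cases hgf : g = f
    · subst hgf
      refine ⟨fun p hp => ?_, .inr hnorm⟩
      exact absurd (h.left_todo g (fun h => h hf) _ hp p.1 rfl) (hnorm _ hp p.1 (by simp))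
    · exact h.fits hN g fun hg' => hg ⟨hg', hgf⟩

theorem PropInv.beginUpdate [Finite K] (hgt : ∀ f, IsAdmissible (gt f))
    (h : PropInv gt RC N todo todoᶜ R) (hp : Presents SC Sf (RC ∪ N) R) (hf : f ∈ todo) :
    ConfigInv gt SC Sf (.updating RC N (todo \ {f}) R f (updStart (R f) RC)) := by
  refine ⟨⟨h.const, h.good, h.left, ?_, h.new, ?_⟩, fun hf' => hf'.2 rfl,
    updStart_good (hgt f).monoOrder h.const (h.good f),
    updStart_inv (h.left_todo f fun hf' => hf' hf), ?_⟩
  · intro g hg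
    refine h.left_todo g fun hg' => hg ⟨fun h => hg' h.1, fun h => hg' (h ▸ hf)⟩
  · intro hN g hg
    exact h.fits hN g fun hg' => hg.1 ⟨hg', hg.2⟩
  · refine hp.of_sat_iff fun E => ?_
    have hR : (updStart (R f) RC).R ∪ ((updStart (R f) RC).S ∪ (updStart (R f) RC).T) =
        constRules RC ∪ R f := by
      simp only [updStart, Set.union_empty, Set.union_assoc]
      rw [Set.sdiff_union_of_subset fun q hq => hq.1]
    rw [sat_update, hR, Sat, satF_union, satF_constRules]
    simp only [updStart, satC_union]
    constructor
    · rintro ⟨⟨h1, _⟩, ⟨_, h2⟩, h3⟩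
      refine ⟨h1, fun g => ?_⟩
      by_cases hg : g = f
      · exact hg ▸ h2
      · exact h3 g hg
    · rintro ⟨h1, h2⟩
      exact ⟨⟨h1, satC_empty⟩, ⟨h1.1, h2 f⟩, fun g _ => h2 g⟩

theorem PropInv.endUpdate {Rf : Rules K} {NRC : Set (K × K)}
    (h : PropInv gt RC N todo {g | g ∉ todo ∧ g ≠ f} R) (hf : f ∉ todo)
    (hg : Good (ltOf (gt f)) Rf ∅) (hu : UpdInv RC Rf NRC)
    (hp : Presents SC Sf (RC ∪ N ∪ NRC) (Function.update R f Rf)) :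
    ConfigInv gt SC Sf (.propagating RC (N ∪ NRC) todo (Function.update R f Rf)) := by
  refine ⟨⟨h.const, ?_, ?_, ?_, ?_, ?_⟩, by rwa [← Set.union_assoc]⟩
  · rw [Function.forall_update_iff R (p := fun g X => Good (ltOf (gt g)) X ∅)]
    exact ⟨hg, fun g _ => h.good g⟩
  · rw [Function.forall_update_iff R (p := fun _ X => ∀ q ∈ X, ∀ a, q.1 = {a} →
      a ∈ cdom RC ∪ cdom (N ∪ NRC))]
    simp only [cdom_union]
    refine ⟨fun q hq a ha => (hu.left_mem q hq a ha).imp id .inr, fun g _ q hq a ha =>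
      (h.left g q hq a ha).imp id .inl⟩
  · intro g hg
    have hg : g ∈ todo := not_not.1 hg
    have hgf : g ≠ f := fun h => hf (h ▸ hg)
    rw [Function.update_of_ne hgf]
    exact h.left_todo g fun h => h.1 hg
  · rintro p (hp | hp)
    · exact h.new p hp
    · exact hu.new p hp
  · intro hN g hg
    rw [Set.union_empty_iff] at hN
    by_cases hgf : g = f
    · subst hgf
      rw [Function.update_self]
      obtain ⟨h1, h2⟩ := hu.same hN.2
      exact ⟨h2, .inl h1⟩
    · rw [Function.update_of_ne hgf]
      exact h.fits hN.1 g ⟨hg, hgf⟩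

theorem PropInv.nextRound [Finite K] (h : PropInv gt RC N ∅ ∅ᶜ R)
    (hp : Presents SC Sf (RC ∪ N) R) :
    ConfigInv gt SC Sf (.propagating (constSystem (RC ∪ N)) ∅ Set.univ R) := by
  have hsub := cdom_subset_constSystem_union (RC := RC) (N := N) (fun p hp => h.const.lt hp)
    fun p hp => (h.new p hp).1
  exact ⟨⟨isConstSystem_constSystem _, h.good,
    fun f q hq a ha => .inl (hsub (h.left f q hq a ha)),
    fun f _ q hq a ha => hsub (h.left f q hq a ha), fun p hp => hp.elim,
    fun _ f hf => absurd (Set.mem_univ f) hf⟩, presents_constSystem hp⟩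

/-- Rules in `NRC` count as equations even after interreduction has changed them in `st.R`; as
consequences of the state they add nothing. -/
theorem presents_update_step {st st' : UpdState K}
    (hp : Presents SC Sf (RC ∪ N ∪ st.NRC) (Function.update R f (st.R ∪ (st.S ∪ st.T))))
    (hc : ∀ x y, Cong (st'.R ∪ (st'.S ∪ st'.T)) x y ↔ Cong (st.R ∪ (st.S ∪ st.T)) x y)
    (hN : st.NRC ⊆ st'.NRC)
    (hN' : ∀ p ∈ st'.NRC, p ∈ st.NRC ∨ Cong (st.R ∪ (st.S ∪ st.T)) {p.1} {p.2}) :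
    Presents SC Sf (RC ∪ N ∪ st'.NRC) (Function.update R f (st'.R ∪ (st'.S ∪ st'.T))) := by
  refine hp.of_sat_iff fun E => ?_
  rw [sat_update, sat_update, satF_congr hc, satC_union, satC_union (A' := st.NRC)]
  constructor
  · rintro ⟨⟨h1, h2⟩, h3⟩
    exact ⟨⟨h1, fun p hp => h2 p (hN hp)⟩, h3⟩
  · rintro ⟨⟨h1, h2⟩, h3, h4⟩
    refine ⟨⟨h1, fun p hp => ?_⟩, h3, h4⟩
    rcases hN' p hp with hp | hp
    · exact h2 p hp
    · have := h3.cong hp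
      rwa [monoVal_singleton, monoVal_singleton, termClass_eq] at this

end Steps

/-! ### Invariance, decrease of the measure and progress for the whole algorithm -/

variable {gt SC Sf}

theorem CombStep.invariant [Finite F] [Finite K] (hgt : ∀ f, IsAdmissible (gt f))
    (hfin : ∀ f, (Sf f).Finite) (hne : ∀ f, ∀ e ∈ Sf f, e.1 ≠ 0 ∧ e.2 ≠ 0) {c c' : Config F K}
    (h : CombStep gt Sf c c') (hc : ConfigInv gt SC Sf c) :
    ConfigInv gt SC Sf c' ∧ MeasureLt (configMeasure c') (configMeasure c) := by
  have hcard : ∀ {todo : Set F} {f : F}, f ∈ todo → (todo \ {f}).ncard < todo.ncard := fun hf =>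
    Set.ncard_sdiff_singleton_lt_of_mem hf (Set.toFinite _)
  cases h with
  | beginCompletion RC N todo R f hf =>
    refine ⟨hc.1.beginCompletion hgt hfin hne hc.2 hf, .right _ (.right _ (.left _ _ ?_))⟩
    have := hcard hf
    omega
  | completion RC N todo R f st st' hs =>
    obtain ⟨h1, h2, h3, h4, h5⟩ := hc
    obtain ⟨i1, i2, i3, i4⟩ := hs.invariant (hgt f).monoOrder h3
    refine ⟨⟨h1, h2, i1, i3 _ h4, h5.of_sat_iff fun E => ?_⟩, .right _ (.right _ (.right _ i4))⟩
    rw [sat_update, sat_update, satF_congr i2]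
  | endCompletion RC N todo R f Rf =>
    obtain ⟨h1, h2, h3, h4, h5⟩ := hc
    exact ⟨h1.endCompletion hgt h2 h3 h4 h5, .right _ (.right _ (.left _ _ (Nat.lt_succ_self _)))⟩
  | noNewConst RC N R hN => exact ⟨hc.1.done hc.2 hN, .left _ _ (by norm_num)⟩
  | newConst RC N R hN => exact ⟨hc.1.propagate hgt hc.2, .left _ _ (by norm_num)⟩
  | skipUpdate RC N todo R f hf ha =>
    refine ⟨hc.1.skip hc.2 hf ha, .right _ (.right _ (.left _ _ ?_))⟩
    have := hcard hf
    omega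
  | beginUpdate RC N todo R f hf ha =>
    refine ⟨hc.1.beginUpdate hgt hc.2 hf, .right _ (.right _ (.left _ _ ?_))⟩
    have := hcard hf
    omega
  | update RC N todo R f st st' hs =>
    obtain ⟨h1, h2, h3, h4, h5⟩ := hc
    obtain ⟨i1, i2, i3, ⟨i4, i5⟩, i6⟩ := hs.invariant (hgt f).monoOrder h3 h4
    exact ⟨⟨h1, h2, i1, i2, presents_update_step h5 i3 i4 i5⟩, .right _ (.right _ (.right _ i6))⟩
  | endUpdate RC N todo R f Rf NRC =>
    obtain ⟨h1, h2, h3, h4, h5⟩ := hc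
    simp only [Set.union_empty] at h3 h5
    exact ⟨h1.endUpdate h2 h3 h4 h5, .right _ (.right _ (.left _ _ (Nat.lt_succ_self _)))⟩
  | finish RC R =>
    obtain ⟨h1, h2⟩ := hc
    rw [Set.union_empty] at h2
    exact ⟨⟨h1.const, h1.good, fun f => h1.fits rfl f id, h2⟩, .left _ _ (by norm_num)⟩
  | nextRound RC N R hN =>
    exact ⟨hc.1.nextRound hc.2, .right _ (.left _ _
      (constSystem_union_dom_lt hc.1.const hc.1.new (Set.nonempty_iff_ne_empty.2 hN)))⟩

theorem configInv_combStart [Finite K] : ConfigInv gt SC Sf (combStart SC) := by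
  refine ⟨⟨isConstSystem_constSystem _, fun _ => good_empty, fun _ _ h => h.elim,
    fun _ _ h => h.elim, fun _ h => h.elim, fun _ _ => rfl⟩, fun E => ?_⟩
  rw [Set.union_empty, Sat, Sat, satC_constSystem]
  refine and_congr_right fun _ => forall_congr' fun f => ?_
  rw [satF_withTodo]
  exact ⟨fun h => h.2 trivial, fun h => ⟨satF_empty, fun _ => h⟩⟩

theorem eq_done_of_stuck (hgt : ∀ f, IsAdmissible (gt f)) {c : Config F K}
    (hc : ConfigInv gt SC Sf c) (hstuck : ∀ c', ¬ CombStep gt Sf c c') :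
    ∃ RC R, c = .done RC R := by
  cases c with
  | firstLoop RC N todo R =>
    rcases todo.eq_empty_or_nonempty with rfl | ⟨f, hf⟩
    · by_cases h : constSystem (RC ∪ N) = RC
      · exact absurd (.noNewConst RC N R h) (hstuck _)
      · exact absurd (.newConst RC N R h) (hstuck _)
    · exact absurd (.beginCompletion RC N todo R f hf) (hstuck _)
  | completing RC N todo R f st =>
    obtain ⟨Rf, T⟩ := st
    by_cases hT : T = ∅
    · subst hT
      exact absurd (.endCompletion RC N todo R f Rf) (hstuck _)
    · obtain ⟨st', h⟩ := exists_completionStep (hgt f) hc.2.2.1 hT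
      exact absurd (.completion RC N todo R f _ _ h) (hstuck _)
  | propagating RC N todo R =>
    rcases todo.eq_empty_or_nonempty with rfl | ⟨f, hf⟩
    · by_cases h : N = ∅
      · subst h
        exact absurd (.finish RC R) (hstuck _)
      · exact absurd (.nextRound RC N R h) (hstuck _)
    · by_cases h : affected RC (R f) = ∅
      · exact absurd (.skipUpdate RC N todo R f hf h) (hstuck _)
      · exact absurd (.beginUpdate RC N todo R f hf h) (hstuck _)
  | updating RC N todo R f st =>
    obtain ⟨Rf, NRC, S, T⟩ := st
    by_cases hST : S = ∅ ∧ T = ∅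
    · obtain ⟨rfl, rfl⟩ := hST
      exact absurd (.endUpdate RC N todo R f Rf NRC) (hstuck _)
    · obtain ⟨st', h⟩ := exists_updateStep (hgt f) hc.2.2.1 hST
      exact absurd (.update RC N todo R f _ _ h) (hstuck _)
  | done RC R => exact ⟨RC, R, rfl⟩

end Combination

end ACClosure

/-! ### The main theorem -/

theorem theorem7p1 {F C K : Type*} [Finite F] [DecidableEq F] [Finite K] [LinearOrder K]
    (i : C ↪ K) (S : Set (GTerm F C × GTerm F C)) (hS : S.Finite)
    (ν : ACTerm F C → K) (hν : IsNaming i S ν)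
    (gt : F → Multiset K → Multiset K → Prop) (hgt : ∀ f, IsAdmissible (gt f)) :
    -- every run of the algorithm is finite
    (¬ ∃ run : ℕ → Config F K, run 0 = combStart (purifyConst i ν S) ∧
        ∀ n, CombStep gt (purifyAC i ν S) (run n) (run (n + 1))) ∧
    -- and where it stops, it has returned a system `R_S = RC ∪ ⋃ f, R f` as required
    ∀ c : Config F K,
      Relation.ReflTransGen (CombStep gt (purifyAC i ν S)) (combStart (purifyConst i ν S)) c →
      (∀ c', ¬ CombStep gt (purifyAC i ν S) c c') →
      ∃ (RC : Set (K × K)) (R : F → Rules K), c = .done RC R ∧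
        -- finite, and oriented by the given orderings
        RC.Finite ∧ (∀ f, (R f).Finite) ∧
        (∀ a b, (a, b) ∈ RC → b < a) ∧ (∀ f A B, (A, B) ∈ R f → gt f A B) ∧
        -- canonical on the ground terms of the extended signature
        Canonical (ACStep (toTermPairs RC R)) ∧
        -- presents the closure of the purified equations in the extended signature
        (∀ u v : GTerm F K, ACCC (toTermPairs RC R) u v ↔
          ACCC (toTermPairs (purifyConst i ν S) (purifyAC i ν S)) u v) ∧
        -- and, restricted to the original signature, the closure of `S`
        (∀ u v : GTerm F C, ACCC (toTermPairs RC R) (u.map i) (v.map i) ↔ ACCC S u v) := by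
  have hstep : ∀ {c c'}, CombStep gt (purifyAC i ν S) c c' →
      ConfigInv gt (purifyConst i ν S) (purifyAC i ν S) c → _ := fun h hc =>
    h.invariant hgt (purifyAC_finite hS) purifyAC_ne_zero hc
  refine ⟨?_, fun c hc hstuck => ?_⟩
  · rintro ⟨run, h0, hrun⟩
    have hinv : ∀ n, ConfigInv gt (purifyConst i ν S) (purifyAC i ν S) (run n) := by
      intro n
      induction n with
      | zero => rw [h0]; exact configInv_combStart
      | succ n ih => exact (hstep (hrun n) ih).1
    exact (wellFounded_iff_isEmpty_descending_chain.1 (wellFounded_measureLt (K := K))).elim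
      ⟨fun n => configMeasure (run n), fun n => (hstep (hrun n) (hinv n)).2⟩
  · have hinv : ConfigInv gt (purifyConst i ν S) (purifyAC i ν S) c := by
      clear hstuck
      induction hc with
      | refl => exact configInv_combStart
      | tail _ h ih => exact (hstep h ih).1
    obtain ⟨RC, R, rfl⟩ := eq_done_of_stuck hgt hinv hstuck
    obtain ⟨hRC, hg, hfit, hpres⟩ := hinv
    have hlt := fun f => (hgt f).monoOrder
    obtain ⟨nf, hnf⟩ := exists_normalForms hlt hRC hfit hg
    have hiff := accc_iff_of_sat_iff
      (fun f p hp => ((hlt f).ne_zero ((hg f).oriented p hp)).symm) purifyAC_ne_zero hpres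
    refine ⟨RC, R, rfl, Set.toFinite _, fun f => (hg f).finite_rules, fun a b h => hRC.lt h,
      fun f A B h => ((hg f).oriented _ h).2.2,
      ⟨terminating_acStep hlt (fun p hp => hRC.lt hp) fun f => (hg f).oriented,
        hnf.locallyConfluent⟩, hiff, fun u v => ?_⟩
    rw [hiff]
    exact ⟨accc_of_accc_map hν, accc_map_of_accc⟩
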